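/- Let $0\le m\le n$ be integers, let $\alpha>1$ be real, and let $\nu_k\in[0,1]$, $\mu_k\in\mathbb R$ with $\mu_k^2=1-\nu_k^2$ for $1\le k\le m$. Put $J=\begin{pmatrix}0&1\\-1&0\end{pmatrix}$ and $$\Gamma_{\mathrm{can}}=\bigoplus_{k=1}^m\Gamma_k\oplus\bigoplus_{k=m+1}^{n}J,\qquad \Gamma_k=\begin{pmatrix}\nu_kJ&\mu_k\mathbb 1_2\\-\mu_k\mathbb 1_2&-\nu_kJ\end{pmatrix},$$ a $(2m+2n)\times(2m+2n)$ matrix whose indices (Majoranas) are split into a set $A$ of size $2m$ (the first two indices of each $\Gamma_k$) and a set $B$ of size $2n$ (the last two indices of each $\Gamma_k$, and the indices of the blocks $J$). Call the $n$ summands the blocks $1,\dots,n$. For a real skew-symmetric matrix $\Gamma$ of this size let $$F_\alpha(\Gamma)=\sum_X|\operatorname{pf}(\Gamma_X)|^{2\alpha},\qquad M_\alpha(\Gamma)=\frac1{1-\alpha}\log\sum_X\Bigl(\frac{\det\Gamma_X}{\det(\mathbb 1+\Gamma)}\Bigr)^{\alpha}-\log 2^{m+n},$$ where $X$ runs over all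 sets of indices, $\Gamma_X$ is the principal submatrix on $X$, and Pfaffians and determinants of odd-sized $\Gamma_X$ are zero. Let $\mathcal O=\{(O_A\oplus O_B)\Gamma_{\mathrm{can}}(O_A\oplus O_B)^T: O_A\in O(2m),\ O_B\in O(2n)\}$. For $K=K_A\oplus K_B$ with $K_A,K_B$ real skew-symmetric put $f(K)=F_\alpha(e^{K}\Gamma_{\mathrm{can}}e^{-K})$. Then the following hold. 1. $f$ is $C^2$ near $0$ with $df(0)=0$ (so $\Gamma_{\mathrm{can}}$ is a critical point of $F_\alpha$ on $\mathcal O$), and $\Gamma_{\mathrm{can}}$ is a local maximum of $F_\alpha$ restricted to $\mathcal O$. 2. $M_\alpha(\Gamma_{\mathrm{can}})=M^{\mathrm{NL}}_{\alpha,>}:=\frac1{1-\alpha}\sum_{k=1}^m\log\frac{1+|\nu_k|^{2\alpha}+|\mu_k|^{2\alpha}}2$, and $\Gamma_{\mathrm{can}}$ is a local minimum of $M_\alpha$ restricted to $\mathcal O$. 3. Let $H_\alpha$ be the Hessian of $f$ at $0$, and for each block $c$ let $S_c$ be the diagonal matrix with entries $-1$ on the indices of block $c$ and $+1$ elsewhere.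 Then $S_c\Gamma_{\mathrm{can}}S_c^T=\Gamma_{\mathrm{can}}$, $F_\alpha(S_c\Gamma S_c^T)=F_\alpha(\Gamma)$ for every real skew-symmetric $\Gamma$, and $H_\alpha(S_cKS_c^T,S_cK'S_c^T)=H_\alpha(K,K')$. For blocks $d,e$, let $V_{de}=V_{ed}$ be the space of those $K$ whose entries vanish except between the blocks $d$ and $e$ (for $d=e$: the intra-block sector $W_d$). For $K\in V_{de}$ one has $S_cKS_c^T=-K$ if exactly one of $d,e$ equals $c$, and $S_cKS_c^T=K$ otherwise. If $\{c,d\}\ne\{e,g\}$, then $H_\alpha(K,K')=0$ for all $K\in V_{cd}$, $K'\in V_{eg}$. Hence, writing $K^{(cd)}$ for the component of $K$ in $V_{cd}$, $$H_\alpha(K,K)=\sum_{c}H_\alpha(K^{(cc)},K^{(cc)})+\sum_{c<d}H_\alpha(K^{(cd)},K^{(cd)}).$$ 4. $H_\alpha$ is negative semidefinite. 5. For distinct $c,d\le m$ the space $V_{cd}$ has dimension $8$. If $\alpha=2$ and $\nu_c\neq\nu_d$, then $H_2$ is negative definite on $V_{cd}$. If $\alpha=2$, then without any condition on $\nu_c,\nu_d$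 one has $H_2(K,K)<0$ for every $K\in V_{cd}$ with $[K,\Gamma_{\mathrm{can}}]\ne0$ (that is, $H_2$ is negative definite on the corresponding space of tangent vectors $[K,\Gamma_{\mathrm{can}}]$ of $\mathcal O$). -/

import Mathlib

open scoped Nat Matrix

/-- The `2m + 2n` Majorana modes: `a k i` is the `i`-th Majorana of the `k`-th mode of subsystem `A`
(`m` modes), and `b k i` is the `i`-th Majorana of the `k`-th mode of subsystem `B` (`n` modes). -/
inductive Majorana (m n : ℕ) where
  | a (k : Fin m) (i : Fin 2) : Majorana m n
  | b (k : Fin n) (i : Fin 2) : Majorana m n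

namespace Majorana

variable {m n : ℕ}

/-- Position of a Majorana in the list of all Majoranas: first those of `A`, then those of `B`. -/
def position : Majorana m n → ℕ
  | a k i => 2 * (k : ℕ) + (i : ℕ)
  | b k i => 2 * m + 2 * (k : ℕ) + (i : ℕ)

theorem position_injective : Function.Injective (position : Majorana m n → ℕ) := by
  rintro (⟨k, i⟩ | ⟨k, i⟩) (⟨l, j⟩ | ⟨l, j⟩) h
  all_goals
    simp only [position] at h
    have hk := k.isLt
    have hl := l.isLt
    have hi := i.isLt
    have hj := j.isLt
  · obtain rfl : k = l := Fin.ext (by omega)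
    obtain rfl : i = j := Fin.ext (by omega)
    rfl
  · omega
  · omega
  · obtain rfl : k = l := Fin.ext (by omega)
    obtain rfl : i = j := Fin.ext (by omega)
    rfl

instance : LinearOrder (Majorana m n) := LinearOrder.lift' position position_injective

/-- Majoranas as a disjoint union. -/
def equivSum : Majorana m n ≃ (Fin m × Fin 2) ⊕ (Fin n × Fin 2) where
  toFun
    | a k i => Sum.inl (k, i)
    | b k i => Sum.inr (k, i)
  invFun
    | Sum.inl (k, i) => a k i
    | Sum.inr (k, i) => b k i
  left_inv := by rintro (⟨k, i⟩ | ⟨k, i⟩) <;> rfl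
  right_inv := by rintro (⟨k, i⟩ | ⟨k, i⟩) <;> rfl

instance : Fintype (Majorana m n) := Fintype.ofEquiv _ equivSum.symm

/-- Whether a Majorana belongs to subsystem `A`. -/
def inA : Majorana m n → Bool
  | a _ _ => true
  | b _ _ => false

/-- The canonical block to which a Majorana belongs, for `m ≤ n`. Block `k` consists of the `k`-th
modes of `A` and `B` if `k < m`, and of the `k`-th mode of `B` only if `m ≤ k < n`. -/
def block (h : m ≤ n) : Majorana m n → Fin n
  | a k _ => Fin.castLE h k
  | b k _ => k

end Majorana

noncomputable section

/-- The Pfaffian of an `N × N` matrix, for even `N = 2r`: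
`(1 / (2 ^ r * r!)) * ∑ σ, sign σ * ∏ i < r, A (σ (2 i)) (σ (2 i + 1))`; it is `0` for odd `N`. -/
def pfaffian {N : ℕ} (A : Matrix (Fin N) (Fin N) ℝ) : ℝ :=
  if Even N then
    (∑ σ : Equiv.Perm (Fin N), ((Equiv.Perm.sign σ : ℤ) : ℝ) *
      ∏ i : Fin (N / 2), A (σ ⟨2 * (i : ℕ), by omega⟩) (σ ⟨2 * (i : ℕ) + 1, by omega⟩)) /
      ((2 : ℝ) ^ (N / 2) * ((N / 2)! : ℝ))
  else 0

section
variable {ι : Type*} [LinearOrder ι]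

/-- `pf (Γ_X)`, where `Γ_X` is the principal submatrix on the increasingly ordered index set `X`. -/
def pfMinor (Γ : Matrix ι ι ℝ) (X : Finset ι) : ℝ :=
  pfaffian (Γ.submatrix (X.orderEmbOfFin rfl) (X.orderEmbOfFin rfl))

/-- `F_α(Γ) = ∑_X |pf (Γ_X)| ^ (2 α)`. -/
def pfaffianSum [Fintype ι] (α : ℝ) (Γ : Matrix ι ι ℝ) : ℝ :=
  ∑ X : Finset ι, |pfMinor Γ X| ^ (2 * α)

end

section
variable {m n : ℕ}

/-- The `α`-stabilizer Rényi entropy of the Gaussian state on `L = m + n` qubits with covariance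
matrix `Γ`: `(1 - α)⁻¹ log ∑_X (det Γ_X / det (1 + Γ)) ^ α - log 2 ^ L`. -/
def gaussianMagic (α : ℝ) (Γ : Matrix (Majorana m n) (Majorana m n) ℝ) : ℝ :=
  1 / (1 - α) * Real.log (∑ X : Finset (Majorana m n),
      ((Γ.submatrix (Subtype.val : X → Majorana m n) Subtype.val).det / (1 + Γ).det) ^ α)
    - Real.log ((2 : ℝ) ^ (m + n))

/-- The closed form `M_{α,>}^NL = (1 - α)⁻¹ ∑_k log ((1 + |ν_k| ^ (2α) + |μ_k| ^ (2α)) / 2)`. -/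
def nonlocalMagicBound (α : ℝ) (ν μ : Fin m → ℝ) : ℝ :=
  1 / (1 - α) * ∑ k, Real.log ((1 + |ν k| ^ (2 * α) + |μ k| ^ (2 * α)) / 2)

/-- The matrix `J = [[0, 1], [-1, 0]]`. -/
def matJ : Matrix (Fin 2) (Fin 2) ℝ := !![0, 1; -1, 0]

/-- The canonical covariance matrix `⨁_{k < m} Γ_k ⊕ ⨁_{m ≤ l < n} J`, where `Γ_k` couples the
`k`-th modes of `A` and `B` by `[[ν_k J, μ_k 1], [-μ_k 1, -ν_k J]]`. -/
def canonicalCov (ν μ : Fin m → ℝ) : Matrix (Majorana m n) (Majorana m n) ℝ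
  | .a k i, .a l j => if k = l then ν k * matJ i j else 0
  | .a k i, .b l j => if (k : ℕ) = (l : ℕ) ∧ i = j then μ k else 0
  | .b k i, .a l j => if (k : ℕ) = (l : ℕ) ∧ i = j then -μ l else 0
  | .b k i, .b l j =>
    if k = l then (if hk : (k : ℕ) < m then -ν ⟨k, hk⟩ else 1) * matJ i j else 0

/-- The direct sum `O_A ⊕ O_B`. -/
def localSum (OA : Matrix (Fin m × Fin 2) (Fin m × Fin 2) ℝ)
    (OB : Matrix (Fin n × Fin 2) (Fin n × Fin 2) ℝ) :
    Matrix (Majorana m n) (Majorana m n) ℝ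
  | .a k i, .a l j => OA (k, i) (l, j)
  | .b k i, .b l j => OB (k, i) (l, j)
  | _, _ => 0

/-- The orbit `{(O_A ⊕ O_B) Γ (O_A ⊕ O_B)ᵀ}` with `O_A ∈ O(2m)` and `O_B ∈ O(2n)`. -/
def localOrbit (Γ : Matrix (Majorana m n) (Majorana m n) ℝ) :
    Set (Matrix (Majorana m n) (Majorana m n) ℝ) :=
  {Γ' | ∃ OA ∈ Matrix.orthogonalGroup (Fin m × Fin 2) ℝ,
    ∃ OB ∈ Matrix.orthogonalGroup (Fin n × Fin 2) ℝ,
      Γ' = localSum OA OB * Γ * (localSum OA OB)ᵀ}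

variable (m n) in
/-- The infinitesimal local Gaussian transformations `K = K_A ⊕ K_B` with `K_A`, `K_B`
skew-symmetric. The ambient space of arrays carries the sup norm. -/
def LocalGen : Submodule ℝ (Majorana m n → Majorana m n → ℝ) where
  carrier := {K | (∀ i j, K j i = -K i j) ∧ ∀ i j, i.inA ≠ j.inA → K i j = 0}
  add_mem' := by
    rintro K K' ⟨h1, h2⟩ ⟨h1', h2'⟩
    refine ⟨fun i j => ?_, fun i j hij => ?_⟩
    · simp only [Pi.add_apply, h1 i j, h1' i j]; ring
    · simp only [Pi.add_apply, h2 i j hij, h2' i j hij, add_zero]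
  zero_mem' := ⟨fun _ _ => by simp, fun _ _ _ => rfl⟩
  smul_mem' := by
    rintro c K ⟨h1, h2⟩
    refine ⟨fun i j => ?_, fun i j hij => ?_⟩
    · simp only [Pi.smul_apply, smul_eq_mul, h1 i j]; ring
    · simp only [Pi.smul_apply, smul_eq_mul, h2 i j hij, mul_zero]

/-- The generator `K` as a matrix. -/
def genMatrix (K : LocalGen m n) : Matrix (Majorana m n) (Majorana m n) ℝ :=
  Matrix.of K.1

/-- `K ↦ F_α(e^K Γ (e^K)ᵀ)`: the function `F_α` on the orbit of `Γ` in exponential coordinates. -/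
def orbitF (α : ℝ) (Γ : Matrix (Majorana m n) (Majorana m n) ℝ) (K : LocalGen m n) : ℝ :=
  pfaffianSum α (NormedSpace.exp (genMatrix K) * Γ * (NormedSpace.exp (genMatrix K))ᵀ)

/-- The Hessian at the origin of `F_α` on the orbit of `Γ`, as a bilinear form on generators. -/
def orbitHessian (α : ℝ) (Γ : Matrix (Majorana m n) (Majorana m n) ℝ) (K K' : LocalGen m n) : ℝ :=
  fderiv ℝ (fderiv ℝ (orbitF α Γ)) 0 K K'

/-- The generators all of whose entries `K i j` lie between the blocks `c` and `d`. For `c = d`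
this is the intra-block sector of `c`; for `c ≠ d` it is the two-block mixing channel of `c, d`. -/
def channel (h : m ≤ n) (c d : Fin n) : Submodule ℝ (LocalGen m n) where
  carrier := {K | ∀ i j, s(i.block h, j.block h) ≠ s(c, d) → K.1 i j = 0}
  add_mem' := by
    intro K K' hK hK' i j hij
    have h1 := hK i j hij
    have h2 := hK' i j hij
    simp [h1, h2]
  zero_mem' := fun _ _ _ => rfl
  smul_mem' := by
    intro r K hK i j hij
    have h1 := hK i j hij
    simp [h1]

/-- The component of a generator in `channel h c d`. -/
def channelPart (h : m ≤ n) (c d : Fin n) (K : LocalGen m n) : LocalGen m n :=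
  ⟨fun i j => if s(i.block h, j.block h) = s(c, d) then K.1 i j else 0, by
    refine ⟨fun i j => ?_, fun i j hij => ?_⟩
    · simp only [Sym2.eq_swap (a := j.block h)]
      split_ifs
      · exact K.2.1 i j
      · simp
    · simp only [K.2.2 i j hij, ite_self]⟩

/-- The signs `-1` on the Majoranas of block `c` and `1` on all others. -/
def flipSign (h : m ≤ n) (c : Fin n) (i : Majorana m n) : ℝ :=
  if i.block h = c then -1 else 1

/-- The sign flip `S_c`. -/
def signFlip (h : m ≤ n) (c : Fin n) : Matrix (Majorana m n) (Majorana m n) ℝ :=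
  Matrix.diagonal (flipSign h c)

/-- `S_c K S_cᵀ`, written entrywise. -/
def flipGen (h : m ≤ n) (c : Fin n) (K : LocalGen m n) : LocalGen m n :=
  ⟨fun i j => flipSign h c i * K.1 i j * flipSign h c j, by
    refine ⟨fun i j => ?_, fun i j hij => ?_⟩
    · simp only [K.2.1 i j]; ring
    · simp only [K.2.2 i j hij, mul_zero, zero_mul]⟩

/-- `flipGen` is conjugation by the sign flip. -/
theorem genMatrix_flipGen (h : m ≤ n) (c : Fin n) (K : LocalGen m n) :
    genMatrix (flipGen h c K) = signFlip h c * genMatrix K * (signFlip h c)ᵀ := by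
  ext i j
  simp [flipGen, genMatrix, signFlip, Matrix.diagonal_mul, Matrix.mul_diagonal]

end

end

/-! Since pf² = det for skew matrices, F_α(Γ) = ∑_X (det Γ_X)^α. As 2α > 2, each summand |pf
Γ_X|^(2α) is C² in Γ, and a minor with vanishing Pfaffian contributes nothing to first or second
order. At the other minors Jacobi's formula applies along the flow e^{tK} Γ e^{-tK}: with R the
inverse of Γ_X extended by zero, A₁ = [K, Γ] and A₂ = [K, A₁], the first derivative is a multiple of
tr(R A₁), which is always 0, and the second is α (det Γ_X)^α (tr(R A₂) - tr(R A₁ R A₁)).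

The canonical matrix is block diagonal, so the weights (det Γ_X)^α define, after normalization, a
product measure on the parts of X in the blocks. Hence the Hessian is a sum of terms attached to
pairs of blocks (`orbitF_derivs_eq`), and this alone gives the decoupling into channels and the
sign-flip invariance. For distinct blocks only the mean of R in each block matters; it is -1/(2S)
times the block with parameters ν̂ = ν(1 + |ν|^(2α-2)) and μ̂ = μ(1 + |μ|^(2α-2)), where S = νν̂ +
μμ̂ (`blockMeanInv_eq`).

A pair of distinct blocks then contributes a quadratic form in 8 variables that diagonalizes into
four pieces indexed by signs σ, τ (`trace_covBlock_channel`). The weight of a piece is positive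
unless (ν, μ) = (σν', τμ'), when it is 0; this is an inequality for two points of the unit circle
(`gapPoly_enhance_pos`). A single block contributes a nonpositive multiple of |μ|^(2α) (a - b)²,
with a and b the rotation rates in A and B (`pairForm_self`). In each case a vanishing contribution
forces the corresponding block of [K, Γ] to vanish. So the Hessian is negative semidefinite and its
null vectors all commute with Γ (`orbitHessian_nonpos`). If ν_c ≠ ν_d, no nonzero K of the channel
commutes with Γ, whence definiteness.

A degenerate Hessian yields a local maximum here because its null directions are tangent to the
stabilizer of Γ. If points of the orbit with larger F_α converged to Γ, they could be written as g Γ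
gᵀ with g closest to the identity among its translates by the stabilizer. Then g → 1, g = e^K, and
the directions K/‖K‖ accumulate at a unit vector u with nonnegative Hessian, hence commuting with Γ.
The choice of g makes g trace-orthogonal to u, and in the limit tr(u²) = 0, so u = 0, a
contradiction (`isLocalMaxOn_localOrbit`).

On the orbit det(1 + Γ) = 2^(m+n), so M_α is an affine function of log F_α with negative slope 1/(1
- α); its value at Γ follows from the factorization over blocks. -/

/-! ### The Pfaffian and its square -/

/-- The signed sum over permutations in the Leibniz formula of the Pfaffian. -/
noncomputable def pfaffianLeibniz (r : ℕ) (A : Matrix (Fin (2 * r)) (Fin (2 * r)) ℝ) : ℝ :=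
  ∑ σ : Equiv.Perm (Fin (2 * r)), ((Equiv.Perm.sign σ : ℤ) : ℝ) *
    ∏ i : Fin r, A (σ ⟨2 * (i : ℕ), by omega⟩) (σ ⟨2 * (i : ℕ) + 1, by omega⟩)

theorem pfaffian_eq_leibniz (r : ℕ) (A : Matrix (Fin (2 * r)) (Fin (2 * r)) ℝ) :
    pfaffian A = pfaffianLeibniz r A / (2 ^ r * (r ! : ℝ)) := by
  have h : 2 * r / 2 = r := by omega
  have hd : ((2 : ℝ) ^ (2 * r / 2) * ((2 * r / 2)! : ℝ)) = 2 ^ r * (r ! : ℝ) := by rw [h]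
  unfold pfaffian pfaffianLeibniz
  rw [if_pos (even_two_mul r), hd]
  congr 1
  refine Finset.sum_congr rfl fun σ _ => ?_
  congr 1
  exact Fintype.prod_equiv (finCongr h) _ _ fun i => rfl

theorem pfaffian_of_odd {N : ℕ} (hN : ¬ Even N) (A : Matrix (Fin N) (Fin N) ℝ) :
    pfaffian A = 0 := if_neg hN

/-- The product of the pairings of consecutive vectors. -/
noncomputable def pairingProd (r : ℕ) (A : Matrix (Fin (2 * r)) (Fin (2 * r)) ℝ)
    (w : Fin (2 * r) → Fin (2 * r) → ℝ) : ℝ :=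
  ∏ i : Fin r, (w ⟨2 * (i : ℕ), by omega⟩) ⬝ᵥ (A *ᵥ w ⟨2 * (i : ℕ) + 1, by omega⟩)

/-- The vector in position `j` enters exactly one factor, that of the pair `j / 2`, and that factor
is linear in it. This supplies the multilinearity of the product. -/
theorem pairingProd_update (r : ℕ) (A : Matrix (Fin (2 * r)) (Fin (2 * r)) ℝ)
    (w : Fin (2 * r) → Fin (2 * r) → ℝ) (j : Fin (2 * r)) :
    ∃ L : (Fin (2 * r) → ℝ) →ₗ[ℝ] ℝ, ∀ z, pairingProd r A (Function.update w j z) = L z := by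
  obtain ⟨i, hi⟩ : ∃ i : Fin r, (j : ℕ) = 2 * i ∨ (j : ℕ) = 2 * i + 1 :=
    ⟨⟨j / 2, by omega⟩, by simp only; omega⟩
  have hrest : ∀ z : Fin (2 * r) → ℝ,
      ∏ k ∈ Finset.univ.erase i, (Function.update w j z ⟨2 * (k : ℕ), by omega⟩) ⬝ᵥ
        (A *ᵥ Function.update w j z ⟨2 * (k : ℕ) + 1, by omega⟩) =
      ∏ k ∈ Finset.univ.erase i, (w ⟨2 * (k : ℕ), by omega⟩) ⬝ᵥ
        (A *ᵥ w ⟨2 * (k : ℕ) + 1, by omega⟩) := by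
    intro z
    refine Finset.prod_congr rfl fun k hk => ?_
    have hki : (k : ℕ) ≠ i := fun h => (Finset.ne_of_mem_erase hk) (Fin.ext h)
    rw [Function.update_of_ne (by rw [Ne, Fin.ext_iff]; simp only; omega),
      Function.update_of_ne (by rw [Ne, Fin.ext_iff]; simp only; omega)]
  rcases hi with hi | hi
  · have hj : (⟨2 * (i : ℕ), by omega⟩ : Fin (2 * r)) = j := Fin.ext hi.symm
    have hne : (⟨2 * (i : ℕ) + 1, by omega⟩ : Fin (2 * r)) ≠ j := by
      rw [Ne, Fin.ext_iff]; simp only; omega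
    refine ⟨LinearMap.mk ⟨fun z => z ⬝ᵥ (A *ᵥ w ⟨2 * (i : ℕ) + 1, by omega⟩) *
      ∏ k ∈ Finset.univ.erase i, (w ⟨2 * (k : ℕ), by omega⟩) ⬝ᵥ
        (A *ᵥ w ⟨2 * (k : ℕ) + 1, by omega⟩), fun x y => by rw [add_dotProduct, add_mul]⟩
      (fun c x => by simp [smul_dotProduct, mul_assoc]), fun z => ?_⟩
    rw [pairingProd, ← Finset.mul_prod_erase Finset.univ _ (Finset.mem_univ i), hrest]
    rw [Function.update_of_ne hne, hj, Function.update_self]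
    rfl
  · have hj : (⟨2 * (i : ℕ) + 1, by omega⟩ : Fin (2 * r)) = j := Fin.ext hi.symm
    have hne : (⟨2 * (i : ℕ), by omega⟩ : Fin (2 * r)) ≠ j := by
      rw [Ne, Fin.ext_iff]; simp only; omega
    refine ⟨LinearMap.mk ⟨fun z => (w ⟨2 * (i : ℕ), by omega⟩) ⬝ᵥ (A *ᵥ z) *
      ∏ k ∈ Finset.univ.erase i, (w ⟨2 * (k : ℕ), by omega⟩) ⬝ᵥ
        (A *ᵥ w ⟨2 * (k : ℕ) + 1, by omega⟩),
      fun x y => by rw [Matrix.mulVec_add, dotProduct_add, add_mul]⟩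
      (fun c x => by simp [Matrix.mulVec_smul, dotProduct_smul, mul_assoc]), fun z => ?_⟩
    rw [pairingProd, ← Finset.mul_prod_erase Finset.univ _ (Finset.mem_univ i), hrest]
    rw [Function.update_of_ne hne, hj, Function.update_self]
    rfl

/-- The product of the pairings of consecutive vectors, as a multilinear map. -/
noncomputable def pairingProduct (r : ℕ) (A : Matrix (Fin (2 * r)) (Fin (2 * r)) ℝ) :
    MultilinearMap ℝ (fun _ : Fin (2 * r) => Fin (2 * r) → ℝ) ℝ :=
  MultilinearMap.mk' (pairingProd r A)
    (fun w j x y => by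
      obtain ⟨L, hL⟩ := pairingProd_update r A w j
      simp only [hL, map_add])
    (fun w j c x => by
      obtain ⟨L, hL⟩ := pairingProd_update r A w j
      simp only [hL, map_smul])

theorem pfaffianLeibniz_eq_alternatization (r : ℕ) (A : Matrix (Fin (2 * r)) (Fin (2 * r)) ℝ)
    (w : Fin (2 * r) → Fin (2 * r) → ℝ) :
    pfaffianLeibniz r (Matrix.of w * A * (Matrix.of w)ᵀ) =
      MultilinearMap.alternatization (pairingProduct r A) w := by
  rw [MultilinearMap.alternatization_apply]
  refine Finset.sum_congr rfl fun σ _ => ?_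
  rw [Units.smul_def, zsmul_eq_mul]
  congr 1
  refine Finset.prod_congr rfl fun i _ => ?_
  rw [Matrix.mul_assoc, Matrix.mul_apply]
  simp only [dotProduct, Matrix.mul_apply, Matrix.mulVec, Matrix.transpose_apply, Matrix.of_apply]

/-- As a function of the rows of `B` the left side is an alternating form of top degree, hence a
multiple of the determinant; the standard basis identifies the factor. -/
theorem pfaffianLeibniz_congr (r : ℕ) (A B : Matrix (Fin (2 * r)) (Fin (2 * r)) ℝ) :
    pfaffianLeibniz r (B * A * Bᵀ) = B.det * pfaffianLeibniz r A := by
  have h2 : (Matrix.of fun i => (Pi.basisFun ℝ (Fin (2 * r))) i) = 1 := by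
    ext i j
    simp [Pi.basisFun_apply, Matrix.one_apply, Pi.single_apply, eq_comm]
  have h1 := pfaffianLeibniz_eq_alternatization r A (fun i => (Pi.basisFun ℝ (Fin (2 * r))) i)
  rw [h2, Matrix.transpose_one, Matrix.mul_one, Matrix.one_mul] at h1
  have h3 := pfaffianLeibniz_eq_alternatization r A (fun i => B i)
  have hB : Matrix.of (fun i => B i) = B := rfl
  rw [hB] at h3
  rw [h3, h1]
  conv_lhs => rw [AlternatingMap.eq_smul_basis_det (Pi.basisFun ℝ (Fin (2 * r)))
      (MultilinearMap.alternatization (pairingProduct r A))]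
  rw [AlternatingMap.smul_apply, Pi.basisFun_det_apply, smul_eq_mul, mul_comm]
  rfl

/-- The first position of the `i`-th pair of consecutive positions. -/
def pairFst {r : ℕ} (i : Fin r) : Fin (2 * r) := ⟨2 * (i : ℕ), by omega⟩

/-- The second position of the `i`-th pair of consecutive positions. -/
def pairSnd {r : ℕ} (i : Fin r) : Fin (2 * r) := ⟨2 * (i : ℕ) + 1, by omega⟩

@[simp] theorem pairFst_inj {r : ℕ} {i j : Fin r} : pairFst i = pairFst j ↔ i = j := by
  simp only [pairFst, Fin.ext_iff]; omega

@[simp] theorem pairSnd_inj {r : ℕ} {i j : Fin r} : pairSnd i = pairSnd j ↔ i = j := by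
  simp only [pairSnd, Fin.ext_iff]; omega

@[simp] theorem pairFst_ne_pairSnd {r : ℕ} (i j : Fin r) : pairFst i ≠ pairSnd j := by
  simp only [pairFst, pairSnd, Ne, Fin.ext_iff]; omega

@[simp] theorem pairSnd_ne_pairFst {r : ℕ} (i j : Fin r) : pairSnd i ≠ pairFst j :=
  (pairFst_ne_pairSnd j i).symm

theorem eq_pairFst_or_pairSnd {r : ℕ} (k : Fin (2 * r)) :
    ∃ i : Fin r, k = pairFst i ∨ k = pairSnd i :=
  ⟨⟨k / 2, by omega⟩, by simp only [pairFst, pairSnd, Fin.ext_iff]; omega⟩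

/-- A term of `pfaffianLeibniz`. -/
noncomputable def pfaffianTerm (r : ℕ) (A : Matrix (Fin (2 * r)) (Fin (2 * r)) ℝ)
    (σ : Equiv.Perm (Fin (2 * r))) : ℝ :=
  ((Equiv.Perm.sign σ : ℤ) : ℝ) * ∏ i : Fin r, A (σ (pairFst i)) (σ (pairSnd i))

theorem pfaffianTerm_flip {r : ℕ} {A : Matrix (Fin (2 * r)) (Fin (2 * r)) ℝ}
    (hA : ∀ i j, A j i = -A i j) (σ : Equiv.Perm (Fin (2 * r))) (k : Fin r) :
    pfaffianTerm r A (σ * Equiv.swap (pairFst k) (pairSnd k)) = pfaffianTerm r A σ := by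
  unfold pfaffianTerm
  rw [Equiv.Perm.sign_mul, Equiv.Perm.sign_swap (by simp),
    ← Finset.mul_prod_erase Finset.univ _ (Finset.mem_univ k),
    ← Finset.mul_prod_erase Finset.univ _ (Finset.mem_univ k)]
  have hrest : ∏ i ∈ Finset.univ.erase k,
      A ((σ * Equiv.swap (pairFst k) (pairSnd k)) (pairFst i))
        ((σ * Equiv.swap (pairFst k) (pairSnd k)) (pairSnd i)) =
      ∏ i ∈ Finset.univ.erase k, A (σ (pairFst i)) (σ (pairSnd i)) := by
    refine Finset.prod_congr rfl fun i hi => ?_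
    have hik := Finset.ne_of_mem_erase hi
    rw [Equiv.Perm.mul_apply, Equiv.Perm.mul_apply,
      Equiv.swap_apply_of_ne_of_ne (by simpa) (by simp),
      Equiv.swap_apply_of_ne_of_ne (by simp) (by simpa)]
  rw [hrest]
  simp only [Equiv.Perm.mul_apply, Equiv.swap_apply_left, Equiv.swap_apply_right]
  rw [hA (σ (pairFst k))]
  push_cast
  ring

theorem pfaffianTerm_swap {r : ℕ} (A : Matrix (Fin (2 * r)) (Fin (2 * r)) ℝ)
    (σ : Equiv.Perm (Fin (2 * r))) {k l : Fin r} (hkl : k ≠ l) :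
    pfaffianTerm r A (σ * (Equiv.swap (pairFst k) (pairFst l) *
      Equiv.swap (pairSnd k) (pairSnd l))) = pfaffianTerm r A σ := by
  unfold pfaffianTerm
  rw [Equiv.Perm.sign_mul, Equiv.Perm.sign_mul, Equiv.Perm.sign_swap (by simpa),
    Equiv.Perm.sign_swap (by simpa)]
  congr 1
  · simp
  · refine Fintype.prod_equiv (Equiv.swap k l) _ _ fun i => ?_
    simp only [Equiv.Perm.mul_apply, Equiv.swap_apply_def]
    congr 2 <;> split_ifs <;> simp_all

/-- Flips within a pair and exchanges of two pairs leave every term invariant and act transitively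
on positions. So the place at which a given index occurs may be normalized. -/
theorem exists_perm_pfaffianTerm_eq {r : ℕ} {A : Matrix (Fin (2 * r)) (Fin (2 * r)) ℝ}
    (hA : ∀ i j, A j i = -A i j) (i₀ : Fin r) (k : Fin (2 * r)) :
    ∃ π : Equiv.Perm (Fin (2 * r)), π k = pairFst i₀ ∧
      ∀ σ, pfaffianTerm r A (σ * π) = pfaffianTerm r A σ := by
  have key : ∀ i : Fin r, ∃ π : Equiv.Perm (Fin (2 * r)),
      π (pairFst i) = pairFst i₀ ∧ ∀ σ, pfaffianTerm r A (σ * π) = pfaffianTerm r A σ := by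
    intro i
    by_cases hi : i₀ = i
    · subst hi
      exact ⟨1, by simp, fun σ => by simp⟩
    · refine ⟨_, ?_, fun σ => pfaffianTerm_swap A σ hi⟩
      rw [Equiv.Perm.mul_apply, Equiv.swap_apply_of_ne_of_ne (a := pairSnd i₀) (by simp) (by simp),
        Equiv.swap_apply_right]
  obtain ⟨i, hi⟩ := eq_pairFst_or_pairSnd k
  obtain ⟨π, h0, hπ⟩ := key i
  rcases hi with rfl | rfl
  · exact ⟨π, h0, hπ⟩
  · refine ⟨π * Equiv.swap (pairFst i) (pairSnd i), ?_, fun σ => ?_⟩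
    · rw [Equiv.Perm.mul_apply, Equiv.swap_apply_right, h0]
    · rw [← mul_assoc, pfaffianTerm_flip hA, hπ]

/-- The index 0 can sit at any of 2(r+1) positions, all contributing equally, which gives the
factor. Once it sits at position 0, its partner must be 1, since row 0 vanishes elsewhere. -/
theorem pfaffianLeibniz_succ (r : ℕ) (A : Matrix (Fin (2 * r + 1 + 1)) (Fin (2 * r + 1 + 1)) ℝ)
    (hA : ∀ i j, A j i = -A i j) (h01 : A 0 1 = 1) (h0 : ∀ j : Fin (2 * r), A 0 j.succ.succ = 0) :
    pfaffianLeibniz (r + 1) A =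
      (2 * (r + 1) : ℝ) * pfaffianLeibniz r (A.submatrix (fun j => j.succ.succ)
        (fun j => j.succ.succ)) := by
  have hz : ∀ (σ : Equiv.Perm (Fin (2 * (r + 1)))),
      ∑ k, (if σ k = ⟨0, by omega⟩ then pfaffianTerm (r + 1) A σ else 0) =
        pfaffianTerm (r + 1) A σ := by
    intro σ
    rw [Finset.sum_eq_single (σ.symm ⟨0, by omega⟩)]
    · simp
    · intro b _ hb
      rw [if_neg]
      rintro h
      exact hb (by rw [← h]; simp)
    · simp
  have h1 : ∀ k : Fin (2 * (r + 1)),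
      ∑ σ : Equiv.Perm (Fin (2 * (r + 1))),
        (if σ k = ⟨0, by omega⟩ then pfaffianTerm (r + 1) A σ else 0) =
      ∑ σ : Equiv.Perm (Fin (2 * (r + 1))),
        (if σ ⟨0, by omega⟩ = ⟨0, by omega⟩ then pfaffianTerm (r + 1) A σ else 0) := by
    intro k
    obtain ⟨π, hk, hπ⟩ := exists_perm_pfaffianTerm_eq hA (0 : Fin (r + 1)) k
    symm
    refine Fintype.sum_equiv (Equiv.mulRight π) _ _ fun σ => ?_
    simp only [Equiv.coe_mulRight, Equiv.Perm.mul_apply, hk, hπ]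
    rfl
  have h2 : pfaffianLeibniz (r + 1) A = (2 * (r + 1) : ℝ) *
      ∑ σ : Equiv.Perm (Fin (2 * (r + 1))),
        (if σ ⟨0, by omega⟩ = ⟨0, by omega⟩ then pfaffianTerm (r + 1) A σ else 0) := by
    calc pfaffianLeibniz (r + 1) A = ∑ σ, pfaffianTerm (r + 1) A σ := rfl
      _ = ∑ σ, ∑ k, (if σ k = ⟨0, by omega⟩ then pfaffianTerm (r + 1) A σ else 0) :=
          Finset.sum_congr rfl fun σ _ => (hz σ).symm
      _ = _ := by
          rw [Finset.sum_comm, Finset.sum_congr rfl fun k _ => h1 k]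
          simp
  rw [h2]
  congr 1
  have h3 : ∑ σ : Equiv.Perm (Fin (2 * r + 1 + 1)),
        (if σ 0 = 0 then pfaffianTerm (r + 1) A σ else 0) =
      ∑ e : Equiv.Perm (Fin (2 * r + 1)),
        pfaffianTerm (r + 1) A (Equiv.Perm.decomposeFin.symm (0, e)) := by
    rw [← Equiv.sum_comp Equiv.Perm.decomposeFin.symm, Fintype.sum_prod_type]
    simp only [Equiv.Perm.decomposeFin_symm_apply_zero]
    rw [Finset.sum_eq_single 0]
    · simp
    · intro b _ hb
      simp [hb]
    · simp
  -- Here `e` permutes the indices other than 0; the partner of 0 is `(e 0).succ`, so only `e 0 = 0`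
  -- survives.
  have h4 : ∀ e : Equiv.Perm (Fin (2 * r + 1)),
      pfaffianTerm (r + 1) A (Equiv.Perm.decomposeFin.symm (0, e)) =
        (if e 0 = 0 then ((Equiv.Perm.sign e : ℤ) : ℝ) * ∏ i : Fin r,
          A (e (⟨2 * (i : ℕ), by omega⟩ : Fin (2 * r)).succ).succ
            (e (⟨2 * (i : ℕ) + 1, by omega⟩ : Fin (2 * r)).succ).succ else 0) := by
    intro e
    have hs : ∀ x : Fin (2 * r + 1),
        (Equiv.Perm.decomposeFin.symm ((0 : Fin (2 * r + 1 + 1)), e)) x.succ = (e x).succ := by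
      intro x
      rw [Equiv.Perm.decomposeFin_symm_apply_succ]
      simp
    unfold pfaffianTerm
    rw [Equiv.Perm.decomposeFin.symm_sign, Fin.prod_univ_succ]
    have e0 : (Equiv.Perm.decomposeFin.symm ((0 : Fin (2 * r + 1 + 1)), e))
        (pairFst (0 : Fin (r + 1))) = 0 :=
      Equiv.Perm.decomposeFin_symm_apply_zero 0 e
    have e1 : (Equiv.Perm.decomposeFin.symm ((0 : Fin (2 * r + 1 + 1)), e))
        (pairSnd (0 : Fin (r + 1))) = (e 0).succ := hs 0
    have e2 : ∀ i : Fin r, (Equiv.Perm.decomposeFin.symm ((0 : Fin (2 * r + 1 + 1)), e))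
        (pairFst i.succ : Fin (2 * (r + 1))) =
        (e (⟨2 * (i : ℕ), by omega⟩ : Fin (2 * r)).succ).succ := fun i =>
      hs (⟨2 * (i : ℕ), by omega⟩ : Fin (2 * r)).succ
    have e3 : ∀ i : Fin r, (Equiv.Perm.decomposeFin.symm ((0 : Fin (2 * r + 1 + 1)), e))
        (pairSnd i.succ : Fin (2 * (r + 1))) =
        (e (⟨2 * (i : ℕ) + 1, by omega⟩ : Fin (2 * r)).succ).succ := fun i =>
      hs (⟨2 * (i : ℕ) + 1, by omega⟩ : Fin (2 * r)).succ
    simp only [e2, e3]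
    erw [e0, e1]
    by_cases he : e 0 = 0
    · rw [if_pos he, he]
      have : A 0 (Fin.succ 0) = 1 := h01
      rw [this]
      simp
    · rw [if_neg he]
      obtain ⟨q, hq⟩ := Fin.exists_succ_eq.mpr he
      rw [← hq, h0]
      simp
  have h5 : ∑ e : Equiv.Perm (Fin (2 * r + 1)),
        (if e 0 = 0 then ((Equiv.Perm.sign e : ℤ) : ℝ) * ∏ i : Fin r,
          A (e (⟨2 * (i : ℕ), by omega⟩ : Fin (2 * r)).succ).succ
            (e (⟨2 * (i : ℕ) + 1, by omega⟩ : Fin (2 * r)).succ).succ else 0) =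
      pfaffianLeibniz r (A.submatrix (fun j => j.succ.succ) (fun j => j.succ.succ)) := by
    rw [← Equiv.sum_comp Equiv.Perm.decomposeFin.symm, Fintype.sum_prod_type,
      Finset.sum_eq_single 0]
    · refine Finset.sum_congr rfl fun e _ => ?_
      rw [if_pos (Equiv.Perm.decomposeFin_symm_apply_zero 0 e), Equiv.Perm.decomposeFin.symm_sign]
      simp only [Equiv.Perm.decomposeFin_symm_apply_succ, if_true, one_mul, Equiv.swap_self,
        Equiv.refl_apply, Matrix.submatrix_apply]
    · intro b _ hb
      simp [hb]
    · simp
  rw [← h5, ← Finset.sum_congr rfl fun e _ => h4 e]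
  exact h3

theorem pfaffianLeibniz_eq_zero_of_row (r : ℕ) (A : Matrix (Fin (2 * r)) (Fin (2 * r)) ℝ)
    (hA : ∀ i j, A j i = -A i j) (k : Fin (2 * r)) (hk : ∀ j, A k j = 0) :
    pfaffianLeibniz r A = 0 := by
  refine Finset.sum_eq_zero fun σ _ => ?_
  obtain ⟨i, hi⟩ := eq_pairFst_or_pairSnd (σ.symm k)
  rw [Finset.prod_eq_zero (Finset.mem_univ i), mul_zero]
  rcases hi with hi | hi
  · have : σ (pairFst i) = k := by rw [← hi]; simp
    exact (congrArg (fun x => A x _) this).trans (hk _)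
  · have : σ (pairSnd i) = k := by rw [← hi]; simp
    refine (congrArg (fun x => A _ x) this).trans ?_
    rw [hA k, hk, neg_zero]

theorem skew_conj {N : ℕ} {A : Matrix (Fin N) (Fin N) ℝ} (hA : ∀ i j, A j i = -A i j)
    (B : Matrix (Fin N) (Fin N) ℝ) (i j : Fin N) : (B * A * Bᵀ) j i = -(B * A * Bᵀ) i j := by
  have h : Aᵀ = -A := by ext i j; exact hA i j
  have : (B * A * Bᵀ)ᵀ = -(B * A * Bᵀ) := by
    rw [Matrix.transpose_mul, Matrix.transpose_mul, Matrix.transpose_transpose, h]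
    simp [Matrix.mul_assoc]
  exact congrFun (congrFun this i) j

theorem det_succ_of_first_pair {N : ℕ} (A : Matrix (Fin (N + 1 + 1)) (Fin (N + 1 + 1)) ℝ)
    (hA : ∀ i j, A j i = -A i j) (h01 : A 0 1 = 1) (h0 : ∀ j : Fin N, A 0 j.succ.succ = 0) :
    A.det = (A.submatrix (fun j : Fin N => j.succ.succ) (fun j => j.succ.succ)).det := by
  have h00 : A 0 0 = 0 := by linarith [hA 0 0]
  have h10 : A 1 0 = -1 := by rw [hA 0 1, h01]
  rw [Matrix.det_succ_row_zero, Fin.sum_univ_succ, Fin.sum_univ_succ]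
  have e1 : A 0 (Fin.succ 0) = 1 := h01
  simp only [h00, h0, e1, mul_zero, zero_mul, Finset.sum_const_zero, add_zero, zero_add]
  rw [Matrix.det_succ_column_zero, Fin.sum_univ_succ]
  have e2 : ∀ i : Fin N, (A.submatrix Fin.succ (Fin.succAbove (Fin.succ 0))) i.succ 0 = 0 := by
    intro i
    have : (Fin.succ (0 : Fin (N + 1))).succAbove (0 : Fin (N + 1)) = 0 := by
      exact Fin.succ_succAbove_zero 0
    rw [Matrix.submatrix_apply, this, hA 0, h0, neg_zero]
  have e3 : (A.submatrix Fin.succ (Fin.succAbove (Fin.succ 0))) 0 0 = -1 := by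
    have : (Fin.succ (0 : Fin (N + 1))).succAbove (0 : Fin (N + 1)) = 0 := by
      exact Fin.succ_succAbove_zero 0
    rw [Matrix.submatrix_apply, this]
    exact h10
  simp only [e2, e3, mul_zero, zero_mul, Finset.sum_const_zero, add_zero]
  have e4 : (A.submatrix Fin.succ (Fin.succAbove (Fin.succ 0))).submatrix (Fin.succAbove 0)
      Fin.succ = A.submatrix (fun j : Fin N => j.succ.succ) (fun j => j.succ.succ) := by
    ext i j
    simp [Matrix.submatrix_apply, Fin.succAbove]
  rw [e4]
  simp

/-- A skew-symmetric matrix whose first row is nonzero is congruent to one in which the first two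
indices decouple from the others. -/
theorem exists_congr_first_pair {N : ℕ} (A : Matrix (Fin (N + 1 + 1)) (Fin (N + 1 + 1)) ℝ)
    (hA : ∀ i j, A j i = -A i j) (hrow : ∃ j, A 0 j ≠ 0) :
    ∃ B : Matrix (Fin (N + 1 + 1)) (Fin (N + 1 + 1)) ℝ, B.det ≠ 0 ∧ (B * A * Bᵀ) 0 1 = 1 ∧
      ∀ j : Fin N, (B * A * Bᵀ) 0 j.succ.succ = 0 := by
  obtain ⟨j, hj⟩ := hrow
  have h00 : A 0 0 = 0 := by linarith [hA 0 0]
  have hj0 : j ≠ 0 := by rintro rfl; exact hj h00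
  -- A permutation first moves the nonzero entry of row 0 to position (0, 1).
  set P : Matrix (Fin (N + 1 + 1)) (Fin (N + 1 + 1)) ℝ := (Equiv.swap 1 j).toPEquiv.toMatrix with hP
  set A' := A.submatrix (Equiv.swap 1 j) (Equiv.swap 1 j) with hA'
  have hPA : P * A * Pᵀ = A' := by
    rw [hP, ← PEquiv.toMatrix_symm, PEquiv.toMatrix_toPEquiv_mul, ← Equiv.toPEquiv_symm,
      PEquiv.mul_toMatrix_toPEquiv, Equiv.symm_symm]
    rfl
  have hPdet : P.det ≠ 0 := by
    rw [hP, Matrix.det_permutation]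
    exact_mod_cast Units.ne_zero _
  set a := A' 0 1 with ha
  have ha0 : a ≠ 0 := by
    rw [ha, hA', Matrix.submatrix_apply, Equiv.swap_apply_left,
      Equiv.swap_apply_of_ne_of_ne (by simp) hj0.symm]
    exact hj
  -- Symplectic elimination: vector 1 is rescaled so that it pairs to 1 with vector 0, and a
  -- multiple of it is subtracted from every later vector to kill the pairing with vector 0. The
  -- matrix is lower triangular.
  let L : Matrix (Fin (N + 1 + 1)) (Fin (N + 1 + 1)) ℝ := Matrix.of (Fin.cons (Pi.single 0 1)
    (Fin.cons (Pi.single 1 a⁻¹) fun k : Fin N =>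
      Pi.single k.succ.succ 1 + Pi.single 1 (-(A' 0 k.succ.succ) / a)))
  have hL0 : L 0 = Pi.single 0 1 := rfl
  have hL1 : L 1 = Pi.single 1 a⁻¹ := rfl
  have hLk : ∀ k : Fin N, L k.succ.succ = Pi.single k.succ.succ 1 +
      Pi.single 1 (-(A' 0 k.succ.succ) / a) := fun k => rfl
  have hLdet : L.det ≠ 0 := by
    rw [Matrix.det_of_isLowerTriangular]
    · rw [Fin.prod_univ_succ, Fin.prod_univ_succ]
      have e1 : L (Fin.succ 0) (Fin.succ 0) = a⁻¹ := by
        have : L (Fin.succ 0) = Pi.single 1 a⁻¹ := rfl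
        rw [this]
        exact Pi.single_eq_same _ _
      have e2 : ∀ k : Fin N, L k.succ.succ k.succ.succ = 1 := by
        intro k
        rw [hLk]
        have h1 : k.succ.succ ≠ (1 : Fin (N + 1 + 1)) := by
          rw [← Fin.succ_zero_eq_one, Ne, Fin.succ_inj]; exact Fin.succ_ne_zero k
        simp [h1]
      rw [e1, hL0]
      simp [e2, ha0]
    · intro x y hxy
      have hxy : x < y := hxy
      refine Fin.cases (motive := fun x => x < y → L x y = 0) ?_ ?_ x hxy
      · intro h
        rw [hL0, Pi.single_eq_of_ne h.ne']
      · intro x'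
        refine Fin.cases (motive := fun x' => x'.succ < y → L x'.succ y = 0) ?_ ?_ x'
        · intro h
          have : L (Fin.succ 0) = Pi.single 1 a⁻¹ := rfl
          rw [this, Pi.single_eq_of_ne]
          exact h.ne'
        · intro k h
          rw [hLk]
          have hk1 : (1 : Fin (N + 1 + 1)) < k.succ.succ := by
            rw [← Fin.succ_zero_eq_one, Fin.succ_lt_succ_iff]; exact Fin.succ_pos _
          simp only [Pi.add_apply]
          rw [Pi.single_eq_of_ne h.ne', Pi.single_eq_of_ne (hk1.trans h).ne']
          simp
  have hval : ∀ x y, (L * A' * Lᵀ) x y = L x ⬝ᵥ (A' *ᵥ L y) := by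
    intro x y
    rw [Matrix.mul_assoc, Matrix.mul_apply]
    rfl
  refine ⟨L * P, by rw [Matrix.det_mul]; exact mul_ne_zero hLdet hPdet, ?_⟩
  have hB : L * P * A * (L * P)ᵀ = L * A' * Lᵀ := by
    rw [← hPA, Matrix.transpose_mul]; simp only [Matrix.mul_assoc]
  rw [hB]
  refine ⟨?_, fun k => ?_⟩
  · rw [hval, hL0, hL1]
    simp [Matrix.mulVec_single, ← ha, ha0]
  · rw [hval, hL0, hLk]
    simp only [Matrix.mulVec_add, Matrix.mulVec_single, single_dotProduct, Pi.add_apply]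
    simp [← ha, Matrix.col_apply]
    field_simp
    ring

/-- Induction on `r`. Under congruence by `B` both sides scale by `B.det ^ 2`, so the first pair may
be assumed to decouple and be split off; if the first row is zero, both sides vanish. -/
theorem pfaffianLeibniz_sq (r : ℕ) (A : Matrix (Fin (2 * r)) (Fin (2 * r)) ℝ)
    (hA : ∀ i j, A j i = -A i j) :
    pfaffianLeibniz r A ^ 2 = (2 ^ r * (r ! : ℝ)) ^ 2 * A.det := by
  induction r with
  | zero =>
    have : IsEmpty (Fin (2 * 0)) := inferInstanceAs (IsEmpty (Fin 0))
    rw [Matrix.det_isEmpty]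
    simp [pfaffianLeibniz]
  | succ r ih =>
    by_cases hrow : ∃ j, A ⟨0, by omega⟩ j ≠ 0
    · obtain ⟨B, hB, h01, h0⟩ := exists_congr_first_pair (N := 2 * r) A hA hrow
      have hskew := skew_conj hA B
      have e1 := pfaffianLeibniz_succ r (B * A * Bᵀ) hskew h01 h0
      have e2 := det_succ_of_first_pair (N := 2 * r) (B * A * Bᵀ) hskew h01 h0
      have e3 := ih ((B * A * Bᵀ : Matrix (Fin (2 * r + 1 + 1)) (Fin (2 * r + 1 + 1)) ℝ).submatrix
        (fun j : Fin (2 * r) => j.succ.succ) (fun j => j.succ.succ)) fun i j => hskew _ _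
      have e4 : pfaffianLeibniz (r + 1) (B * A * Bᵀ) = Matrix.det B * pfaffianLeibniz (r + 1) A :=
        pfaffianLeibniz_congr (r + 1) A B
      have e5 : Matrix.det (B * A * Bᵀ) = B.det ^ 2 * A.det := by
        rw [Matrix.det_mul, Matrix.det_mul, Matrix.det_transpose]; ring
      have hB2 : (Matrix.det B) ^ 2 ≠ 0 := pow_ne_zero _ hB
      apply mul_left_cancel₀ hB2
      rw [← mul_pow, ← e4]
      calc pfaffianLeibniz (r + 1) (B * A * Bᵀ) ^ 2
          = (2 * (r + 1) : ℝ) ^ 2 * ((2 ^ r * (r ! : ℝ)) ^ 2 * Matrix.det (B * A * Bᵀ)) := by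
            rw [e2, ← e3, ← mul_pow, ← e1]
        _ = _ := by
            rw [e5, Nat.factorial_succ]
            push_cast
            ring
    · push Not at hrow
      rw [pfaffianLeibniz_eq_zero_of_row (r + 1) A hA _ hrow, Matrix.det_eq_zero_of_row_eq_zero _ hrow]
      simp

/-- The square of the Pfaffian of a skew-symmetric matrix is its determinant. -/
theorem pfaffian_sq {N : ℕ} (A : Matrix (Fin N) (Fin N) ℝ) (hA : ∀ i j, A j i = -A i j) :
    pfaffian A ^ 2 = A.det := by
  rcases Nat.even_or_odd N with hN | hN
  · obtain ⟨r, rfl⟩ := hN.two_dvd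
    rw [pfaffian_eq_leibniz, div_pow, pfaffianLeibniz_sq r A hA, mul_div_assoc, mul_comm,
      mul_comm_div, mul_comm]
    have : (2 ^ r * (r ! : ℝ)) ^ 2 ≠ 0 := by positivity
    field_simp
  · rw [pfaffian_of_odd (Nat.not_even_iff_odd.mpr hN)]
    have h : A.det = -A.det := by
      conv_lhs => rw [← Matrix.det_transpose, show Aᵀ = -A from by ext i j; exact hA i j,
        Matrix.det_neg, Fintype.card_fin, hN.neg_one_pow, neg_one_mul]
    rw [zero_pow two_ne_zero]
    linarith

section
variable {ι : Type*} [LinearOrder ι]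

theorem pfMinor_sq (Γ : Matrix ι ι ℝ) (hΓ : ∀ i j, Γ j i = -Γ i j) (X : Finset ι) :
    pfMinor Γ X ^ 2 = (Γ.submatrix (Subtype.val : X → ι) Subtype.val).det := by
  rw [pfMinor, pfaffian_sq (Γ.submatrix (X.orderEmbOfFin rfl) (X.orderEmbOfFin rfl))
    fun i j => hΓ _ _,
    ← Matrix.det_submatrix_equiv_self (X.orderIsoOfFin rfl).toEquiv]
  rfl

theorem abs_pfMinor_rpow (Γ : Matrix ι ι ℝ) (hΓ : ∀ i j, Γ j i = -Γ i j) (X : Finset ι) (α : ℝ) :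
    |pfMinor Γ X| ^ (2 * α) = (Γ.submatrix (Subtype.val : X → ι) Subtype.val).det ^ α := by
  rw [Real.rpow_mul (abs_nonneg _), Real.rpow_two, sq_abs, pfMinor_sq Γ hΓ]

theorem det_minor_nonneg (Γ : Matrix ι ι ℝ) (hΓ : ∀ i j, Γ j i = -Γ i j) (X : Finset ι) :
    0 ≤ (Γ.submatrix (Subtype.val : X → ι) Subtype.val).det := by
  rw [← pfMinor_sq Γ hΓ]; positivity

end

/-! ### Calculus of absolute powers and of determinants -/

section
open Filter Topology

/-- At 0 the difference quotient is |t|^q, which tends to 0; elsewhere the function is |x|^(q+2) /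
x. -/
theorem hasDerivAt_abs_rpow_mul_self {q : ℝ} (hq : 0 < q) (x : ℝ) :
    HasDerivAt (fun x : ℝ => |x| ^ q * x) ((q + 1) * |x| ^ q) x := by
  rcases eq_or_ne x 0 with rfl | hx
  · rw [hasDerivAt_iff_tendsto_slope_zero]
    have h1 : Tendsto (fun t : ℝ => |t| ^ q) (𝓝[≠] 0) (𝓝 0) := by
      have : ContinuousAt (fun t : ℝ => |t| ^ q) 0 :=
        (continuous_abs.continuousAt).rpow_const (Or.inr hq.le)
      have h := this.tendsto
      simp only [abs_zero, Real.zero_rpow hq.ne'] at h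
      exact h.mono_left nhdsWithin_le_nhds
    simp only [abs_zero, Real.zero_rpow hq.ne', mul_zero]
    refine h1.congr' ?_
    filter_upwards [self_mem_nhdsWithin] with t ht
    have ht : t ≠ 0 := ht
    simp only [zero_add, sub_zero, smul_eq_mul]
    field_simp
  · have h1 := (hasDerivAt_abs_rpow x (p := q + 2) (by linarith)).mul (hasDerivAt_inv hx)
    have e : ∀ y : ℝ, y ≠ 0 → |y| ^ (q + 2) = |y| ^ q * y ^ 2 := by
      intro y hy
      rw [Real.rpow_add (abs_pos.mpr hy), Real.rpow_two, sq_abs]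
    have h2 : HasDerivAt (fun x : ℝ => |x| ^ q * x)
        ((q + 2) * |x| ^ (q + 2 - 2) * x * x⁻¹ + |x| ^ (q + 2) * -(x ^ 2)⁻¹) x := by
      refine h1.congr_of_eventuallyEq ?_
      filter_upwards [isOpen_ne.mem_nhds hx] with y hy
      have hy : y ≠ 0 := hy
      simp only [Pi.mul_apply]
      rw [e y hy]
      field_simp
    convert! h2 using 1
    rw [e x hx, add_sub_cancel_right]
    field_simp
    ring

/-- The derivatives are p |x|^(p-2) x and p (p-1) |x|^(p-2), the latter continuous because p > 2. It
is applied with p = 2α. -/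
theorem contDiff_two_abs_rpow {p : ℝ} (hp : 2 < p) : ContDiff ℝ 2 (fun x : ℝ => |x| ^ p) := by
  have hd : deriv (fun x : ℝ => |x| ^ p) = fun x => p * (|x| ^ (p - 2) * x) := by
    funext x
    rw [(hasDerivAt_abs_rpow x (by linarith)).deriv, mul_assoc]
  have hd2 : deriv (fun x : ℝ => |x| ^ (p - 2) * x) = fun x => (p - 2 + 1) * |x| ^ (p - 2) := by
    funext x
    rw [(hasDerivAt_abs_rpow_mul_self (by linarith) x).deriv]
  rw [show (2 : WithTop ℕ∞) = 1 + 1 by norm_num, contDiff_succ_iff_deriv]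
  refine ⟨fun x => (hasDerivAt_abs_rpow x (by linarith)).differentiableAt, by simp, ?_⟩
  rw [hd]
  refine contDiff_const.mul ?_
  rw [show (1 : WithTop ℕ∞) = 0 + 1 by norm_num, contDiff_succ_iff_deriv]
  refine ⟨fun x => (hasDerivAt_abs_rpow_mul_self (by linarith) x).differentiableAt, by simp, ?_⟩
  rw [hd2, contDiff_zero]
  exact continuous_const.mul (continuous_abs.rpow_const fun x => Or.inr (by linarith))

/-- The first two derivatives of `|g| ^ (2 α)` at a point where `D = g ^ 2` vanishes or is
critical. -/
theorem deriv_abs_rpow_comp {α : ℝ} (hα : 1 < α) {g D : ℝ → ℝ} (hg : ContDiff ℝ 2 g)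
    (hD : ∀ t, g t ^ 2 = D t) {d₂ : ℝ} (h1 : D 0 ≠ 0 → deriv D 0 = 0)
    (h2 : D 0 ≠ 0 → deriv (deriv D) 0 = D 0 * d₂) :
    deriv (fun t => |g t| ^ (2 * α)) 0 = 0 ∧
      deriv (deriv fun t => |g t| ^ (2 * α)) 0 = α * (D 0 ^ α * d₂) := by
  have hg1 : ∀ t, HasDerivAt g (deriv g t) t := fun t =>
    (hg.differentiable (by norm_num) t).hasDerivAt
  have hg2 : ∀ t, HasDerivAt (deriv g) (deriv (deriv g) t) t := by
    have : ContDiff ℝ 1 (deriv g) := by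
      rw [show (2 : WithTop ℕ∞) = 1 + 1 by norm_num, contDiff_succ_iff_deriv] at hg
      exact hg.2.2
    exact fun t => (this.differentiable (by norm_num) t).hasDerivAt
  have hu : deriv (fun t => |g t| ^ (2 * α)) =
      fun t => 2 * α * (|g t| ^ (2 * α - 2) * g t) * deriv g t := by
    funext t
    have := (hasDerivAt_abs_rpow (g t) (p := 2 * α) (by linarith)).comp t (hg1 t)
    rw [← mul_assoc]
    exact this.deriv
  have hu2 : deriv (deriv fun t => |g t| ^ (2 * α)) 0 =
      2 * α * ((2 * α - 1) * |g 0| ^ (2 * α - 2) * deriv g 0) * deriv g 0 +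
        2 * α * (|g 0| ^ (2 * α - 2) * g 0) * deriv (deriv g) 0 := by
    rw [hu]
    have h := ((((hasDerivAt_abs_rpow_mul_self (q := 2 * α - 2) (by linarith) (g 0)).comp 0
      (hg1 0)).const_mul (2 * α)).mul (hg2 0)).deriv
    have e : 2 * α - 2 + 1 = 2 * α - 1 := by ring
    rw [e] at h
    exact h
  have hDf : D = fun t => g t ^ 2 := funext fun t => (hD t).symm
  -- If `g 0 = 0`, every term carries the factor |g 0|^(2α-2) with positive exponent. Otherwise
  -- criticality of D = g² gives g'(0) = 0, and only the term with g'' remains, where 2 g g'' = D''.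
  by_cases h0 : g 0 = 0
  · have hD0 : D 0 = 0 := by rw [← hD, h0]; simp
    rw [hu2, hu]
    simp only [h0, hD0, abs_zero]
    rw [Real.zero_rpow (by linarith : 2 * α - 2 ≠ 0), Real.zero_rpow (by linarith : α ≠ 0)]
    simp
  · have hD0 : D 0 ≠ 0 := by rw [← hD]; exact pow_ne_zero _ h0
    have hD1 : deriv D = fun t => 2 * g t * deriv g t := by
      funext t
      rw [hDf]
      simpa using ((hg1 t).fun_pow 2).deriv
    have hD2 : deriv (deriv D) 0 = 2 * deriv g 0 * deriv g 0 + 2 * g 0 * deriv (deriv g) 0 := by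
      rw [hD1]
      exact (((hg1 0).const_mul 2).mul (hg2 0)).deriv
    have hg0 : deriv g 0 = 0 := by
      have := h1 hD0
      rw [hD1] at this
      simpa [h0] using this
    have hgg : 2 * (g 0 * deriv (deriv g) 0) = D 0 * d₂ := by
      rw [← h2 hD0, hD2, hg0]; ring
    have hpow : D 0 ^ α = |g 0| ^ (2 * α - 2) * D 0 := by
      rw [← hD, ← sq_abs, ← Real.rpow_two, ← Real.rpow_mul (abs_nonneg _),
        ← Real.rpow_add (abs_pos.mpr h0)]
      congr 1
      ring
    rw [hu2, hu, hg0]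
    refine ⟨by simp [hg0], ?_⟩
    rw [hpow]
    linear_combination α * |g 0| ^ (2 * α - 2) * hgg

section Jacobi
variable {κ : Type*} [Fintype κ] [DecidableEq κ]

/-- Jacobi's formula for the derivative of the determinant. -/
theorem hasDerivAt_det {M : ℝ → Matrix κ κ ℝ} {M' : Matrix κ κ ℝ} {t : ℝ}
    (hM : ∀ i j, HasDerivAt (fun s => M s i j) (M' i j) t) :
    HasDerivAt (fun s => (M s).det) ((M t).adjugate * M').trace t := by
  have h1 : HasDerivAt (fun s => ∑ σ : Equiv.Perm κ, ((Equiv.Perm.sign σ : ℤ) : ℝ) *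
      ∏ i, M s (σ i) i) (∑ σ : Equiv.Perm κ, ((Equiv.Perm.sign σ : ℤ) : ℝ) *
        ∑ k, (∏ i ∈ Finset.univ.erase k, M t (σ i) i) • M' (σ k) k) t := by
    refine HasDerivAt.fun_sum fun σ _ => HasDerivAt.const_mul _ ?_
    exact HasDerivAt.fun_finsetProd fun i _ => hM (σ i) i
  have h2 : (fun s => (M s).det) = fun s => ∑ σ : Equiv.Perm κ,
      ((Equiv.Perm.sign σ : ℤ) : ℝ) * ∏ i, M s (σ i) i := by
    funext s
    exact Matrix.det_apply' _
  rw [h2]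
  convert! h1 using 1
  have h3 : ∀ k, ((M t).adjugate * M') k k = ((M t).updateCol k fun i => M' i k).det := by
    intro k
    rw [← Matrix.cramer_apply, Matrix.cramer_eq_adjugate_mulVec]
    rfl
  simp only [Matrix.trace, Matrix.diag_apply, h3, Matrix.det_apply']
  rw [Finset.sum_comm]
  refine Finset.sum_congr rfl fun σ _ => ?_
  rw [Finset.mul_sum]
  refine Finset.sum_congr rfl fun k _ => ?_
  congr 1
  rw [← Finset.prod_erase_mul Finset.univ _ (Finset.mem_univ k), Matrix.updateCol_self,
    smul_eq_mul]
  congr 1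
  refine Finset.prod_congr rfl fun i hi => ?_
  rw [Matrix.updateCol_ne (Finset.ne_of_mem_erase hi)]

/-- Jacobi's formula is differentiated once more. The derivative of the adjugate is obtained from
adj(M) M = det(M) 1 rather than from a formula for the inverse. -/
theorem deriv_det_of_isUnit {M M' : ℝ → Matrix κ κ ℝ} {M'' N : Matrix κ κ ℝ}
    (hM : ∀ t i j, HasDerivAt (fun s => M s i j) (M' t i j) t)
    (hM' : ∀ i j, HasDerivAt (fun s => M' s i j) (M'' i j) 0) (hN : M 0 * N = 1) :
    deriv (fun t => (M t).det) 0 = (M 0).det * (N * M' 0).trace ∧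
    deriv (deriv fun t => (M t).det) 0 = (M 0).det *
      ((N * M' 0).trace ^ 2 + (N * M'').trace - (N * M' 0 * N * M' 0).trace) := by
  have hN' : N * M 0 = 1 := mul_eq_one_comm.mp hN
  have hadj : (M 0).adjugate = (M 0).det • N := by
    calc (M 0).adjugate = (M 0).adjugate * (M 0 * N) := by rw [hN, Matrix.mul_one]
      _ = _ := by rw [← Matrix.mul_assoc, Matrix.adjugate_mul, Matrix.smul_mul, Matrix.one_mul]
  have hd : ∀ t, HasDerivAt (fun s => (M s).det) ((M t).adjugate * M' t).trace t :=
    fun t => hasDerivAt_det (hM t)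
  have hd0 : ((M 0).adjugate * M' 0).trace = (M 0).det * (N * M' 0).trace := by
    rw [hadj, Matrix.smul_mul, Matrix.trace_smul, smul_eq_mul]
  refine ⟨by rw [(hd 0).deriv, hd0], ?_⟩
  have hdf : (deriv fun t => (M t).det) = fun t => ((M t).adjugate * M' t).trace :=
    funext fun t => (hd t).deriv
  -- Entries of the adjugate are themselves determinants, hence differentiable; the value of the
  -- derivative is determined afterwards.
  have hA : ∀ i j, ∃ a, HasDerivAt (fun t => (M t).adjugate i j) a 0 := by
    intro i j
    simp only [Matrix.adjugate_apply]
    refine ⟨_, hasDerivAt_det (M' := (M' 0).updateRow j 0) fun k l => ?_⟩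
    by_cases hk : k = j
    · subst hk
      simp only [Matrix.updateRow_self]
      exact hasDerivAt_const _ _
    · simp only [Matrix.updateRow_ne hk]
      exact hM 0 k l
  choose A' hA' using hA
  have hAM : Matrix.of A' * M 0 + (M 0).adjugate * M' 0 =
      ((M 0).det * (N * M' 0).trace) • (1 : Matrix κ κ ℝ) := by
    ext i j
    have h1 : HasDerivAt (fun t => ((M t).adjugate * M t) i j)
        ((Matrix.of A' * M 0 + (M 0).adjugate * M' 0) i j) 0 := by
      simp only [Matrix.add_apply, Matrix.mul_apply, ← Finset.sum_add_distrib]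
      exact HasDerivAt.fun_sum fun k _ => (hA' i k).mul (hM 0 k j)
    have h2 : HasDerivAt (fun t => ((M t).adjugate * M t) i j)
        ((((M 0).det * (N * M' 0).trace) • (1 : Matrix κ κ ℝ)) i j) 0 := by
      simp only [Matrix.adjugate_mul, Matrix.smul_apply, smul_eq_mul]
      rw [← hd0]
      exact (hd 0).mul_const _
    exact h1.unique h2
  have hA'eq : Matrix.of A' = (M 0).det • ((N * M' 0).trace • N - N * M' 0 * N) := by
    have := congrArg (· * N) hAM
    simp only [Matrix.add_mul, Matrix.mul_assoc, hN, Matrix.mul_one, Matrix.smul_mul,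
      Matrix.one_mul] at this
    rw [eq_sub_of_add_eq this, hadj, smul_sub, smul_smul]
    simp only [Matrix.smul_mul, Matrix.mul_assoc]
  have h3 : HasDerivAt (fun t => ((M t).adjugate * M' t).trace)
      ((Matrix.of A' * M' 0 + (M 0).adjugate * M'').trace) 0 := by
    simp only [Matrix.trace, Matrix.diag_apply, Matrix.add_apply, Matrix.mul_apply,
      ← Finset.sum_add_distrib]
    exact HasDerivAt.fun_sum fun i _ => HasDerivAt.fun_sum fun k _ => (hA' i k).mul (hM' k i)
  rw [hdf, h3.deriv, hA'eq, hadj]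
  simp only [Matrix.smul_mul, Matrix.sub_mul, Matrix.trace_add, Matrix.trace_smul,
    Matrix.trace_sub, smul_eq_mul, Matrix.mul_assoc]
  ring

end Jacobi

end

/-! ### Smoothness of the orbit map and the conjugation flow -/

section
open Filter Topology

section
variable {E : Type*} [NormedAddCommGroup E] [NormedSpace ℝ E]

theorem ContDiff.pfMinor {ι : Type*} [LinearOrder ι] {n : WithTop ℕ∞} {G : E → Matrix ι ι ℝ}
    (hG : ∀ i j, ContDiff ℝ n fun x => G x i j) (X : Finset ι) :
    ContDiff ℝ n fun x => pfMinor (G x) X := by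
  unfold _root_.pfMinor pfaffian
  split_ifs
  · refine ContDiff.div_const (ContDiff.sum fun σ _ => contDiff_const.mul ?_) _
    exact contDiff_prod fun i _ => hG _ _
  · exact contDiff_const

theorem ContDiff.pfaffianSum {ι : Type*} [LinearOrder ι] [Fintype ι] {α : ℝ} (hα : 1 < α)
    {G : E → Matrix ι ι ℝ} (hG : ∀ i j, ContDiff ℝ 2 fun x => G x i j) :
    ContDiff ℝ 2 fun x => pfaffianSum α (G x) := by
  unfold _root_.pfaffianSum
  refine ContDiff.sum fun X _ => ?_
  exact (contDiff_two_abs_rpow (by linarith)).comp (ContDiff.pfMinor hG X)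

theorem deriv_along_line {f : E → ℝ} (hf : ContDiff ℝ 2 f) (v : E) :
    deriv (fun t : ℝ => f (t • v)) 0 = fderiv ℝ f 0 v ∧
      deriv (deriv fun t : ℝ => f (t • v)) 0 = fderiv ℝ (fderiv ℝ f) 0 v v := by
  have hl : ∀ t : ℝ, HasDerivAt (fun t : ℝ => t • v) v t := fun t => by
    simpa using (hasDerivAt_id t).smul_const v
  have h1 : ∀ t : ℝ, HasDerivAt (fun t : ℝ => f (t • v)) (fderiv ℝ f (t • v) v) t := fun t =>
    ((hf.differentiable (by norm_num) (t • v)).hasFDerivAt).comp_hasDerivAt t (hl t)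
  have h2 : Differentiable ℝ (fderiv ℝ f) :=
    (hf.fderiv_right (m := 1) (by norm_num)).differentiable (by norm_num)
  have h3 : HasDerivAt (fun t : ℝ => fderiv ℝ f (t • v)) (fderiv ℝ (fderiv ℝ f) ((0 : ℝ) • v) v) 0 :=
    ((h2 ((0 : ℝ) • v)).hasFDerivAt).comp_hasDerivAt 0 (hl 0)
  have h4 : HasDerivAt (fun t : ℝ => fderiv ℝ f (t • v) v)
      (fderiv ℝ (fderiv ℝ f) ((0 : ℝ) • v) v v) 0 := by
    simpa using h3.clm_apply (hasDerivAt_const (0 : ℝ) v)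
  rw [funext fun t => (h1 t).deriv, h4.deriv]
  simp only [zero_smul, and_self]

end

section MatrixExp
variable {κ : Type*} [Fintype κ] [DecidableEq κ]

attribute [local instance] Matrix.linftyOpNormedRing Matrix.linftyOpNormedAlgebra

theorem contDiff_exp_apply {n : WithTop ℕ∞} {E : Type*} [NormedAddCommGroup E] [NormedSpace ℝ E]
    [FiniteDimensional ℝ E] (L : E →ₗ[ℝ] Matrix κ κ ℝ) (i j : κ) :
    ContDiff ℝ n fun x => NormedSpace.exp (L x) i j := by
  have h1 : ContDiff ℝ n (NormedSpace.exp : Matrix κ κ ℝ → Matrix κ κ ℝ) :=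
    contDiff_iff_contDiffAt.mpr fun x => (NormedSpace.exp_analytic (𝕂 := ℝ) x).contDiffAt
  have h2 : ContDiff ℝ n fun x => L x := (LinearMap.toContinuousLinearMap L).contDiff
  have h3 : ContDiff ℝ n fun M : Matrix κ κ ℝ => M i j :=
    (LinearMap.toContinuousLinearMap (Matrix.entryLinearMap ℝ ℝ i j)).contDiff
  exact h3.comp (h1.comp h2)

theorem hasDerivAt_exp_smul_apply (K : Matrix κ κ ℝ) (t : ℝ) (i j : κ) :
    HasDerivAt (fun s : ℝ => NormedSpace.exp (s • K) i j) ((NormedSpace.exp (t • K) * K) i j) t := by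
  have h3 := (LinearMap.toContinuousLinearMap (Matrix.entryLinearMap ℝ ℝ i j)).hasFDerivAt
    (x := NormedSpace.exp (t • K))
  exact h3.comp_hasDerivAt t (hasDerivAt_exp_smul_const (𝕂 := ℝ) K t)

end MatrixExp

section
variable {κ : Type*} [Fintype κ] [DecidableEq κ]

/-- Differentiating a conjugation flow inserts a commutator. -/
theorem hasDerivAt_conj_exp (K G : Matrix κ κ ℝ) (hK : Kᵀ = -K) (t : ℝ) (i j : κ) :
    HasDerivAt (fun s : ℝ => (NormedSpace.exp (s • K) * G * (NormedSpace.exp (s • K))ᵀ) i j)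
      ((NormedSpace.exp (t • K) * (K * G - G * K) * (NormedSpace.exp (t • K))ᵀ) i j) t := by
  have h : HasDerivAt
      (fun s : ℝ => (NormedSpace.exp (s • K) * G * (NormedSpace.exp (s • K))ᵀ) i j)
      ((NormedSpace.exp (t • K) * K * G * (NormedSpace.exp (t • K))ᵀ +
        NormedSpace.exp (t • K) * G * (NormedSpace.exp (t • K) * K)ᵀ) i j) t := by
    simp only [Matrix.mul_apply (M := _ * G), Matrix.add_apply,
      Matrix.mul_apply (N := G), Matrix.transpose_apply, ← Finset.sum_add_distrib]
    refine HasDerivAt.fun_sum fun l _ => HasDerivAt.mul ?_ (hasDerivAt_exp_smul_apply K t j l)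
    exact HasDerivAt.fun_sum fun k _ => (hasDerivAt_exp_smul_apply K t i k).mul_const _
  convert! h using 1
  rw [Matrix.transpose_mul, hK]
  noncomm_ring

end

section
variable {m n : ℕ}

/-- `genMatrix` as a linear map. -/
noncomputable def genLinear (m n : ℕ) : LocalGen m n →ₗ[ℝ] Matrix (Majorana m n) (Majorana m n) ℝ where
  toFun := genMatrix
  map_add' _ _ := rfl
  map_smul' _ _ := rfl

theorem genMatrix_transpose (K : LocalGen m n) : (genMatrix K)ᵀ = -genMatrix K := by
  ext i j
  exact K.2.1 i j

theorem genMatrix_smul (t : ℝ) (K : LocalGen m n) : genMatrix (t • K) = t • genMatrix K := rfl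

theorem contDiff_orbit_apply {k : WithTop ℕ∞} (Γ : Matrix (Majorana m n) (Majorana m n) ℝ)
    (i j : Majorana m n) :
    ContDiff ℝ k fun K : LocalGen m n =>
      (NormedSpace.exp (genMatrix K) * Γ * (NormedSpace.exp (genMatrix K))ᵀ) i j := by
  simp only [Matrix.mul_apply, Matrix.transpose_apply]
  refine ContDiff.sum fun l _ => ContDiff.mul ?_ (contDiff_exp_apply (genLinear m n) j l)
  exact ContDiff.sum fun p _ => (contDiff_exp_apply (genLinear m n) i p).mul contDiff_const

theorem contDiff_orbitF {α : ℝ} (hα : 1 < α) (Γ : Matrix (Majorana m n) (Majorana m n) ℝ) :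
    ContDiff ℝ 2 (orbitF α Γ) :=
  ContDiff.pfaffianSum hα fun i j => contDiff_orbit_apply Γ i j

end

end

/-! ### Four slots per block, and minors as determinants of a fixed size -/

section Pad
variable {m n : ℕ}

/-- Every Majorana as one of the four slots of its block; the first two slots belong to `A`. -/
def slot (h : m ≤ n) : Majorana m n → Fin 4 × Fin n
  | .a k i => (⟨i, by omega⟩, Fin.castLE h k)
  | .b k i => (⟨2 + i, by omega⟩, k)

theorem slot_injective (h : m ≤ n) : Function.Injective (slot h) := by
  rintro (⟨k, i⟩ | ⟨k, i⟩) (⟨l, j⟩ | ⟨l, j⟩) hkl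
  all_goals
    simp only [slot, Prod.mk.injEq, Fin.mk.injEq] at hkl
    obtain ⟨h1, h2⟩ := hkl
  · rw [Fin.castLE_inj] at h2
    rw [h2, Fin.ext h1]
  · omega
  · omega
  · rw [h2, Fin.ext (by omega : (i : ℕ) = j)]

/-- The slots of a block that are occupied. -/
def IsSlot (m : ℕ) (c : ℕ) (p : Fin 4) : Prop := c < m ∨ 2 ≤ (p : ℕ)

instance (m c : ℕ) (p : Fin 4) : Decidable (IsSlot m c p) := inferInstanceAs (Decidable (_ ∨ _))

theorem exists_slot_eq (h : m ≤ n) (p : Fin 4) (c : Fin n) :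
    (∃ i, slot h i = (p, c)) ↔ IsSlot m c p := by
  constructor
  · rintro ⟨⟨k, i⟩ | ⟨k, i⟩, hi⟩ <;> simp only [slot, Prod.mk.injEq] at hi <;>
      obtain ⟨rfl, rfl⟩ := hi
    · exact Or.inl k.2
    · exact Or.inr (by simp)
  · intro hp
    by_cases h2 : 2 ≤ (p : ℕ)
    · exact ⟨.b c ⟨p - 2, by omega⟩, by simp only [slot, Prod.mk.injEq, and_true, Fin.ext_iff]; omega⟩
    · have hc : (c : ℕ) < m := hp.resolve_right h2
      exact ⟨.a ⟨c, hc⟩ ⟨p, by omega⟩, rfl⟩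

theorem slot_snd (h : m ≤ n) (i : Majorana m n) : (slot h i).2 = i.block h := by
  cases i <;> rfl

/-- The incidence matrix of Majoranas and slots. -/
def slotMatrix (h : m ≤ n) : Matrix (Majorana m n) (Fin 4 × Fin n) ℝ :=
  Matrix.of fun i p => if slot h i = p then 1 else 0

theorem slotMatrix_mul_transpose (h : m ≤ n) : slotMatrix h * (slotMatrix h)ᵀ = 1 := by
  ext i j
  simp [slotMatrix, Matrix.mul_apply, Matrix.one_apply, (slot_injective h).eq_iff, eq_comm]

/-- A matrix over Majoranas, extended by zero to all slots. -/
noncomputable def pad (h : m ≤ n) (M : Matrix (Majorana m n) (Majorana m n) ℝ) :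
    Matrix (Fin 4 × Fin n) (Fin 4 × Fin n) ℝ :=
  (slotMatrix h)ᵀ * M * slotMatrix h

theorem pad_mul (h : m ≤ n) (M N : Matrix (Majorana m n) (Majorana m n) ℝ) :
    pad h (M * N) = pad h M * pad h N := by
  calc pad h (M * N) = (slotMatrix h)ᵀ * M * (slotMatrix h * (slotMatrix h)ᵀ) * N * slotMatrix h := by
        rw [slotMatrix_mul_transpose, Matrix.mul_one, pad]; simp only [Matrix.mul_assoc]
    _ = _ := by simp only [pad, Matrix.mul_assoc]

theorem pad_sub (h : m ≤ n) (M N : Matrix (Majorana m n) (Majorana m n) ℝ) :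
    pad h (M - N) = pad h M - pad h N := by
  simp only [pad, Matrix.mul_sub, Matrix.sub_mul]

theorem pad_slot (h : m ≤ n) (M : Matrix (Majorana m n) (Majorana m n) ℝ) (i j : Majorana m n) :
    pad h M (slot h i) (slot h j) = M i j := by
  simp [pad, slotMatrix, Matrix.mul_apply, (slot_injective h).eq_iff]

theorem pad_eq_sum (h : m ≤ n) (M : Matrix (Majorana m n) (Majorana m n) ℝ)
    (p q : Fin 4 × Fin n) :
    pad h M p q = ∑ j, (∑ i, (slotMatrix h) i p * M i j) * slotMatrix h j q := by
  simp only [pad, Matrix.mul_apply, Matrix.transpose_apply]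

theorem pad_eq_zero_left (h : m ≤ n) (M : Matrix (Majorana m n) (Majorana m n) ℝ)
    {p : Fin 4} {c : Fin n} (hp : ¬ IsSlot m c p) (q : Fin 4 × Fin n) : pad h M (p, c) q = 0 := by
  have : ∀ i, slot h i ≠ (p, c) := fun i hi => hp ((exists_slot_eq h p c).mp ⟨i, hi⟩)
  simp [pad_eq_sum, slotMatrix, this]

theorem pad_eq_zero_right (h : m ≤ n) (M : Matrix (Majorana m n) (Majorana m n) ℝ)
    {q : Fin 4} {c : Fin n} (hq : ¬ IsSlot m c q) (p : Fin 4 × Fin n) : pad h M p (q, c) = 0 := by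
  have : ∀ i, slot h i ≠ (q, c) := fun i hi => hq ((exists_slot_eq h q c).mp ⟨i, hi⟩)
  simp [pad_eq_sum, slotMatrix, this]

theorem pad_injective (h : m ≤ n) {M : Matrix (Majorana m n) (Majorana m n) ℝ}
    (hM : pad h M = 0) : M = 0 := by
  ext i j
  rw [← pad_slot h M, hM]; rfl

/-- Whether the Majorana of slot `p` of block `c` belongs to `X`. -/
def slotBits (h : m ≤ n) (X : Finset (Majorana m n)) (c : Fin n) (p : Fin 4) : Bool :=
  decide (∃ i ∈ X, slot h i = (p, c))

theorem slotBits_slot (h : m ≤ n) (X : Finset (Majorana m n)) (i : Majorana m n) :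
    slotBits h X (slot h i).2 (slot h i).1 = decide (i ∈ X) := by
  simp [slotBits, (slot_injective h).eq_iff]

/-- The diagonal projection onto the slots in `X`. -/
def slotProj (h : m ≤ n) (X : Finset (Majorana m n)) : Matrix (Fin 4 × Fin n) (Fin 4 × Fin n) ℝ :=
  Matrix.diagonal fun p => if slotBits h X p.2 p.1 then 1 else 0

theorem slotProj_sq (h : m ≤ n) (X : Finset (Majorana m n)) :
    slotProj h X * slotProj h X = slotProj h X := by
  rw [slotProj, Matrix.diagonal_mul_diagonal]
  congr 1
  funext p
  split_ifs <;> simp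

/-- Rows outside X are rows of the identity, so the matrix on the right is block triangular with
diagonal blocks Γ_X and 1. In this form all minors are determinants on one index set, on which the
projection is block diagonal. -/
theorem det_minor_eq (h : m ≤ n) (X : Finset (Majorana m n))
    (M : Matrix (Majorana m n) (Majorana m n) ℝ) :
    (M.submatrix (Subtype.val : X → Majorana m n) Subtype.val).det =
      (1 - slotProj h X + slotProj h X * pad h M).det := by
  have hent : ∀ p q, (1 - slotProj h X + slotProj h X * pad h M) p q =
      if slotBits h X p.2 p.1 then pad h M p q else (1 : Matrix _ _ ℝ) p q := by
    intro p q
    rw [Matrix.add_apply, Matrix.sub_apply, slotProj, Matrix.diagonal_mul, Matrix.diagonal_apply,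
      Matrix.one_apply]
    split_ifs <;> simp
  rw [Matrix.twoBlockTriangular_det (1 - slotProj h X + slotProj h X * pad h M)
    fun p => slotBits h X p.2 p.1 = true]
  · have h2 : (Matrix.toSquareBlockProp (1 - slotProj h X + slotProj h X * pad h M)
        fun p => ¬ slotBits h X p.2 p.1 = true) = 1 := by
      ext p q
      rw [Matrix.toSquareBlockProp_def, Matrix.of_apply, hent, if_neg p.2]
      simp [Matrix.one_apply, Subtype.ext_iff]
    rw [h2, Matrix.det_one, mul_one]
    have e : ∀ i : X, slotBits h X (slot h i).2 (slot h i).1 = true := fun i => by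
      rw [slotBits_slot]; simp
    let f : X ≃ {p : Fin 4 × Fin n // slotBits h X p.2 p.1 = true} :=
      Equiv.ofBijective (fun i => ⟨slot h i, e i⟩) ⟨fun i j hij =>
        Subtype.ext (slot_injective h (congrArg Subtype.val hij)), fun ⟨p, hp⟩ => by
        simp only [slotBits, decide_eq_true_eq] at hp
        obtain ⟨i, hi, hip⟩ := hp
        exact ⟨⟨i, hi⟩, Subtype.ext hip⟩⟩
    rw [← Matrix.det_submatrix_equiv_self f]
    congr 1
    ext i j
    rw [Matrix.submatrix_apply, Matrix.submatrix_apply, Matrix.toSquareBlockProp_def,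
      Matrix.of_apply, hent, if_pos (f i).2]
    exact (pad_slot h M i j).symm
  · intro p hp q hq
    rw [hent, if_neg hp, Matrix.one_apply_ne]
    rintro rfl
    exact hp hq

/-- Majoranas correspond to occupied slots, so their subsets are the bit patterns supported there.
-/
theorem sum_slotBits (h : m ≤ n) (Φ : (Fin n → Fin 4 → Bool) → ℝ) :
    ∑ X : Finset (Majorana m n), Φ (slotBits h X) =
      ∑ s : Fin n → Fin 4 → Bool,
        if ∀ c p, s c p = true → IsSlot m c p then Φ s else 0 := by
  rw [← Finset.sum_filter]
  refine Finset.sum_bij' (fun X _ => slotBits h X)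
    (fun s _ => Finset.univ.filter fun i => s (slot h i).2 (slot h i).1 = true) ?_ ?_ ?_ ?_ ?_
  · intro X _
    simp only [Finset.mem_filter, Finset.mem_univ, true_and, slotBits, decide_eq_true_eq]
    rintro c p ⟨i, -, hi⟩
    exact (exists_slot_eq h p c).mp ⟨i, hi⟩
  · simp
  · intro X _
    ext i
    simp [slotBits_slot]
  · intro s hs
    simp only [Finset.mem_filter, Finset.mem_univ, true_and] at hs
    funext c p
    rw [Bool.eq_iff_iff]
    simp only [slotBits, Finset.mem_filter, Finset.mem_univ, true_and, decide_eq_true_eq]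
    constructor
    · rintro ⟨i, hi, hic⟩
      rwa [hic] at hi
    · intro hcp
      obtain ⟨i, hi⟩ := (exists_slot_eq h p c).mpr (hs c p hcp)
      exact ⟨i, by rw [hi]; exact hcp, hi⟩
  · simp

/-- The support condition is imposed block by block, so distributivity exchanges sum and product.
This is the source of the independence of blocks. -/
theorem sum_prod_slotBits (h : m ≤ n) (g : Fin n → (Fin 4 → Bool) → ℝ) :
    ∑ X : Finset (Majorana m n), ∏ c, g c (slotBits h X c) =
      ∏ c : Fin n, ∑ t : Fin 4 → Bool, if ∀ p, t p = true → IsSlot m c p then g c t else 0 := by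
  rw [sum_slotBits h fun s => ∏ c, g c (s c), Finset.prod_univ_sum, Fintype.piFinset_univ]
  refine Finset.sum_congr rfl fun s _ => ?_
  split_ifs with hs
  · exact Finset.prod_congr rfl fun c _ => by rw [if_pos (hs c)]
  · push Not at hs
    obtain ⟨c, p, hp, hc⟩ := hs
    rw [Finset.prod_eq_zero (Finset.mem_univ c)]
    rw [if_neg]
    exact fun hall => hc (hall p hp)

end Pad

/-! ### Minors and inverses of one covariance block -/

section Local

/-- The covariance block `[[ν J, μ 1], [-μ 1, -ν J]]`. -/
def covBlock (ν μ : ℝ) : Matrix (Fin 4) (Fin 4) ℝ :=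
  !![0, ν, μ, 0; -ν, 0, 0, μ; -μ, 0, 0, -ν; 0, -μ, ν, 0]

/-- The diagonal projection onto a set of slots of a block. -/
def blockProj (t : Fin 4 → Bool) : Matrix (Fin 4) (Fin 4) ℝ :=
  Matrix.diagonal fun p => if t p then 1 else 0

/-- The principal minor of `covBlock` on a set of slots. -/
def covMinor (ν μ : ℝ) (t : Fin 4 → Bool) : ℝ :=
  match t 0, t 1, t 2, t 3 with
  | false, false, false, false => 1
  | true, true, false, false => ν ^ 2
  | false, false, true, true => ν ^ 2
  | true, false, true, false => μ ^ 2
  | false, true, false, true => μ ^ 2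
  | true, true, true, true => 1
  | _, _, _, _ => 0

/-- The inverse of the principal submatrix of `covBlock` on a set of slots, extended by zero. -/
noncomputable def covInv (ν μ : ℝ) (t : Fin 4 → Bool) : Matrix (Fin 4) (Fin 4) ℝ :=
  match t 0, t 1, t 2, t 3 with
  | true, true, false, false => !![0, -ν⁻¹, 0, 0; ν⁻¹, 0, 0, 0; 0, 0, 0, 0; 0, 0, 0, 0]
  | false, false, true, true => !![0, 0, 0, 0; 0, 0, 0, 0; 0, 0, 0, ν⁻¹; 0, 0, -ν⁻¹, 0]
  | true, false, true, false => !![0, 0, -μ⁻¹, 0; 0, 0, 0, 0; μ⁻¹, 0, 0, 0; 0, 0, 0, 0]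
  | false, true, false, true => !![0, 0, 0, 0; 0, 0, 0, -μ⁻¹; 0, 0, 0, 0; 0, μ⁻¹, 0, 0]
  | true, true, true, true => -covBlock ν μ
  | _, _, _, _ => 0

theorem boolVec_cases {P : (Fin 4 → Bool) → Prop} (h : ∀ a b c d, P ![a, b, c, d])
    (t : Fin 4 → Bool) : P t := by
  have : t = ![t 0, t 1, t 2, t 3] := by
    funext i; fin_cases i <;> rfl
  rw [this]
  exact h _ _ _ _

/-- A check of the sixteen subsets; the normalization is needed only for the full one, whose
determinant is (ν² + μ²)². -/
theorem det_covBlock_mask {ν μ : ℝ} (h : ν ^ 2 + μ ^ 2 = 1) (t : Fin 4 → Bool) :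
    (1 - blockProj t + blockProj t * covBlock ν μ).det = covMinor ν μ t := by
  revert t
  refine boolVec_cases ?_
  have hM : ∀ a b c d : Bool, (1 - blockProj ![a, b, c, d] + blockProj ![a, b, c, d] * covBlock ν μ) =
      !![(if a then 0 else 1), (if a then ν else 0), (if a then μ else 0), 0;
        (if b then -ν else 0), (if b then 0 else 1), 0, (if b then μ else 0);
        (if c then -μ else 0), 0, (if c then 0 else 1), (if c then -ν else 0);
        0, (if d then -μ else 0), (if d then ν else 0), (if d then 0 else 1)] := by
    intro a b c d
    ext i j
    rw [blockProj, Matrix.add_apply, Matrix.sub_apply, Matrix.diagonal_mul]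
    fin_cases i
    · cases a <;> fin_cases j <;> simp [covBlock]
    · cases b <;> fin_cases j <;> simp [covBlock]
    · cases c <;> fin_cases j <;> simp [covBlock]
    · cases d <;> fin_cases j <;> simp [covBlock]
  intro a b c d
  rw [hM]
  cases a <;> cases b <;> cases c <;> cases d <;>
    simp [covMinor, Matrix.det_succ_row_zero, Fin.sum_univ_succ, Fin.succAbove] <;>
    first
      | ring1
      | linear_combination (ν ^ 2 + μ ^ 2 + 1) * h

theorem blockProj_mul_covInv (ν μ : ℝ) (t : Fin 4 → Bool) :
    blockProj t * covInv ν μ t = covInv ν μ t := by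
  revert t
  refine boolVec_cases fun a b c d => ?_
  ext i j
  rw [blockProj, Matrix.diagonal_mul]
  cases a <;> cases b <;> cases c <;> cases d <;> fin_cases i <;> fin_cases j <;> simp [covInv]

theorem covInv_mul_blockProj (ν μ : ℝ) (t : Fin 4 → Bool) :
    covInv ν μ t * blockProj t = covInv ν μ t := by
  revert t
  refine boolVec_cases fun a b c d => ?_
  ext i j
  rw [blockProj, Matrix.mul_diagonal]
  cases a <;> cases b <;> cases c <;> cases d <;> fin_cases i <;> fin_cases j <;> simp [covInv]

theorem blockProj_mul_covBlock_mul_covInv {ν μ : ℝ} (h : ν ^ 2 + μ ^ 2 = 1) (t : Fin 4 → Bool)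
    (ht : covMinor ν μ t ≠ 0) :
    blockProj t * covBlock ν μ * covInv ν μ t = blockProj t := by
  revert t
  refine boolVec_cases fun a b c d ht => ?_
  ext i j
  rw [blockProj, Matrix.mul_assoc, Matrix.diagonal_mul, Matrix.mul_apply, Fin.sum_univ_four,
    Matrix.diagonal_apply]
  cases a <;> cases b <;> cases c <;> cases d <;> simp [covMinor] at ht <;>
    fin_cases i <;> fin_cases j <;> simp [covInv, covBlock, ht] <;>
    first | ring1 | linear_combination h

end Local

/-! ### Minors of the canonical covariance matrix -/

section Canonical
variable {m n : ℕ}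

/-- The parameter `ν` of each block; a block of `B` alone has `ν = -1`. -/
def nuExt (ν : Fin m → ℝ) (c : Fin n) : ℝ := if hc : (c : ℕ) < m then ν ⟨c, hc⟩ else -1

/-- The parameter `μ` of each block; a block of `B` alone has `μ = 0`. -/
def muExt (μ : Fin m → ℝ) (c : Fin n) : ℝ := if hc : (c : ℕ) < m then μ ⟨c, hc⟩ else 0

theorem nuExt_sq_add_muExt_sq {ν μ : Fin m → ℝ} (hμ : ∀ k, μ k ^ 2 = 1 - ν k ^ 2) (c : Fin n) :
    nuExt ν c ^ 2 + muExt μ c ^ 2 = 1 := by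
  unfold nuExt muExt
  split_ifs with hc
  · rw [hμ]; ring
  · norm_num

/-- The block of a matrix over all slots at a pair of blocks. -/
def slotBlock (A : Matrix (Fin 4 × Fin n) (Fin 4 × Fin n) ℝ) (c d : Fin n) :
    Matrix (Fin 4) (Fin 4) ℝ := Matrix.of fun p q => A (p, c) (q, d)

/-- The values ν = -1, μ = 0 on a block of B alone are chosen so that the B half -νJ equals J and
does not couple to the empty A slots. -/
theorem pad_canonicalCov (h : m ≤ n) (ν μ : Fin m → ℝ) (p q : Fin 4) (c d : Fin n)
    (hp : IsSlot m c p) (hq : IsSlot m d q) :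
    pad h (canonicalCov ν μ) (p, c) (q, d) =
      if c = d then covBlock (nuExt ν c) (muExt μ c) p q else 0 := by
  obtain ⟨i, hi⟩ := (exists_slot_eq h p c).mpr hp
  obtain ⟨j, hj⟩ := (exists_slot_eq h q d).mpr hq
  rw [← hi, ← hj, pad_slot]
  rcases i with ⟨k, i⟩ | ⟨k, i⟩ <;> rcases j with ⟨l, j⟩ | ⟨l, j⟩ <;>
    simp only [slot, Prod.mk.injEq] at hi hj <;> obtain ⟨rfl, rfl⟩ := hi <;>
    obtain ⟨rfl, rfl⟩ := hj
  · simp only [canonicalCov, Fin.castLE_inj]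
    split_ifs with hkl
    · fin_cases i <;> fin_cases j <;> simp [matJ, covBlock, nuExt]
    · rfl
  · have e : Fin.castLE h k = l ↔ (k : ℕ) = l := by rw [Fin.ext_iff]; rfl
    simp only [canonicalCov, e]
    by_cases hkl : (k : ℕ) = l
    · obtain rfl : Fin.castLE h k = l := Fin.ext hkl
      fin_cases i <;> fin_cases j <;> simp [covBlock, muExt]
    · simp [hkl]
  · have e : k = Fin.castLE h l ↔ (k : ℕ) = l := by rw [Fin.ext_iff]; rfl
    simp only [canonicalCov, e]
    by_cases hkl : (k : ℕ) = l
    · fin_cases i <;> fin_cases j <;> simp [hkl, covBlock, muExt]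
    · simp [hkl]
  · simp only [canonicalCov]
    split_ifs with hkl hk
    · fin_cases i <;> fin_cases j <;> simp [matJ, covBlock, nuExt, hk]
    · fin_cases i <;> fin_cases j <;> simp [matJ, covBlock, nuExt, hk]
    · rfl

theorem slotProj_eq_blockDiagonal (h : m ≤ n) (X : Finset (Majorana m n)) :
    slotProj h X = Matrix.blockDiagonal fun c => blockProj (slotBits h X c) := by
  ext ⟨p, c⟩ ⟨q, d⟩
  rw [slotProj, Matrix.diagonal_apply, Matrix.blockDiagonal_apply, blockProj]
  simp only [Matrix.diagonal_apply, Prod.mk.injEq]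
  by_cases hcd : c = d <;> simp [hcd]

theorem slotBits_isSlot (h : m ≤ n) {X : Finset (Majorana m n)} {c : Fin n} {p : Fin 4}
    (hp : slotBits h X c p = true) : IsSlot m c p := by
  simp only [slotBits, decide_eq_true_eq] at hp
  obtain ⟨i, -, hi⟩ := hp
  exact (exists_slot_eq h p c).mp ⟨i, hi⟩

/-- The two matrices differ only in rows of empty slots, which the projection removes: in an
occupied row of a block of B alone, the entries in empty columns are ±μ = 0 or 0. -/
theorem slotProj_mul_pad_canonicalCov (h : m ≤ n) (ν μ : Fin m → ℝ)
    (X : Finset (Majorana m n)) :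
    slotProj h X * pad h (canonicalCov ν μ) =
      slotProj h X * Matrix.blockDiagonal fun c => covBlock (nuExt ν c) (muExt μ c) := by
  ext ⟨p, c⟩ ⟨q, d⟩
  rw [slotProj, Matrix.diagonal_mul, Matrix.diagonal_mul, Matrix.blockDiagonal_apply]
  simp only
  by_cases hX : slotBits h X c p = true
  · congr 1
    have hp := slotBits_isSlot h hX
    by_cases hq : IsSlot m d q
    · exact pad_canonicalCov h ν μ p q c d hp hq
    · rw [pad_eq_zero_right h _ hq]
      simp only [IsSlot, not_or, not_lt, not_le] at hp hq
      split_ifs with hcd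
      · subst hcd
        have h2 := hp.resolve_left (by omega)
        have hc : ¬ (c : ℕ) < m := by omega
        simp only [covBlock, muExt, hc, dite_false]
        fin_cases p <;> fin_cases q <;> simp at hq h2 ⊢
      · rfl
  · simp [hX]

theorem det_minor_canonicalCov (h : m ≤ n) {ν μ : Fin m → ℝ} (hμ : ∀ k, μ k ^ 2 = 1 - ν k ^ 2)
    (X : Finset (Majorana m n)) :
    ((canonicalCov ν μ).submatrix (Subtype.val : X → Majorana m n) Subtype.val).det =
      ∏ c : Fin n, covMinor (nuExt ν c) (muExt μ c) (slotBits h X c) := by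
  rw [det_minor_eq h, slotProj_mul_pad_canonicalCov, slotProj_eq_blockDiagonal,
    ← Matrix.blockDiagonal_one, ← Matrix.blockDiagonal_sub, ← Matrix.blockDiagonal_mul,
    ← Matrix.blockDiagonal_add, Matrix.det_blockDiagonal]
  exact Finset.prod_congr rfl fun c _ => det_covBlock_mask (nuExt_sq_add_muExt_sq hμ c) _

/-- The inverse of the principal submatrix of `canonicalCov` on `X`, extended by zero. -/
noncomputable def minorInv (h : m ≤ n) (ν μ : Fin m → ℝ) (X : Finset (Majorana m n)) :
    Matrix (Fin 4 × Fin n) (Fin 4 × Fin n) ℝ :=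
  Matrix.blockDiagonal fun c => covInv (nuExt ν c) (muExt μ c) (slotBits h X c)

theorem exists_mask_inverse (h : m ≤ n) {ν μ : Fin m → ℝ} (hμ : ∀ k, μ k ^ 2 = 1 - ν k ^ 2)
    (X : Finset (Majorana m n))
    (hX : ∏ c : Fin n, covMinor (nuExt ν c) (muExt μ c) (slotBits h X c) ≠ 0) :
    ∃ N, (1 - slotProj h X + slotProj h X * pad h (canonicalCov ν μ)) * N = 1 ∧
      N * slotProj h X = minorInv h ν μ X := by
  set P := slotProj h X with hP
  set G := Matrix.blockDiagonal fun c : Fin n => covBlock (nuExt ν c) (muExt μ c) with hG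
  set R := minorInv h ν μ X with hR
  have hPP : P * P = P := slotProj_sq h X
  have hPR : P * R = R := by
    rw [hP, hR, slotProj_eq_blockDiagonal, minorInv, ← Matrix.blockDiagonal_mul]
    simp only [blockProj_mul_covInv]
  have hRP : R * P = R := by
    rw [hP, hR, slotProj_eq_blockDiagonal, minorInv, ← Matrix.blockDiagonal_mul]
    simp only [covInv_mul_blockProj]
  have hPGR : P * G * R = P := by
    rw [hP, hR, hG, slotProj_eq_blockDiagonal, minorInv, ← Matrix.blockDiagonal_mul,
      ← Matrix.blockDiagonal_mul]
    congr 1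
    funext c
    exact blockProj_mul_covBlock_mul_covInv (nuExt_sq_add_muExt_sq hμ c) _
      (Finset.prod_ne_zero_iff.mp hX c (Finset.mem_univ c))
  rw [slotProj_mul_pad_canonicalCov]
  -- Relative to the range of P the matrix is upper triangular with diagonal parts PGP and 1. As R
  -- inverts PGP, this is the inverse of a triangular block matrix.
  refine ⟨1 - P + R * (1 - G * (1 - P)), ?_, ?_⟩
  · have h1 : (1 - P) * (1 - P) = 1 - P := by
      rw [Matrix.mul_sub, Matrix.sub_mul, Matrix.sub_mul, hPP]; simp
    have h2 : (1 - P) * R = 0 := by rw [Matrix.sub_mul, hPR, Matrix.one_mul, sub_self]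
    calc (1 - P + P * G) * (1 - P + R * (1 - G * (1 - P)))
        = (1 - P) * (1 - P) + ((1 - P) * R) * (1 - G * (1 - P)) + P * G * (1 - P) +
          (P * G * R) * (1 - G * (1 - P)) := by noncomm_ring
      _ = 1 := by rw [h1, h2, hPGR]; noncomm_ring
  · have h1 : (1 - P) * P = 0 := by rw [Matrix.sub_mul, hPP, Matrix.one_mul, sub_self]
    calc (1 - P + R * (1 - G * (1 - P))) * P
        = (1 - P) * P + (R * P - R * G * ((1 - P) * P)) := by noncomm_ring
      _ = R := by rw [h1, hRP]; simp

end Canonical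

/-! ### First and second derivatives along a line of generators -/

section Hessian
variable {m n : ℕ}

theorem canonicalCov_skew (ν μ : Fin m → ℝ) (i j : Majorana m n) :
    canonicalCov ν μ j i = -canonicalCov ν μ i j := by
  have hJ : ∀ i j : Fin 2, matJ j i = -matJ i j := by
    intro i j; fin_cases i <;> fin_cases j <;> simp [matJ]
  rcases i with ⟨k, i⟩ | ⟨k, i⟩ <;> rcases j with ⟨l, j⟩ | ⟨l, j⟩
  · simp only [canonicalCov, hJ i j, eq_comm (a := l)]
    split_ifs with h
    · subst h; ring
    · simp
  · simp only [canonicalCov, eq_comm (a := (l : ℕ)), eq_comm (a := j)]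
    split_ifs <;> simp
  · simp only [canonicalCov, eq_comm (a := (l : ℕ)), eq_comm (a := j)]
    split_ifs <;> simp
  · simp only [canonicalCov, hJ i j, eq_comm (a := l)]
    by_cases h : k = l
    · subst h; simp
    · simp [h]

theorem conj_skew {κ : Type*} [Fintype κ] {G : Matrix κ κ ℝ} (hG : ∀ i j, G j i = -G i j)
    (O : Matrix κ κ ℝ) (i j : κ) : (O * G * Oᵀ) j i = -(O * G * Oᵀ) i j := by
  have h : Gᵀ = -G := by ext i j; exact hG i j
  have : (O * G * Oᵀ)ᵀ = -(O * G * Oᵀ) := by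
    rw [Matrix.transpose_mul, Matrix.transpose_mul, Matrix.transpose_transpose, h]
    simp [Matrix.mul_assoc]
  exact congrFun (congrFun this i) j

/-- The first two derivatives of `orbitF` along a line, as sums over minors. -/
theorem orbitF_derivs (h : m ≤ n) {α : ℝ} (hα : 1 < α) {ν μ : Fin m → ℝ}
    (hμ : ∀ k, μ k ^ 2 = 1 - ν k ^ 2) (K : LocalGen m n) {A₁ A₂ : Matrix (Majorana m n) (Majorana m n) ℝ}
    (hA₁ : A₁ = genMatrix K * canonicalCov ν μ - canonicalCov ν μ * genMatrix K)
    (hA₂ : A₂ = genMatrix K * A₁ - A₁ * genMatrix K)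
    (htr : ∀ X, (minorInv h ν μ X * pad h A₁).trace = 0) :
    fderiv ℝ (orbitF α (canonicalCov ν μ)) 0 K = 0 ∧
    orbitHessian α (canonicalCov ν μ) K K = ∑ X : Finset (Majorana m n),
      α * ((∏ c, covMinor (nuExt ν c) (muExt μ c) (slotBits h X c)) ^ α *
        ((minorInv h ν μ X * pad h A₂).trace -
          (minorInv h ν μ X * pad h A₁ * minorInv h ν μ X * pad h A₁).trace)) := by
  set Γ : Matrix (Majorana m n) (Majorana m n) ℝ := canonicalCov ν μ with hΓ
  have hf := contDiff_orbitF hα Γ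
  obtain ⟨e1, e2⟩ := deriv_along_line hf K
  rw [← e1, orbitHessian, ← e2]
  let S : ℝ → Matrix (Majorana m n) (Majorana m n) ℝ →
    Matrix (Majorana m n) (Majorana m n) ℝ := fun t G =>
      NormedSpace.exp (t • genMatrix K) * G * (NormedSpace.exp (t • genMatrix K))ᵀ
  have hS0 : ∀ G, S 0 G = G := fun G => by simp [S]
  have hS : ∀ G t i j, HasDerivAt (fun s => S s G i j)
      (S t (genMatrix K * G - G * genMatrix K) i j) t := fun G t i j =>
    hasDerivAt_conj_exp (genMatrix K) G (genMatrix_transpose K) t i j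
  have hline : (fun t : ℝ => orbitF α Γ (t • K)) = fun t =>
      ∑ X : Finset (Majorana m n), |pfMinor (S t Γ) X| ^ (2 * α) := rfl
  have hg : ∀ X, ContDiff ℝ 2 fun t : ℝ => pfMinor (S t Γ) X := fun X =>
    ContDiff.pfMinor (G := fun t : ℝ => S t Γ) (fun i j => by
      have h1 : ContDiff ℝ 2 fun t : ℝ => t • K := contDiff_id.smul contDiff_const
      exact (contDiff_orbit_apply Γ i j).comp h1) X
  have key : ∀ X, deriv (fun t => |pfMinor (S t Γ) X| ^ (2 * α)) 0 = 0 ∧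
      deriv (deriv fun t => |pfMinor (S t Γ) X| ^ (2 * α)) 0 =
        α * ((∏ c, covMinor (nuExt ν c) (muExt μ c) (slotBits h X c)) ^ α *
          ((minorInv h ν μ X * pad h A₂).trace -
            (minorInv h ν μ X * pad h A₁ * minorInv h ν μ X * pad h A₁).trace)) := by
    intro X
    have hdet : ∀ t, pfMinor (S t Γ) X ^ 2 =
        (1 - slotProj h X + slotProj h X * pad h (S t Γ)).det := fun t => by
      rw [← det_minor_eq h]
      exact pfMinor_sq _ (conj_skew (canonicalCov_skew ν μ) _) X
    have hD0 : (1 - slotProj h X + slotProj h X * pad h (S 0 Γ)).det =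
        ∏ c, covMinor (nuExt ν c) (muExt μ c) (slotBits h X c) := by
      rw [hS0, ← det_minor_eq h, det_minor_canonicalCov h hμ]
    have hpad : ∀ G t p q, HasDerivAt (fun s => (slotProj h X * pad h (S s G)) p q)
        ((slotProj h X * pad h (S t (genMatrix K * G - G * genMatrix K))) p q) t := by
      intro G t p q
      simp only [slotProj, Matrix.diagonal_mul, pad_eq_sum]
      refine HasDerivAt.const_mul _ (HasDerivAt.fun_sum fun j _ => HasDerivAt.mul_const ?_ _)
      exact HasDerivAt.fun_sum fun i _ => (hS G t i j).const_mul _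
    have hM : ∀ t p q, HasDerivAt
        (fun s => (1 - slotProj h X + slotProj h X * pad h (S s Γ)) p q)
        ((slotProj h X * pad h (S t A₁)) p q) t := by
      intro t p q
      simp only [Matrix.add_apply]
      rw [hA₁]
      exact (hpad Γ t p q).const_add _
    have hM' : ∀ p q, HasDerivAt (fun s => (slotProj h X * pad h (S s A₁)) p q)
        ((slotProj h X * pad h A₂) p q) 0 := by
      intro p q
      have := hpad A₁ 0 p q
      rwa [← hA₂, hS0] at this
    rw [← hD0]
    -- Invertibility of the masked matrix is available only for nonvanishing minors; the other
    -- minors are covered by the case g 0 = 0 of `deriv_abs_rpow_comp`.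
    have hboth : (1 - slotProj h X + slotProj h X * pad h (S 0 Γ)).det ≠ 0 →
        deriv (fun t => (1 - slotProj h X + slotProj h X * pad h (S t Γ)).det) 0 = 0 ∧
        deriv (deriv fun t => (1 - slotProj h X + slotProj h X * pad h (S t Γ)).det) 0 =
          (1 - slotProj h X + slotProj h X * pad h (S 0 Γ)).det *
          ((minorInv h ν μ X * pad h A₂).trace -
            (minorInv h ν μ X * pad h A₁ * minorInv h ν μ X * pad h A₁).trace) := by
      intro hne
      rw [hD0] at hne
      obtain ⟨N, hN, hNP⟩ := exists_mask_inverse h hμ X hne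
      have hN' : (1 - slotProj h X + slotProj h X * pad h (S 0 Γ)) * N = 1 := by rw [hS0]; exact hN
      obtain ⟨d1, d2⟩ := deriv_det_of_isUnit hM hM' hN'
      have t1 : (N * (slotProj h X * pad h (S 0 A₁))).trace = 0 := by
        rw [hS0, ← Matrix.mul_assoc, hNP, htr]
      refine ⟨by rw [d1, t1, mul_zero], ?_⟩
      rw [d2, t1, hS0 A₁]
      congr 1
      -- The derivatives of the masked matrix all begin with the projection, so N enters only
      -- through its product with it, which is `minorInv`.
      have t2 : N * (slotProj h X * pad h A₂) = minorInv h ν μ X * pad h A₂ := by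
        rw [← Matrix.mul_assoc, hNP]
      have t3 : N * (slotProj h X * pad h A₁) * N * (slotProj h X * pad h A₁) =
          minorInv h ν μ X * pad h A₁ * minorInv h ν μ X * pad h A₁ := by
        rw [← Matrix.mul_assoc N, hNP, Matrix.mul_assoc _ N, ← Matrix.mul_assoc N, hNP]
        simp only [Matrix.mul_assoc]
      rw [t2, t3]
      ring
    exact deriv_abs_rpow_comp hα (hg X) hdet (fun hne => (hboth hne).1) (fun hne => (hboth hne).2)
  have hC : ∀ X, ContDiff ℝ 2 fun t => |pfMinor (S t Γ) X| ^ (2 * α) := fun X =>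
    (contDiff_two_abs_rpow (by linarith)).comp (hg X)
  have hd : ∀ X, Differentiable ℝ fun t => |pfMinor (S t Γ) X| ^ (2 * α) := fun X =>
    (hC X).differentiable (by norm_num)
  have hd' : ∀ X, Differentiable ℝ (deriv fun t => |pfMinor (S t Γ) X| ^ (2 * α)) := fun X => by
    have := hC X
    rw [show (2 : WithTop ℕ∞) = 1 + 1 by norm_num, contDiff_succ_iff_deriv] at this
    exact this.2.2.differentiable (by norm_num)
  have hderiv : deriv (fun t : ℝ => orbitF α Γ (t • K)) = fun t =>
      ∑ X : Finset (Majorana m n), deriv (fun t => |pfMinor (S t Γ) X| ^ (2 * α)) t := by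
    funext t
    rw [hline]
    exact deriv_fun_sum fun X _ => hd X t
  rw [hderiv]
  refine ⟨Finset.sum_eq_zero fun X _ => (key X).1, ?_⟩
  rw [deriv_fun_sum fun X _ => hd' X 0]
  exact Finset.sum_congr rfl fun X _ => (key X).2

end Hessian

/-! ### Blocks of generators and of commutators -/

section SlotBlocks
variable {m n : ℕ}

theorem slotBlock_mul (A B : Matrix (Fin 4 × Fin n) (Fin 4 × Fin n) ℝ) (c d : Fin n) :
    slotBlock (A * B) c d = ∑ e, slotBlock A c e * slotBlock B e d := by
  ext p q
  simp only [slotBlock, Matrix.of_apply, Matrix.mul_apply, Matrix.sum_apply]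
  rw [Fintype.sum_prod_type, Finset.sum_comm]

theorem slotBlock_sub (A B : Matrix (Fin 4 × Fin n) (Fin 4 × Fin n) ℝ) (c d : Fin n) :
    slotBlock (A - B) c d = slotBlock A c d - slotBlock B c d := rfl

theorem slotBlock_blockDiagonal (r : Fin n → Matrix (Fin 4) (Fin 4) ℝ) (c d : Fin n) :
    slotBlock (Matrix.blockDiagonal r) c d = if c = d then r c else 0 := by
  ext p q
  simp only [slotBlock, Matrix.of_apply, Matrix.blockDiagonal_apply]
  split_ifs <;> rfl

theorem trace_eq_sum_slotBlock (A : Matrix (Fin 4 × Fin n) (Fin 4 × Fin n) ℝ) :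
    A.trace = ∑ c, (slotBlock A c c).trace := by
  simp only [Matrix.trace, Matrix.diag_apply, slotBlock, Matrix.of_apply]
  rw [Fintype.sum_prod_type, Finset.sum_comm]

theorem slotBlock_blockDiagonal_mul (r : Fin n → Matrix (Fin 4) (Fin 4) ℝ)
    (A : Matrix (Fin 4 × Fin n) (Fin 4 × Fin n) ℝ) (c d : Fin n) :
    slotBlock (Matrix.blockDiagonal r * A) c d = r c * slotBlock A c d := by
  rw [slotBlock_mul, Finset.sum_eq_single c]
  · rw [slotBlock_blockDiagonal, if_pos rfl]
  · intro e _ he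
    rw [slotBlock_blockDiagonal, if_neg he.symm, Matrix.zero_mul]
  · simp

theorem slotBlock_mul_blockDiagonal (r : Fin n → Matrix (Fin 4) (Fin 4) ℝ)
    (A : Matrix (Fin 4 × Fin n) (Fin 4 × Fin n) ℝ) (c d : Fin n) :
    slotBlock (A * Matrix.blockDiagonal r) c d = slotBlock A c d * r d := by
  rw [slotBlock_mul, Finset.sum_eq_single d]
  · rw [slotBlock_blockDiagonal, if_pos rfl]
  · intro e _ he
    rw [slotBlock_blockDiagonal, if_neg he, Matrix.mul_zero]
  · simp

theorem trace_blockDiagonal_mul (r : Fin n → Matrix (Fin 4) (Fin 4) ℝ)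
    (A : Matrix (Fin 4 × Fin n) (Fin 4 × Fin n) ℝ) :
    (Matrix.blockDiagonal r * A).trace = ∑ c, (r c * slotBlock A c c).trace := by
  simp only [trace_eq_sum_slotBlock, slotBlock_blockDiagonal_mul]

theorem trace_blockDiagonal_mul_mul (r : Fin n → Matrix (Fin 4) (Fin 4) ℝ)
    (A : Matrix (Fin 4 × Fin n) (Fin 4 × Fin n) ℝ) :
    (Matrix.blockDiagonal r * A * Matrix.blockDiagonal r * A).trace =
      ∑ c, ∑ d, (r c * slotBlock A c d * r d * slotBlock A d c).trace := by
  rw [trace_eq_sum_slotBlock]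
  refine Finset.sum_congr rfl fun c _ => ?_
  rw [slotBlock_mul, Matrix.trace_sum]
  simp only [slotBlock_mul_blockDiagonal, slotBlock_blockDiagonal_mul]

theorem pad_transpose (h : m ≤ n) (M : Matrix (Majorana m n) (Majorana m n) ℝ) :
    (pad h M)ᵀ = pad h Mᵀ := by
  simp only [pad, Matrix.transpose_mul, Matrix.transpose_transpose, Matrix.mul_assoc]

theorem pad_neg (h : m ≤ n) (M : Matrix (Majorana m n) (Majorana m n) ℝ) :
    pad h (-M) = -pad h M := by
  simp only [pad, Matrix.mul_neg, Matrix.neg_mul]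

/-- The block of a generator at a pair of blocks. -/
noncomputable def genBlock (h : m ≤ n) (K : LocalGen m n) (c d : Fin n) :
    Matrix (Fin 4) (Fin 4) ℝ := slotBlock (pad h (genMatrix K)) c d

theorem genBlock_swap (h : m ≤ n) (K : LocalGen m n) (c d : Fin n) :
    genBlock h K d c = -(genBlock h K c d)ᵀ := by
  ext p q
  have := congrFun (congrFun (pad_transpose h (genMatrix K)) (p, d)) (q, c)
  rw [genMatrix_transpose, pad_neg, Matrix.transpose_apply, Matrix.neg_apply] at this
  simp only [genBlock, slotBlock, Matrix.of_apply, Matrix.neg_apply, Matrix.transpose_apply, this,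
    neg_neg]

theorem genBlock_eq_zero_left (h : m ≤ n) (K : LocalGen m n) {c : Fin n} (d : Fin n) {p : Fin 4}
    (q : Fin 4) (hp : ¬ IsSlot m c p) : genBlock h K c d p q = 0 :=
  pad_eq_zero_left h _ hp _

theorem genBlock_eq_zero_right (h : m ≤ n) (K : LocalGen m n) (c : Fin n) {d : Fin n} (p : Fin 4)
    {q : Fin 4} (hq : ¬ IsSlot m d q) : genBlock h K c d p q = 0 :=
  pad_eq_zero_right h _ hq _

theorem slot_fst_lt_two (h : m ≤ n) (i : Majorana m n) :
    ((slot h i).1 : ℕ) < 2 ↔ i.inA = true := by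
  rcases i with ⟨k, i⟩ | ⟨k, i⟩
  · simp only [slot, Majorana.inA, iff_true]; omega
  · simp [slot, Majorana.inA]; omega

theorem genBlock_eq_zero (h : m ≤ n) (K : LocalGen m n) (c d : Fin n) {p q : Fin 4}
    (hpq : ¬ ((p : ℕ) < 2 ↔ (q : ℕ) < 2)) : genBlock h K c d p q = 0 := by
  by_cases hp : IsSlot m c p
  · by_cases hq : IsSlot m d q
    · obtain ⟨i, hi⟩ := (exists_slot_eq h p c).mpr hp
      obtain ⟨j, hj⟩ := (exists_slot_eq h q d).mpr hq
      rw [genBlock, slotBlock, Matrix.of_apply, ← hi, ← hj, pad_slot]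
      refine K.2.2 i j fun hij => hpq ?_
      have h1 := slot_fst_lt_two h i
      have h2 := slot_fst_lt_two h j
      rw [hi] at h1
      rw [hj] at h2
      simp only at h1 h2
      rw [h1, h2, hij]
    · exact genBlock_eq_zero_right h K c p hq
  · exact genBlock_eq_zero_left h K d q hp

/-- A block of a generator, from its parts in `A` and in `B`. -/
def blockSum (a b : Fin 2 → Fin 2 → ℝ) : Matrix (Fin 4) (Fin 4) ℝ :=
  !![a 0 0, a 0 1, 0, 0; a 1 0, a 1 1, 0, 0; 0, 0, b 0 0, b 0 1; 0, 0, b 1 0, b 1 1]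

theorem genBlock_eq_blockSum (h : m ≤ n) (K : LocalGen m n) (c d : Fin n) :
    genBlock h K c d = blockSum
      (fun i j => genBlock h K c d ⟨i, by omega⟩ ⟨j, by omega⟩)
      (fun i j => genBlock h K c d ⟨2 + i, by omega⟩ ⟨2 + j, by omega⟩) := by
  ext p q
  fin_cases p <;> fin_cases q <;> first | rfl | exact genBlock_eq_zero h K c d (by simp)

theorem covBlock_transpose (ν μ : ℝ) : (covBlock ν μ)ᵀ = -covBlock ν μ := by
  ext i j
  fin_cases i <;> fin_cases j <;> simp [covBlock]

theorem slotProj_univ_mul_pad (h : m ≤ n) (M : Matrix (Majorana m n) (Majorana m n) ℝ) :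
    pad h M * slotProj h Finset.univ = pad h M := by
  ext p ⟨q, d⟩
  rw [slotProj, Matrix.mul_diagonal]
  by_cases hq : IsSlot m d q
  · obtain ⟨i, hi⟩ := (exists_slot_eq h q d).mpr hq
    have : slotBits h Finset.univ d q = true := by
      simp only [slotBits, decide_eq_true_eq]
      exact ⟨i, Finset.mem_univ _, hi⟩
    simp [this]
  · rw [pad_eq_zero_right h _ hq, zero_mul]

/-- The padded covariance and the full block diagonal matrix differ only at empty slots, and the
corresponding columns of `pad h M` vanish. -/
theorem pad_mul_pad_canonicalCov (h : m ≤ n) (ν μ : Fin m → ℝ)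
    (M : Matrix (Majorana m n) (Majorana m n) ℝ) :
    pad h M * pad h (canonicalCov ν μ) =
      pad h M * Matrix.blockDiagonal fun c => covBlock (nuExt ν c) (muExt μ c) := by
  rw [← slotProj_univ_mul_pad h M, Matrix.mul_assoc, slotProj_mul_pad_canonicalCov,
    Matrix.mul_assoc]

theorem pad_canonicalCov_mul_pad (h : m ≤ n) (ν μ : Fin m → ℝ)
    (M : Matrix (Majorana m n) (Majorana m n) ℝ) :
    pad h (canonicalCov ν μ) * pad h M =
      (Matrix.blockDiagonal fun c => covBlock (nuExt ν c) (muExt μ c)) * pad h M := by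
  -- The left version follows from the right one by transposition, both covariance matrices being
  -- skew.
  have h1 := congrArg Matrix.transpose (pad_mul_pad_canonicalCov h ν μ Mᵀ)
  have hs : (canonicalCov ν μ : Matrix (Majorana m n) (Majorana m n) ℝ)ᵀ = -canonicalCov ν μ := by
    ext i j; exact canonicalCov_skew ν μ i j
  rw [Matrix.transpose_mul, Matrix.transpose_mul, pad_transpose, pad_transpose, hs,
    Matrix.transpose_transpose, Matrix.blockDiagonal_transpose, pad_neg] at h1
  simp only [covBlock_transpose] at h1
  have h2 : (Matrix.blockDiagonal fun c : Fin n => -covBlock (nuExt ν c) (muExt μ c)) =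
      -Matrix.blockDiagonal fun c : Fin n => covBlock (nuExt ν c) (muExt μ c) :=
    Matrix.blockDiagonal_neg _
  rw [h2, Matrix.neg_mul, Matrix.neg_mul] at h1
  exact neg_injective h1

/-- The blocks of the commutator of a generator with the canonical covariance matrix. -/
theorem slotBlock_commutator (h : m ≤ n) (ν μ : Fin m → ℝ) (K : LocalGen m n) (c d : Fin n) :
    slotBlock (pad h (genMatrix K * canonicalCov ν μ - canonicalCov ν μ * genMatrix K)) c d =
      genBlock h K c d * covBlock (nuExt ν d) (muExt μ d) -
        covBlock (nuExt ν c) (muExt μ c) * genBlock h K c d := by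
  rw [pad_sub, pad_mul, pad_mul, pad_mul_pad_canonicalCov, pad_canonicalCov_mul_pad, slotBlock_sub,
    slotBlock_mul_blockDiagonal, slotBlock_blockDiagonal_mul]
  rfl

end SlotBlocks

/-! ### The product measure on subsets -/

section Mean
variable {m n : ℕ}

/-- The weight of a set of slots of a block. -/
noncomputable def blockWeight (α : ℝ) (ν μ : Fin m → ℝ) (c : Fin n) (t : Fin 4 → Bool) : ℝ :=
  if ∀ p, t p = true → IsSlot m c p then covMinor (nuExt ν c) (muExt μ c) t ^ α else 0

theorem covMinor_nonneg (ν μ : ℝ) (t : Fin 4 → Bool) : 0 ≤ covMinor ν μ t := by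
  unfold covMinor
  split <;> positivity

theorem blockWeight_nonneg (α : ℝ) (ν μ : Fin m → ℝ) (c : Fin n) (t : Fin 4 → Bool) :
    0 ≤ blockWeight α ν μ c t := by
  unfold blockWeight
  split_ifs
  · exact Real.rpow_nonneg (covMinor_nonneg _ _ _) _
  · exact le_rfl

/-- The total weight of a block. -/
noncomputable def blockTotal (α : ℝ) (ν μ : Fin m → ℝ) (c : Fin n) : ℝ :=
  ∑ t, blockWeight α ν μ c t

theorem blockTotal_pos (α : ℝ) (ν μ : Fin m → ℝ) (c : Fin n) : 0 < blockTotal α ν μ c := by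
  refine Finset.sum_pos' (fun t _ => blockWeight_nonneg α ν μ c t) ⟨fun _ => false,
    Finset.mem_univ _, ?_⟩
  simp [blockWeight, covMinor]

/-- The normalized weight of a set of slots of a block. -/
noncomputable def blockProb (α : ℝ) (ν μ : Fin m → ℝ) (c : Fin n) (t : Fin 4 → Bool) : ℝ :=
  blockWeight α ν μ c t / blockTotal α ν μ c

theorem sum_blockProb (α : ℝ) (ν μ : Fin m → ℝ) (c : Fin n) : ∑ t, blockProb α ν μ c t = 1 := by
  unfold blockProb
  rw [← Finset.sum_div]
  exact div_self (blockTotal_pos α ν μ c).ne'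

/-- The minors factor over the blocks, and so do their α-th powers; normalized, they form a product
measure. -/
theorem sum_minor_rpow_mul_prod (h : m ≤ n) (α : ℝ) (ν μ : Fin m → ℝ)
    (g : Fin n → (Fin 4 → Bool) → ℝ) :
    ∑ X : Finset (Majorana m n),
      (∏ c, covMinor (nuExt ν c) (muExt μ c) (slotBits h X c)) ^ α * ∏ c, g c (slotBits h X c) =
    (∏ c : Fin n, blockTotal α ν μ c) * ∏ c, ∑ t, blockProb α ν μ c t * g c t := by
  have h1 := sum_prod_slotBits h fun (c : Fin n) t =>
    covMinor (nuExt ν c) (muExt μ c) t ^ α * g c t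
  have h2 : ∀ X : Finset (Majorana m n),
      (∏ c, covMinor (nuExt ν c) (muExt μ c) (slotBits h X c)) ^ α * ∏ c, g c (slotBits h X c) =
      ∏ c, covMinor (nuExt ν c) (muExt μ c) (slotBits h X c) ^ α * g c (slotBits h X c) := by
    intro X
    rw [Finset.prod_mul_distrib, Real.finsetProd_rpow _ _ fun c _ => covMinor_nonneg _ _ _]
  rw [Finset.sum_congr rfl fun X _ => h2 X, h1, ← Finset.prod_mul_distrib]
  refine Finset.prod_congr rfl fun c _ => ?_
  rw [Finset.mul_sum]
  refine Finset.sum_congr rfl fun t _ => ?_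
  have := (blockTotal_pos α ν μ c).ne'
  unfold blockProb blockWeight
  split_ifs
  · field_simp
  · simp

/-- Independence of the parts of X in two distinct blocks: it holds for products of indicator
functions, and every function of the two parts is a combination of these. -/
theorem sum_minor_rpow_mul_two (h : m ≤ n) (α : ℝ) (ν μ : Fin m → ℝ) {c d : Fin n} (hcd : c ≠ d)
    (f : (Fin 4 → Bool) → (Fin 4 → Bool) → ℝ) :
    ∑ X : Finset (Majorana m n),
      (∏ c, covMinor (nuExt ν c) (muExt μ c) (slotBits h X c)) ^ α *
        f (slotBits h X c) (slotBits h X d) =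
    (∏ c : Fin n, blockTotal α ν μ c) *
      ∑ s, ∑ t, blockProb α ν μ c s * blockProb α ν μ d t * f s t := by
  have h1 : ∀ s t : Fin 4 → Bool, ∑ X : Finset (Majorana m n),
      (∏ c, covMinor (nuExt ν c) (muExt μ c) (slotBits h X c)) ^ α *
        ((if slotBits h X c = s then 1 else 0) * (if slotBits h X d = t then 1 else 0)) =
      (∏ c : Fin n, blockTotal α ν μ c) * (blockProb α ν μ c s * blockProb α ν μ d t) := by
    intro s t
    have h2 := sum_minor_rpow_mul_prod h α ν μ fun e x =>
      (if e = c then (if x = s then (1 : ℝ) else 0) else 1) *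
        (if e = d then (if x = t then (1 : ℝ) else 0) else 1)
    simp only [Finset.prod_mul_distrib, Finset.prod_ite_eq', Finset.mem_univ, if_true] at h2
    rw [h2]
    congr 1
    have h3 : ∀ e : Fin n, ∑ x, blockProb α ν μ e x *
        ((if e = c then (if x = s then (1 : ℝ) else 0) else 1) *
        (if e = d then (if x = t then (1 : ℝ) else 0) else 1)) =
        (if e = c then blockProb α ν μ c s else 1) * (if e = d then blockProb α ν μ d t else 1) := by
      intro e
      by_cases hc : e = c
      · subst hc
        simp [hcd]
      · by_cases hd : e = d
        · subst hd
          simp [hc]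
        · simp [hc, hd, sum_blockProb]
    simp only [h3, Finset.prod_mul_distrib, Finset.prod_ite_eq', Finset.mem_univ, if_true]
  have h4 : ∀ X : Finset (Majorana m n),
      (∏ c, covMinor (nuExt ν c) (muExt μ c) (slotBits h X c)) ^ α *
        f (slotBits h X c) (slotBits h X d) =
      ∑ s, ∑ t, (∏ c, covMinor (nuExt ν c) (muExt μ c) (slotBits h X c)) ^ α *
        ((if slotBits h X c = s then 1 else 0) * (if slotBits h X d = t then 1 else 0)) * f s t := by
    intro X
    simp
  rw [Finset.sum_congr rfl fun X _ => h4 X, Finset.sum_comm, Finset.mul_sum]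
  refine Finset.sum_congr rfl fun s _ => ?_
  rw [Finset.sum_comm, Finset.mul_sum]
  refine Finset.sum_congr rfl fun t _ => ?_
  rw [← Finset.sum_mul, h1]
  ring

theorem sum_minor_rpow_mul_one (h : m ≤ n) (α : ℝ) (ν μ : Fin m → ℝ) (c : Fin n)
    (f : (Fin 4 → Bool) → ℝ) :
    ∑ X : Finset (Majorana m n),
      (∏ c, covMinor (nuExt ν c) (muExt μ c) (slotBits h X c)) ^ α * f (slotBits h X c) =
    (∏ c : Fin n, blockTotal α ν μ c) * ∑ s, blockProb α ν μ c s * f s := by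
  have h2 := sum_minor_rpow_mul_prod h α ν μ fun e x => if e = c then f x else 1
  simp only [Finset.prod_ite_eq', Finset.mem_univ, if_true] at h2
  rw [h2]
  congr 1
  have h3 : ∀ e : Fin n, ∑ x, blockProb α ν μ e x * (if e = c then f x else 1) =
      if e = c then ∑ s, blockProb α ν μ c s * f s else 1 := by
    intro e
    by_cases hc : e = c
    · subst hc; simp
    · simp [hc, sum_blockProb]
  simp only [h3, Finset.prod_ite_eq', Finset.mem_univ, if_true]

theorem sum_minor_rpow (h : m ≤ n) (α : ℝ) (ν μ : Fin m → ℝ) :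
    ∑ X : Finset (Majorana m n),
      (∏ c, covMinor (nuExt ν c) (muExt μ c) (slotBits h X c)) ^ α =
    ∏ c : Fin n, blockTotal α ν μ c := by
  have := sum_minor_rpow_mul_prod h α ν μ fun _ _ => 1
  simpa [sum_blockProb] using this

end Mean

/-! ### Criticality, and the Hessian as a sum over pairs of blocks -/

section Local

/-- The generator rotating the two slots of `A` and the two slots of `B` of a block. -/
def rotBlock (a b : ℝ) : Matrix (Fin 4) (Fin 4) ℝ :=
  !![0, a, 0, 0; -a, 0, 0, 0; 0, 0, 0, b; 0, 0, -b, 0]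

theorem rotBlock_commutator (a b ν μ : ℝ) :
    rotBlock a b * covBlock ν μ - covBlock ν μ * rotBlock a b =
      !![0, 0, 0, μ * (a - b); 0, 0, -(μ * (a - b)), 0; 0, μ * (a - b), 0, 0;
        -(μ * (a - b)), 0, 0, 0] := by
  ext i j
  rw [Matrix.sub_apply, Matrix.mul_apply, Matrix.mul_apply, Fin.sum_univ_four, Fin.sum_univ_four]
  fin_cases i <;> fin_cases j <;> simp [rotBlock, covBlock] <;> ring

/-- The commutator couples only the slots 0, 3 and 1, 2, whereas no inverse of a minor has an entry
there. This is why the canonical point is critical. -/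
theorem trace_covInv_commutator (a b ν μ : ℝ) (t : Fin 4 → Bool) :
    (covInv ν μ t * (rotBlock a b * covBlock ν μ - covBlock ν μ * rotBlock a b)).trace = 0 := by
  rw [rotBlock_commutator]
  revert t
  refine boolVec_cases fun x y z w => ?_
  cases x <;> cases y <;> cases z <;> cases w <;>
    simp [covInv, covBlock, Matrix.trace, Fin.sum_univ_four, Matrix.vecHead, Matrix.vecTail]

end Local

section Hessian
variable {m n : ℕ}

theorem genBlock_self_eq_rotBlock (h : m ≤ n) (K : LocalGen m n) (c : Fin n) :
    genBlock h K c c = rotBlock (genBlock h K c c 0 1) (genBlock h K c c 2 3) := by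
  have hs : ∀ p q, genBlock h K c c q p = -genBlock h K c c p q := fun p q =>
    congrFun (congrFun (genBlock_swap h K c c) q) p
  have hd : ∀ p, genBlock h K c c p p = 0 := fun p => by linarith [hs p p]
  rw [genBlock_eq_blockSum]
  ext p q
  have h1 := hs 0 1
  have h2 := hs 2 3
  fin_cases p <;> fin_cases q <;> simp [blockSum, rotBlock, hd] <;> assumption

/-- The mean of the inverses of the minors of a block. -/
noncomputable def blockMeanInv (α : ℝ) (ν μ : Fin m → ℝ) (c : Fin n) : Matrix (Fin 4) (Fin 4) ℝ :=
  ∑ t, blockProb α ν μ c t • covInv (nuExt ν c) (muExt μ c) t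

/-- The commutator block of a generator block with the canonical covariance matrix. -/
noncomputable def commBlock (ν μ : Fin m → ℝ) (c d : Fin n) (B : Matrix (Fin 4) (Fin 4) ℝ) :
    Matrix (Fin 4) (Fin 4) ℝ :=
  B * covBlock (nuExt ν d) (muExt μ d) - covBlock (nuExt ν c) (muExt μ c) * B

/-- The contribution of an ordered pair of blocks to the Hessian. -/
noncomputable def pairForm (α : ℝ) (ν μ : Fin m → ℝ) (c d : Fin n)
    (B : Matrix (Fin 4) (Fin 4) ℝ) : ℝ :=
  (blockMeanInv α ν μ c * (B * commBlock ν μ d c (-Bᵀ) - commBlock ν μ c d B * -Bᵀ)).trace -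
    if c = d then ∑ t, blockProb α ν μ c t *
      (covInv (nuExt ν c) (muExt μ c) t * commBlock ν μ c d B *
        covInv (nuExt ν c) (muExt μ c) t * commBlock ν μ d c (-Bᵀ)).trace
    else (blockMeanInv α ν μ c * commBlock ν μ c d B *
      blockMeanInv α ν μ d * commBlock ν μ d c (-Bᵀ)).trace

theorem pairForm_zero (α : ℝ) (ν μ : Fin m → ℝ) (c d : Fin n) : pairForm α ν μ c d 0 = 0 := by
  simp [pairForm, commBlock]

theorem pairForm_neg (α : ℝ) (ν μ : Fin m → ℝ) (c d : Fin n) (B : Matrix (Fin 4) (Fin 4) ℝ) :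
    pairForm α ν μ c d (-B) = pairForm α ν μ c d B := by
  have h : ∀ (e f : Fin n) (B : Matrix (Fin 4) (Fin 4) ℝ),
      commBlock ν μ e f (-B) = -commBlock ν μ e f B := by
    intro e f B
    simp only [commBlock, Matrix.neg_mul, Matrix.mul_neg]
    abel
  simp only [pairForm, Matrix.transpose_neg, h, Matrix.neg_mul, Matrix.mul_neg, neg_neg]

/-- The first and second derivatives of `orbitF` at the canonical point, in terms of blocks. -/
theorem orbitF_derivs_eq (h : m ≤ n) {α : ℝ} (hα : 1 < α) {ν μ : Fin m → ℝ}
    (hμ : ∀ k, μ k ^ 2 = 1 - ν k ^ 2) (K : LocalGen m n) :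
    fderiv ℝ (orbitF α (canonicalCov ν μ)) 0 K = 0 ∧
    orbitHessian α (canonicalCov ν μ) K K = α * (∏ c : Fin n, blockTotal α ν μ c) *
      ∑ c, ∑ d, pairForm α ν μ c d (genBlock h K c d) := by
  set A₁ := genMatrix K * canonicalCov ν μ - canonicalCov ν μ * genMatrix K with hA₁
  set A₂ := genMatrix K * A₁ - A₁ * genMatrix K with hA₂
  have hb : ∀ c d, slotBlock (pad h A₁) c d = commBlock ν μ c d (genBlock h K c d) := fun c d =>
    slotBlock_commutator h ν μ K c d
  have hb2 : ∀ c, slotBlock (pad h A₂) c c = ∑ d, (genBlock h K c d *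
      commBlock ν μ d c (-(genBlock h K c d)ᵀ) -
        commBlock ν μ c d (genBlock h K c d) * -(genBlock h K c d)ᵀ) := by
    intro c
    rw [hA₂, pad_sub, pad_mul, pad_mul, slotBlock_sub, slotBlock_mul, slotBlock_mul,
      ← Finset.sum_sub_distrib]
    refine Finset.sum_congr rfl fun d _ => ?_
    rw [hb, hb, ← genBlock_swap]
    rfl
  have htr : ∀ X, (minorInv h ν μ X * pad h A₁).trace = 0 := by
    intro X
    rw [minorInv, trace_blockDiagonal_mul]
    refine Finset.sum_eq_zero fun c _ => ?_
    rw [hb, genBlock_self_eq_rotBlock, commBlock, trace_covInv_commutator]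
  obtain ⟨e1, e2⟩ := orbitF_derivs h hα hμ K hA₁ hA₂ htr
  refine ⟨e1, ?_⟩
  rw [e2, ← Finset.mul_sum, mul_assoc]
  congr 1
  have t1 : ∀ X, (minorInv h ν μ X * pad h A₂).trace = ∑ c, ∑ d,
      (covInv (nuExt ν c) (muExt μ c) (slotBits h X c) * (genBlock h K c d *
      commBlock ν μ d c (-(genBlock h K c d)ᵀ) -
        commBlock ν μ c d (genBlock h K c d) * -(genBlock h K c d)ᵀ)).trace := by
    intro X
    rw [minorInv, trace_blockDiagonal_mul]
    refine Finset.sum_congr rfl fun c _ => ?_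
    rw [hb2, Matrix.mul_sum, Matrix.trace_sum]
  have t2 : ∀ X, (minorInv h ν μ X * pad h A₁ * minorInv h ν μ X * pad h A₁).trace = ∑ c, ∑ d,
      (covInv (nuExt ν c) (muExt μ c) (slotBits h X c) * commBlock ν μ c d (genBlock h K c d) *
      covInv (nuExt ν d) (muExt μ d) (slotBits h X d) *
        commBlock ν μ d c (-(genBlock h K c d)ᵀ)).trace := by
    intro X
    rw [minorInv, trace_blockDiagonal_mul_mul]
    refine Finset.sum_congr rfl fun c _ => Finset.sum_congr rfl fun d _ => ?_
    rw [hb, hb, genBlock_swap h K c d]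
  simp only [t1, t2, ← Finset.sum_sub_distrib, Finset.mul_sum]
  rw [Finset.sum_comm]
  refine Finset.sum_congr rfl fun c _ => ?_
  rw [Finset.sum_comm]
  refine Finset.sum_congr rfl fun d _ => ?_
  rw [pairForm]
  generalize genBlock h K c d * commBlock ν μ d c (-(genBlock h K c d)ᵀ) -
    commBlock ν μ c d (genBlock h K c d) * -(genBlock h K c d)ᵀ = M
  simp only [mul_sub, Finset.sum_sub_distrib]
  have l1 : ∀ M : Matrix (Fin 4) (Fin 4) ℝ,
      ∑ t, blockProb α ν μ c t * (covInv (nuExt ν c) (muExt μ c) t * M).trace =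
        (blockMeanInv α ν μ c * M).trace := by
    intro M
    rw [blockMeanInv, Matrix.sum_mul, Matrix.trace_sum]
    simp only [Matrix.smul_mul, Matrix.trace_smul, smul_eq_mul]
  rw [sum_minor_rpow_mul_one h α ν μ c
    fun t => (covInv (nuExt ν c) (muExt μ c) t * M).trace, l1]
  congr 1
  -- On the diagonal both inverses belong to the same part of X, so the mean of the product does not
  -- factor; for distinct blocks independence replaces each inverse by its mean.
  split_ifs with hcd
  · subst hcd
    exact sum_minor_rpow_mul_one h α ν μ c fun t => (covInv (nuExt ν c) (muExt μ c) t *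
      commBlock ν μ c c (genBlock h K c c) * covInv (nuExt ν c) (muExt μ c) t *
        commBlock ν μ c c (-(genBlock h K c c)ᵀ)).trace
  · rw [sum_minor_rpow_mul_two h α ν μ hcd fun s t => (covInv (nuExt ν c) (muExt μ c) s *
      commBlock ν μ c d (genBlock h K c d) * covInv (nuExt ν d) (muExt μ d) t *
        commBlock ν μ d c (-(genBlock h K c d)ᵀ)).trace]
    congr 1
    simp only [blockMeanInv, Matrix.sum_mul, Matrix.mul_sum, Matrix.trace_sum, Matrix.smul_mul,
      Matrix.mul_smul, Matrix.trace_smul, smul_eq_mul]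
    rw [Finset.sum_comm]
    simp only [Finset.mul_sum]
    refine Finset.sum_congr rfl fun s _ => Finset.sum_congr rfl fun t _ => ?_
    ring

end Hessian

/-! ### Total weights and mean inverses of the blocks -/

section Local

theorem sum_boolVec {M : Type*} [AddCommMonoid M] (f : (Fin 4 → Bool) → M) :
    ∑ t, f t = ∑ a, ∑ b, ∑ c, ∑ d, f ![a, b, c, d] := by
  let e : Bool × Bool × Bool × Bool ≃ (Fin 4 → Bool) :=
    { toFun := fun p => ![p.1, p.2.1, p.2.2.1, p.2.2.2]
      invFun := fun t => (t 0, t 1, t 2, t 3)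
      left_inv := fun _ => rfl
      right_inv := fun t => by funext i; fin_cases i <;> rfl }
  rw [← e.sum_comp]
  simp only [Fintype.sum_prod_type]
  rfl

/-- The weighted value `x (1 + |x| ^ (2α - 2))`. -/
noncomputable def hatVal (α x : ℝ) : ℝ := x + (x ^ 2) ^ α * x⁻¹

theorem mul_hatVal {α : ℝ} (hα : 1 < α) (x : ℝ) : x * hatVal α x = x ^ 2 + (x ^ 2) ^ α := by
  unfold hatVal
  by_cases hx : x = 0
  · simp [hx, Real.zero_rpow (by linarith : α ≠ 0)]
  · field_simp

theorem hatVal_neg (α x : ℝ) : hatVal α (-x) = -hatVal α x := by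
  simp only [hatVal, neg_sq, inv_neg]; ring

/-- The pairing `ν ν̂ + μ μ̂`. -/
noncomputable def hatDot (α ν μ : ℝ) : ℝ := ν * hatVal α ν + μ * hatVal α μ

theorem hatDot_eq {α : ℝ} (hα : 1 < α) {ν μ : ℝ} (h : ν ^ 2 + μ ^ 2 = 1) :
    hatDot α ν μ = 1 + (ν ^ 2) ^ α + (μ ^ 2) ^ α := by
  rw [hatDot, mul_hatVal hα, mul_hatVal hα]; linarith

theorem one_le_hatDot {α : ℝ} (hα : 1 < α) {ν μ : ℝ} (h : ν ^ 2 + μ ^ 2 = 1) :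
    1 ≤ hatDot α ν μ := by
  rw [hatDot_eq hα h]
  have := Real.rpow_nonneg (sq_nonneg ν) α
  have := Real.rpow_nonneg (sq_nonneg μ) α
  linarith

/-- The signed quadratic form attached to a two-block channel. -/
noncomputable def chanSq (σ τ : ℝ) (a b : Fin 2 → Fin 2 → ℝ) : ℝ :=
  (a 0 0 + σ * a 1 1 + τ * (b 0 0 + σ * b 1 1)) ^ 2 +
    (a 0 1 - σ * a 1 0 + τ * (b 0 1 - σ * b 1 0)) ^ 2

theorem blockSum_transpose_neg (a b : Fin 2 → Fin 2 → ℝ) :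
    -(blockSum a b)ᵀ = blockSum (fun i j => -a j i) (fun i j => -b j i) := by
  ext i j
  fin_cases i <;> fin_cases j <;> simp [blockSum]

/-- The block of the commutator with `covBlock`. -/
theorem blockSum_commutator (a b : Fin 2 → Fin 2 → ℝ) (ν μ ν' μ' : ℝ) :
    blockSum a b * covBlock ν' μ' - covBlock ν μ * blockSum a b =
    !![-a 0 1 * ν' - ν * a 1 0, a 0 0 * ν' - ν * a 1 1, a 0 0 * μ' - μ * b 0 0, a 0 1 * μ' - μ * b 0 1;
      -a 1 1 * ν' + ν * a 0 0, a 1 0 * ν' + ν * a 0 1, a 1 0 * μ' - μ * b 1 0, a 1 1 * μ' - μ * b 1 1;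
      -b 0 0 * μ' + μ * a 0 0, -b 0 1 * μ' + μ * a 0 1, b 0 1 * ν' + ν * b 1 0, -b 0 0 * ν' + ν * b 1 1;
      -b 1 0 * μ' + μ * a 1 0, -b 1 1 * μ' + μ * a 1 1, b 1 1 * ν' - ν * b 0 0, -b 1 0 * ν' - ν * b 0 1] := by
  ext i j
  rw [Matrix.sub_apply, Matrix.mul_apply, Matrix.mul_apply, Fin.sum_univ_four, Fin.sum_univ_four]
  fin_cases i <;> fin_cases j <;> simp [blockSum, covBlock]

end Local

section Total
variable {m n : ℕ}

theorem isSlot_of_lt {c : Fin n} (hc : (c : ℕ) < m) (p : Fin 4) : IsSlot m c p := Or.inl hc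

/-- The empty and full sets have weight 1, and two pairs each have weight |ν|^(2α) and |μ|^(2α). In
a block of B alone only the empty set and the pair of B slots contribute. -/
theorem blockTotal_eq {α : ℝ} (hα : 1 < α) {ν μ : Fin m → ℝ} (hμ : ∀ k, μ k ^ 2 = 1 - ν k ^ 2)
    (c : Fin n) : blockTotal α ν μ c =
      if (c : ℕ) < m then 2 * hatDot α (nuExt ν c) (muExt μ c) else 2 := by
  have hα0 : α ≠ 0 := by linarith
  rw [blockTotal, sum_boolVec]
  split_ifs with hc
  · rw [hatDot_eq hα (nuExt_sq_add_muExt_sq hμ c)]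
    simp [blockWeight, isSlot_of_lt hc, covMinor, hα0]
    ring
  · simp [blockWeight, IsSlot, hc, covMinor, hα0, nuExt, Fin.forall_fin_succ]
    norm_num

/-- The diagonal projection onto the slots of a block that are present. -/
noncomputable def slotMask (m : ℕ) (c : Fin n) : Matrix (Fin 4) (Fin 4) ℝ :=
  Matrix.diagonal fun p => by classical exact if IsSlot m c p then 1 else 0

theorem slotMask_of_lt {c : Fin n} (hc : (c : ℕ) < m) : slotMask m c = 1 := by
  simp [slotMask, isSlot_of_lt hc]

theorem slotMask_of_not_lt {c : Fin n} (hc : ¬ (c : ℕ) < m) :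
    slotMask m c = !![0, 0, 0, 0; 0, 0, 0, 0; 0, 0, 1, 0; 0, 0, 0, 1] := by
  ext i j
  fin_cases i <;> fin_cases j <;> simp [slotMask, IsSlot, hc]

/-- The sum of the inverses of the minors of a block, with arbitrary weights. -/
theorem sum_smul_covInv (w : (Fin 4 → Bool) → ℝ) (ν μ : ℝ) :
    ∑ t, w t • covInv ν μ t =
      w ![true, true, true, true] • -covBlock ν μ +
      w ![true, true, false, false] • !![0, -ν⁻¹, 0, 0; ν⁻¹, 0, 0, 0; 0, 0, 0, 0; 0, 0, 0, 0] +
      w ![true, false, true, false] • !![0, 0, -μ⁻¹, 0; 0, 0, 0, 0; μ⁻¹, 0, 0, 0; 0, 0, 0, 0] +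
      w ![false, true, false, true] • !![0, 0, 0, 0; 0, 0, 0, -μ⁻¹; 0, 0, 0, 0; 0, μ⁻¹, 0, 0] +
      w ![false, false, true, true] • !![0, 0, 0, 0; 0, 0, 0, 0; 0, 0, 0, ν⁻¹; 0, 0, -ν⁻¹, 0] := by
  rw [sum_boolVec]
  simp only [Fintype.sum_bool, covInv, Matrix.cons_val, smul_zero, add_zero, zero_add, add_assoc]

/-- The full set contributes `-covBlock` with weight 1, and a pair contributes an entry ±x⁻¹ of the
same sign pattern with weight |x|^(2α). Together each parameter x becomes x + |x|^(2α) / x, and the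
total weight is divided out. The masks remove the absent A slots of a block of B alone. -/
theorem blockMeanInv_eq {α : ℝ} (hα : 1 < α) {ν μ : Fin m → ℝ} (hμ : ∀ k, μ k ^ 2 = 1 - ν k ^ 2)
    (c : Fin n) : blockMeanInv α ν μ c = slotMask m c *
      (-(1 / (2 * hatDot α (nuExt ν c) (muExt μ c))) •
        covBlock (hatVal α (nuExt ν c)) (hatVal α (muExt μ c))) * slotMask m c := by
  have hα0 : α ≠ 0 := by linarith
  have hS := one_le_hatDot hα (nuExt_sq_add_muExt_sq hμ c)
  have hT := blockTotal_eq hα hμ c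
  rw [blockMeanInv, sum_smul_covInv]
  by_cases hc : (c : ℕ) < m
  · rw [if_pos hc] at hT
    rw [slotMask_of_lt hc, one_mul, mul_one]
    simp only [blockProb, hT, blockWeight, isSlot_of_lt hc, implies_true, if_true, covMinor,
      Matrix.cons_val]
    generalize nuExt ν c = x at *
    generalize muExt μ c = y at *
    have hne : hatDot α x y ≠ 0 := by linarith
    ext i j
    fin_cases i <;> fin_cases j <;> simp [covBlock, hatVal, -one_div] <;> ring
  · rw [if_neg hc] at hT
    rw [slotMask_of_not_lt hc]
    have h1 : nuExt ν c = -1 := by simp [nuExt, hc]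
    have h2 : muExt μ c = 0 := by simp [muExt, hc]
    have h3 : hatVal α (-1) = -2 := by norm_num [hatVal]
    have h4 : hatVal α 0 = 0 := by simp [hatVal]
    have h5 : hatDot α (-1) 0 = 2 := by rw [hatDot, h3, h4]; norm_num
    have hw : ∀ a b e f : Bool, (∀ p, ![a, b, e, f] p = true → IsSlot m c p) ↔
        a = false ∧ b = false := by
      intro a b e f
      simp [Fin.forall_fin_succ, IsSlot, hc]
    simp only [blockProb, hT, h1, h2, h3, h4, h5, blockWeight, hw]
    have hmat : ∀ x y : ℝ, !![0, 0, 0, 0; 0, 0, 0, 0; 0, 0, 1, 0; 0, 0, 0, 1] *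
        (x • covBlock y 0) * !![0, 0, 0, 0; 0, 0, 0, 0; 0, 0, 1, 0; 0, 0, 0, 1] =
        !![0, 0, 0, 0; 0, 0, 0, 0; 0, 0, 0, -(x * y); 0, 0, x * y, 0] := by
      intro x y
      ext i j
      simp only [Matrix.mul_apply, Fin.sum_univ_four]
      fin_cases i <;> fin_cases j <;> simp [covBlock]
    rw [hmat]
    ext i j
    fin_cases i <;> fin_cases j <;> simp [covMinor]

end Total

/-! ### Diagonalization of the two-block channels -/

section Local

/-- The bracket of the mean inverse with a two-block generator, as an explicit polynomial. -/
theorem trace_covBlock_second (a b : Fin 2 → Fin 2 → ℝ) (ν μ ν' μ' x y : ℝ) :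
    (covBlock x y * (blockSum a b * (-(blockSum a b)ᵀ * covBlock ν μ -
      covBlock ν' μ' * -(blockSum a b)ᵀ) -
      (blockSum a b * covBlock ν' μ' - covBlock ν μ * blockSum a b) * -(blockSum a b)ᵀ)).trace =
    2 * (ν * x + μ * y) * (a 0 0 ^ 2 + a 0 1 ^ 2 + a 1 0 ^ 2 + a 1 1 ^ 2 +
        b 0 0 ^ 2 + b 0 1 ^ 2 + b 1 0 ^ 2 + b 1 1 ^ 2)
      - 4 * (x * ν' * (a 0 0 * a 1 1 - a 0 1 * a 1 0 + b 0 0 * b 1 1 - b 0 1 * b 1 0) +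
        y * μ' * (a 0 0 * b 0 0 + a 0 1 * b 0 1 + a 1 0 * b 1 0 + a 1 1 * b 1 1)) := by
  rw [blockSum_commutator, blockSum_transpose_neg, blockSum_commutator]
  simp only [Matrix.trace, Fin.sum_univ_four, Matrix.diag_apply, Matrix.mul_apply, Matrix.sub_apply,
    covBlock, blockSum, Matrix.of_apply, Matrix.cons_val]
  ring

/-- The weight of a signed quadratic form of a two-block channel. -/
noncomputable def chanWeight (S S' ν μ ν' μ' x y x' y' σ τ : ℝ) : ℝ :=
  S * S' + σ * τ * (ν * y - μ * x) * (ν' * y' - μ' * x') - σ * x * x' - τ * y * y'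

/-- Up to the factor -4SS' the left side is the contribution of both orders of a pair of blocks to
the Hessian. It becomes diagonal in the signed combinations of entries that make up `chanSq`; the
relations ν² + μ² = 1 are needed to match the bilinear terms. -/
theorem trace_covBlock_channel (a b : Fin 2 → Fin 2 → ℝ) {ν μ ν' μ' : ℝ} (x y x' y' : ℝ)
    (h : ν ^ 2 + μ ^ 2 = 1) (h' : ν' ^ 2 + μ' ^ 2 = 1) {S S' : ℝ}
    (hS : S = ν * x + μ * y) (hS' : S' = ν' * x' + μ' * y') :
    2 * S' * (2 * S * (a 0 0 ^ 2 + a 0 1 ^ 2 + a 1 0 ^ 2 + a 1 1 ^ 2 +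
        b 0 0 ^ 2 + b 0 1 ^ 2 + b 1 0 ^ 2 + b 1 1 ^ 2)
      - 4 * (x * ν' * (a 0 0 * a 1 1 - a 0 1 * a 1 0 + b 0 0 * b 1 1 - b 0 1 * b 1 0) +
        y * μ' * (a 0 0 * b 0 0 + a 0 1 * b 0 1 + a 1 0 * b 1 0 + a 1 1 * b 1 1))) +
    2 * S * (2 * S' * (a 0 0 ^ 2 + a 0 1 ^ 2 + a 1 0 ^ 2 + a 1 1 ^ 2 +
        b 0 0 ^ 2 + b 0 1 ^ 2 + b 1 0 ^ 2 + b 1 1 ^ 2)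
      - 4 * (x' * ν * (a 0 0 * a 1 1 - a 0 1 * a 1 0 + b 0 0 * b 1 1 - b 0 1 * b 1 0) +
        y' * μ * (a 0 0 * b 0 0 + a 0 1 * b 0 1 + a 1 0 * b 1 0 + a 1 1 * b 1 1))) +
    2 * (covBlock x y * (blockSum a b * covBlock ν' μ' - covBlock ν μ * blockSum a b) *
      covBlock x' y' * (-(blockSum a b)ᵀ * covBlock ν μ - covBlock ν' μ' * -(blockSum a b)ᵀ)).trace
    = chanWeight S S' ν μ ν' μ' x y x' y' 1 1 * chanSq 1 1 a b +
      chanWeight S S' ν μ ν' μ' x y x' y' 1 (-1) * chanSq 1 (-1) a b +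
      chanWeight S S' ν μ ν' μ' x y x' y' (-1) 1 * chanSq (-1) 1 a b +
      chanWeight S S' ν μ ν' μ' x y x' y' (-1) (-1) * chanSq (-1) (-1) a b := by
  subst hS hS'
  rw [blockSum_commutator, blockSum_transpose_neg, blockSum_commutator]
  simp only [Matrix.trace, Fin.sum_univ_four, Matrix.diag_apply, Matrix.mul_apply,
    covBlock, Matrix.of_apply, Matrix.cons_val, chanWeight, chanSq]
  linear_combination (-4 * (x * x' * (a 0 0 * a 1 1 - a 0 1 * a 1 0 + b 0 0 * b 1 1 - b 0 1 * b 1 0) +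
        y * y' * (a 0 0 * b 0 0 + a 0 1 * b 0 1 + a 1 0 * b 1 0 + a 1 1 * b 1 1))) * h +
    (-4 * (x * x' * (a 0 0 * a 1 1 - a 0 1 * a 1 0 + b 0 0 * b 1 1 - b 0 1 * b 1 0) +
        y * y' * (a 0 0 * b 0 0 + a 0 1 * b 0 1 + a 1 0 * b 1 0 + a 1 1 * b 1 1))) * h'

end Local

section Channel
variable {m n : ℕ}

theorem slotMask_mul_genBlock (h : m ≤ n) (K : LocalGen m n) (c d : Fin n) :
    slotMask m c * genBlock h K c d = genBlock h K c d := by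
  ext p q
  rw [slotMask, Matrix.diagonal_mul]
  split_ifs with hp
  · rw [one_mul]
  · rw [zero_mul, genBlock_eq_zero_left h K d q hp]

theorem slotMask_mul_covBlock {c : Fin n} {x y : ℝ} (hc : ¬ (c : ℕ) < m → y = 0) :
    slotMask m c * covBlock x y = covBlock x y * slotMask m c := by
  by_cases hcm : (c : ℕ) < m
  · rw [slotMask_of_lt hcm, one_mul, mul_one]
  · ext p q
    rw [slotMask, Matrix.diagonal_mul, Matrix.mul_diagonal]
    fin_cases p <;> fin_cases q <;> simp [covBlock, IsSlot, hcm, hc hcm]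

theorem muExt_of_not_lt (μ : Fin m → ℝ) {c : Fin n} (hc : ¬ (c : ℕ) < m) : muExt μ c = 0 := by
  simp [muExt, hc]

/-- In front of matrices supported on occupied slots the masks may be dropped, so that blocks of B
alone are treated by the same formulas as the others. -/
theorem blockMeanInv_mul {α : ℝ} (hα : 1 < α) {ν μ : Fin m → ℝ} (hμ : ∀ k, μ k ^ 2 = 1 - ν k ^ 2)
    (c : Fin n) {M : Matrix (Fin 4) (Fin 4) ℝ} (hM : slotMask m c * M = M) :
    blockMeanInv α ν μ c * M = -(1 / (2 * hatDot α (nuExt ν c) (muExt μ c))) •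
      (covBlock (hatVal α (nuExt ν c)) (hatVal α (muExt μ c)) * M) := by
  rw [blockMeanInv_eq hα hμ, Matrix.mul_smul, Matrix.smul_mul, Matrix.smul_mul,
    slotMask_mul_covBlock, Matrix.mul_assoc, hM, Matrix.mul_assoc, hM]
  intro hc
  simp [muExt_of_not_lt μ hc, hatVal]

theorem slotMask_mul_commBlock (h : m ≤ n) (ν μ : Fin m → ℝ) (K : LocalGen m n) (c d : Fin n) :
    slotMask m c * commBlock ν μ c d (genBlock h K c d) = commBlock ν μ c d (genBlock h K c d) := by
  rw [commBlock, mul_sub, ← Matrix.mul_assoc, slotMask_mul_genBlock, ← Matrix.mul_assoc,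
    slotMask_mul_covBlock (fun hc => muExt_of_not_lt μ hc), Matrix.mul_assoc,
    slotMask_mul_genBlock]

theorem pairForm_of_ne (h : m ≤ n) {α : ℝ} (hα : 1 < α) {ν μ : Fin m → ℝ}
    (hμ : ∀ k, μ k ^ 2 = 1 - ν k ^ 2) (K : LocalGen m n) {c d : Fin n} (hcd : c ≠ d) :
    pairForm α ν μ c d (genBlock h K c d) =
      -(1 / (2 * hatDot α (nuExt ν c) (muExt μ c))) *
        (covBlock (hatVal α (nuExt ν c)) (hatVal α (muExt μ c)) * (genBlock h K c d *
          commBlock ν μ d c (-(genBlock h K c d)ᵀ) -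
            commBlock ν μ c d (genBlock h K c d) * -(genBlock h K c d)ᵀ)).trace -
      1 / (2 * hatDot α (nuExt ν c) (muExt μ c)) * (1 / (2 * hatDot α (nuExt ν d) (muExt μ d))) *
        (covBlock (hatVal α (nuExt ν c)) (hatVal α (muExt μ c)) *
          commBlock ν μ c d (genBlock h K c d) *
          covBlock (hatVal α (nuExt ν d)) (hatVal α (muExt μ d)) *
            commBlock ν μ d c (-(genBlock h K c d)ᵀ)).trace := by
  have h1 := blockMeanInv_mul hα hμ c (slotMask_mul_commBlock h ν μ K c d)
  have h2 := blockMeanInv_mul hα hμ d (slotMask_mul_commBlock h ν μ K d c)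
  rw [genBlock_swap h K c d] at h2
  have h3 := blockMeanInv_mul hα hμ c (M := genBlock h K c d *
          commBlock ν μ d c (-(genBlock h K c d)ᵀ) -
            commBlock ν μ c d (genBlock h K c d) * -(genBlock h K c d)ᵀ) (by
    rw [mul_sub, ← Matrix.mul_assoc, slotMask_mul_genBlock, ← Matrix.mul_assoc,
      slotMask_mul_commBlock])
  rw [pairForm, if_neg hcd, h3, Matrix.mul_assoc (blockMeanInv α ν μ c * _), h2, h1,
    Matrix.trace_smul, smul_eq_mul, Matrix.smul_mul, Matrix.mul_smul, smul_smul, Matrix.trace_smul,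
    smul_eq_mul]
  simp only [Matrix.mul_assoc]
  ring

/-- The contribution of a pair of distinct blocks, as a combination of squares. -/
theorem pairForm_add_pairForm (h : m ≤ n) {α : ℝ} (hα : 1 < α) {ν μ : Fin m → ℝ}
    (hμ : ∀ k, μ k ^ 2 = 1 - ν k ^ 2) (K : LocalGen m n) {c d : Fin n} (hcd : c ≠ d)
    {a b : Fin 2 → Fin 2 → ℝ} (hab : genBlock h K c d = blockSum a b) {w : ℝ → ℝ → ℝ}
    (hw : w = chanWeight (hatDot α (nuExt ν c) (muExt μ c)) (hatDot α (nuExt ν d) (muExt μ d))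
      (nuExt ν c) (muExt μ c) (nuExt ν d) (muExt μ d) (hatVal α (nuExt ν c))
      (hatVal α (muExt μ c)) (hatVal α (nuExt ν d)) (hatVal α (muExt μ d))) :
    pairForm α ν μ c d (genBlock h K c d) + pairForm α ν μ d c (genBlock h K d c) =
      -(1 / (4 * (hatDot α (nuExt ν c) (muExt μ c) * hatDot α (nuExt ν d) (muExt μ d)))) *
        (w 1 1 * chanSq 1 1 a b + w 1 (-1) * chanSq 1 (-1) a b + w (-1) 1 * chanSq (-1) 1 a b +
          w (-1) (-1) * chanSq (-1) (-1) a b) := by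
  have hS := one_le_hatDot hα (nuExt_sq_add_muExt_sq hμ c)
  have hS' := one_le_hatDot hα (nuExt_sq_add_muExt_sq hμ d)
  have key := trace_covBlock_channel a b (hatVal α (nuExt ν c)) (hatVal α (muExt μ c))
    (hatVal α (nuExt ν d)) (hatVal α (muExt μ d)) (nuExt_sq_add_muExt_sq hμ c)
    (nuExt_sq_add_muExt_sq hμ d) (rfl : hatDot α _ _ = _) (rfl : hatDot α _ _ = _)
  rw [← hw] at key
  rw [← key, pairForm_of_ne h hα hμ K hcd, pairForm_of_ne h hα hμ K hcd.symm, genBlock_swap h K c d]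
  -- By cyclicity the mixed traces of the two orders of the pair coincide.
  have hT : ∀ (ρ ρ' : Matrix (Fin 4) (Fin 4) ℝ) (e f : Matrix (Fin 4) (Fin 4) ℝ),
      (ρ * e * ρ' * f).trace = (ρ' * f * ρ * e).trace := by
    intro ρ ρ' e f
    rw [Matrix.mul_assoc (ρ * e), Matrix.trace_mul_comm, ← Matrix.mul_assoc]
  have htt : -(-(genBlock h K c d)ᵀ)ᵀ = genBlock h K c d := by
    rw [Matrix.transpose_neg, Matrix.transpose_transpose, neg_neg]
  rw [htt, hT (covBlock (hatVal α (nuExt ν d)) (hatVal α (muExt μ d)))]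
  have t1 := trace_covBlock_second a b (nuExt ν c) (muExt μ c) (nuExt ν d) (muExt μ d)
    (hatVal α (nuExt ν c)) (hatVal α (muExt μ c))
  have t2 := trace_covBlock_second (fun i j => -a j i) (fun i j => -b j i) (nuExt ν d) (muExt μ d)
    (nuExt ν c) (muExt μ c) (hatVal α (nuExt ν d)) (hatVal α (muExt μ d))
  rw [← blockSum_transpose_neg, ← hab, htt] at t2
  rw [← hab] at t1
  simp only [commBlock]
  rw [t1, t2, ← hab]
  simp only [← hatDot.eq_1]
  generalize hatDot α (nuExt ν c) (muExt μ c) = S at *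
  generalize hatDot α (nuExt ν d) (muExt μ d) = S' at *
  have : S ≠ 0 := by linarith
  have : S' ≠ 0 := by linarith
  field_simp
  ring

end Channel

/-! ### Positivity of the channel weights -/

section Gap

/-- The weight of a two-block channel between the points `(c, s)` and `(c', s')` of the circle, as a
polynomial in the enhancement factors. -/
noncomputable def gapPoly (p q p' q' c s c' s' : ℝ) : ℝ :=
  (c * c' + s * s' - 1) * (p * p' * (c * c') + q * q' * (s * s')) +
    p * q' * (c ^ 2 * s' ^ 2 - c * c' * (s * s')) + q * p' * (s ^ 2 * c' ^ 2 - c * c' * (s * s'))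

theorem gapPoly_symm (p q p' q' c s c' s' : ℝ) :
    gapPoly p q p' q' c s c' s' = gapPoly p' q' p q c' s' c s := by
  unfold gapPoly; ring

theorem gapPoly_swap (p q p' q' c s c' s' : ℝ) :
    gapPoly p q p' q' c s c' s' = gapPoly q p q' p' s c s' c' := by
  unfold gapPoly; ring

/-- For p < q the expression is q(2p - q) + (q - p)q(1 - v) + (q - p)pu, where q ≤ 2 ≤ 2p; the case
p > q is symmetric. -/
theorem factor_pos {p q u v : ℝ} (hp : 1 ≤ p) (hp2 : p ≤ 2) (hq : 1 ≤ q) (hq2 : q ≤ 2)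
    (hu : 0 ≤ u) (hv : 0 ≤ v) (hu1 : u < 1) (hv1 : v < 1) :
    0 < p * q - (p - q) * (p * u - q * v) := by
  rcases lt_trichotomy p q with h | h | h
  · have h1 : 0 < (q - p) * q * (1 - v) := by
      have : 0 < q - p := by linarith
      have : 0 < 1 - v := by linarith
      positivity
    have h2 : 0 ≤ (q - p) * (p * u) := by
      have : 0 ≤ q - p := by linarith
      positivity
    nlinarith
  · subst h; nlinarith
  · have h1 : 0 < (p - q) * p * (1 - u) := by
      have : 0 < p - q := by linarith
      have : 0 < 1 - u := by linarith
      positivity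
    have h2 : 0 ≤ (p - q) * (q * v) := by
      have : 0 ≤ p - q := by linarith
      positivity
    nlinarith

/-- Both points lie in the closed first quadrant. With C and D the cosine and sine of the angle
between them, multiplication by 1 + C and (1 + C)(C - 1) = -D² extract a factor D. The cofactor is a
combination of q' - q, p - p' and D with coefficients that are nonnegative for the first two and
positive for the last. -/
theorem gapPoly_pos_of_le {p q p' q' c s c' s' : ℝ} (hp : 1 ≤ p) (hp2 : p ≤ 2) (hq : 1 ≤ q)
    (hq2 : q ≤ 2) (hpp : p' ≤ p) (hqq : q ≤ q')
    (hc : 0 ≤ c) (hs : 0 ≤ s) (hc' : 0 ≤ c') (hs' : 0 ≤ s') (h : c ^ 2 + s ^ 2 = 1)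
    (h' : c' ^ 2 + s' ^ 2 = 1) (hss : s ≤ s') (hne : ¬ (c = c' ∧ s = s')) :
    0 < gapPoly p q p' q' c s c' s' := by
  have hcc : c' ≤ c := abs_le_of_sq_le_sq' (by nlinarith) hc |>.2
  have hid : (c * c' + s * s') ^ 2 + (c * s' - s * c') ^ 2 = 1 := by
    linear_combination (c' ^ 2 + s' ^ 2) * h + h'
  have hC0 : 0 ≤ c * c' + s * s' := by positivity
  have hC1 : c * c' + s * s' < 1 := by
    by_contra hcon
    have h1 : (c - c') ^ 2 + (s - s') ^ 2 ≤ 0 := by nlinarith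
    refine hne ⟨?_, ?_⟩
    · have : (c - c') ^ 2 = 0 := le_antisymm (by nlinarith [sq_nonneg (s - s')]) (sq_nonneg _)
      linarith [pow_eq_zero_iff (two_ne_zero) |>.mp this]
    · have : (s - s') ^ 2 = 0 := le_antisymm (by nlinarith [sq_nonneg (c - c')]) (sq_nonneg _)
      linarith [pow_eq_zero_iff (two_ne_zero) |>.mp this]
  have hD0 : 0 ≤ c * s' - s * c' := by nlinarith [mul_le_mul hcc hss hs hc]
  have hD : 0 < c * s' - s * c' := by
    rcases hD0.lt_or_eq with hlt | heq
    · exact hlt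
    · rw [← heq] at hid
      nlinarith
  set D := c * s' - s * c' with hDdef
  set C := c * c' + s * s' with hCdef
  have hu : 0 ≤ c * c' := by positivity
  have hv : 0 ≤ s * s' := by positivity
  -- The worst case is p = 1, q = 2, where the bracket is a sum of nonnegative terms.
  have hα1 : 0 ≤ s' * ((1 + C) * (p * c) - D * (q * s)) := by
    refine mul_nonneg hs' ?_
    have h1 : D * (q * s) ≤ 2 * (D * s) := by nlinarith [mul_nonneg hD0 hs]
    have h2 : (1 + C) * c ≤ (1 + C) * (p * c) := by
      nlinarith [mul_nonneg (by linarith : 0 ≤ 1 + C) hc]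
    have h3 : 2 * (D * s) ≤ (1 + C) * c := by
      have e : (1 + C) * c - 2 * (D * s) = c * (1 - s * s') + c ^ 2 * c' + 2 * (s ^ 2 * c') := by
        rw [hDdef, hCdef]; ring
      have : 0 ≤ 1 - s * s' := by linarith
      have : 0 ≤ c * (1 - s * s') + c ^ 2 * c' + 2 * (s ^ 2 * c') := by positivity
      linarith
    linarith
  have hβ1 : 0 ≤ (1 + C) * (q * s * c') + D * (p * (c * c')) := by positivity
  have hE : 0 < (1 + C) * (p * q' * (c * s') - q * p' * (s * c')) -
      D * (p * p' * (c * c') + q * q' * (s * s')) := by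
    have e : (1 + C) * (p * q' * (c * s') - q * p' * (s * c')) -
        D * (p * p' * (c * c') + q * q' * (s * s')) =
        (q' - q) * (s' * ((1 + C) * (p * c) - D * (q * s))) +
        (p - p') * ((1 + C) * (q * s * c') + D * (p * (c * c'))) +
        D * (p * q - (p - q) * (p * (c * c') - q * (s * s'))) := by
      rw [hDdef, hCdef]; ring
    rw [e]
    have h1 := mul_nonneg (by linarith : 0 ≤ q' - q) hα1
    have h2 := mul_nonneg (by linarith : 0 ≤ p - p') hβ1
    have h3 := mul_pos hD (factor_pos hp hp2 hq hq2 hu hv (by linarith) (by linarith))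
    linarith
  have hmain : (1 + C) * gapPoly p q p' q' c s c' s' =
      D * ((1 + C) * (p * q' * (c * s') - q * p' * (s * c')) -
      D * (p * p' * (c * c') + q * q' * (s * s'))) := by
    have e : gapPoly p q p' q' c s c' s' = (C - 1) * (p * p' * (c * c') + q * q' * (s * s')) +
        D * (p * q' * (c * s') - q * p' * (s * c')) := by
      rw [gapPoly, hDdef, hCdef]; ring
    rw [e]
    linear_combination (p * p' * (c * c') + q * q' * (s * s')) * hid
  have := mul_pos hD hE
  rw [← hmain] at this
  exact pos_of_mul_pos_right this (by linarith)

/-- The second point is reflected into the fourth quadrant. Multiplying by 1 plus the cosine of the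
angle again extracts a sine, and the cofactor is positive because 2q' ≥ p', 2q ≥ p and cc' + ss' ≤
1. -/
theorem gapPoly_pos_of_neg {p q p' q' c s c' s' : ℝ} (hp : 1 ≤ p) (hp2 : p ≤ 2) (hq : 1 ≤ q)
    (hp' : 1 ≤ p') (hp2' : p' ≤ 2) (hq' : 1 ≤ q')
    (hc : 0 < c) (hs : 0 < s) (hc' : 0 < c') (hs' : 0 < s') (h : c ^ 2 + s ^ 2 = 1)
    (h' : c' ^ 2 + s' ^ 2 = 1) : 0 < gapPoly p q p' q' c s c' (-s') := by
  have hid : (c * c' - s * s') ^ 2 + (c * s' + s * c') ^ 2 = 1 := by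
    linear_combination (c' ^ 2 + s' ^ 2) * h + h'
  have hC1 : 0 ≤ 1 - c * c' - s * s' := by nlinarith [sq_nonneg (c - c'), sq_nonneg (s - s')]
  have hu : 0 < c * c' := mul_pos hc hc'
  have hv : 0 < s * s' := mul_pos hs hs'
  have hB : 0 < c * s' * (p * q' * (1 - c * c' - s * s') + p * (2 * q' - p') * (c * c') +
        q * q' * (s * s')) +
      s * c' * (q * p' * (1 - c * c' - s * s') + p' * (2 * q - p) * (c * c') +
        q * q' * (s * s')) := by
    have : 0 ≤ 2 * q' - p' := by linarith
    have : 0 ≤ 2 * q - p := by linarith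
    have : 0 < p := by linarith
    have : 0 < q := by linarith
    have : 0 < p' := by linarith
    have : 0 < q' := by linarith
    positivity
  have hmain : (1 + (c * c' - s * s')) * gapPoly p q p' q' c s c' (-s') =
      (c * s' + s * c') * (c * s' * (p * q' * (1 - c * c' - s * s') + p * (2 * q' - p') * (c * c') +
        q * q' * (s * s')) +
      s * c' * (q * p' * (1 - c * c' - s * s') + p' * (2 * q - p) * (c * c') +
        q * q' * (s * s'))) := by
    unfold gapPoly
    linear_combination (p * p' * (c * c') - q * q' * (s * s')) * hid
  have := mul_pos (by positivity : 0 < c * s' + s * c') hB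
  rw [← hmain] at this
  exact pos_of_mul_pos_right this (by linarith)

/-- The leading product of weighted means is at least 1. The only term that may be negative is
(cc')(ss')(q - p)(q' - p'), at least -1/4 since 0 ≤ (cc')(ss') ≤ 1/4. -/
theorem gapPoly_pos_of_nonpos {p q p' q' c s c' s' : ℝ} (hp : 1 ≤ p) (hp2 : p ≤ 2) (hq : 1 ≤ q)
    (hq2 : q ≤ 2) (hp' : 1 ≤ p') (hp2' : p' ≤ 2) (hq' : 1 ≤ q') (hq2' : q' ≤ 2)
    (hc : c * c' ≤ 0) (hs : s * s' ≤ 0) (h : c ^ 2 + s ^ 2 = 1)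
    (h' : c' ^ 2 + s' ^ 2 = 1) : 0 < gapPoly p q p' q' c s c' s' := by
  have e : gapPoly p q p' q' c s c' s' = (c ^ 2 * p + s ^ 2 * q) * (c' ^ 2 * p' + s' ^ 2 * q') +
      (c * c') * (s * s') * ((q - p) * (q' - p')) - p * p' * (c * c') - q * q' * (s * s') := by
    unfold gapPoly; ring
  rw [e]
  have h1 : 1 ≤ c ^ 2 * p + s ^ 2 * q := by nlinarith [sq_nonneg c, sq_nonneg s]
  have h2 : 1 ≤ c' ^ 2 * p' + s' ^ 2 * q' := by nlinarith [sq_nonneg c', sq_nonneg s']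
  have h3 : 1 ≤ (c ^ 2 * p + s ^ 2 * q) * (c' ^ 2 * p' + s' ^ 2 * q') := one_le_mul_of_one_le_of_one_le h1 h2
  have h4 : -1 ≤ (q - p) * (q' - p') := by nlinarith
  have h5 : (c * c') * (s * s') ≤ 1 / 4 := by
    have e1 : (c * s) * (c' * s') ≤ 1 / 4 := by
      nlinarith [sq_nonneg (c * s - c' * s'), sq_nonneg (c ^ 2 - s ^ 2), sq_nonneg (c' ^ 2 - s' ^ 2)]
    linarith
  have h6 : 0 ≤ (c * c') * (s * s') := mul_nonneg_of_nonpos_of_nonpos hc hs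
  have h7 : 0 ≤ p * p' * (-(c * c')) := by
    have : 0 ≤ -(c * c') := by linarith
    positivity
  have h8 : 0 ≤ q * q' * (-(s * s')) := by
    have : 0 ≤ -(s * s') := by linarith
    positivity
  nlinarith

/-- The enhancement factor `1 + |x| ^ (2α - 2)`. -/
noncomputable def enhance (α x : ℝ) : ℝ := 1 + (x ^ 2) ^ (α - 1)

theorem hatVal_eq_mul_enhance (α x : ℝ) : hatVal α x = x * enhance α x := by
  unfold hatVal enhance
  by_cases hx : x = 0
  · simp [hx]
  · have : (x ^ 2) ^ α = (x ^ 2) ^ (α - 1) * x ^ 2 := by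
      conv_lhs => rw [show α = (α - 1) + 1 by ring]
      rw [Real.rpow_add_one (by positivity)]
    rw [this]
    field_simp

theorem one_le_enhance (α x : ℝ) : 1 ≤ enhance α x := by
  have := Real.rpow_nonneg (sq_nonneg x) (α - 1)
  unfold enhance; linarith

theorem enhance_mono {α : ℝ} (hα : 1 < α) {x y : ℝ} (h : x ^ 2 ≤ y ^ 2) :
    enhance α x ≤ enhance α y := by
  have := Real.rpow_le_rpow (sq_nonneg x) h (by linarith : 0 ≤ α - 1)
  unfold enhance; linarith

theorem enhance_le_two {α : ℝ} (hα : 1 < α) {x y : ℝ} (h : x ^ 2 + y ^ 2 = 1) :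
    enhance α x ≤ 2 := by
  have := Real.rpow_le_one (sq_nonneg x) (by nlinarith [sq_nonneg y] : x ^ 2 ≤ 1)
    (by linarith : 0 ≤ α - 1)
  unfold enhance; linarith

/-- The polynomial involves the points only through squares and the products cc' and ss', so the
signs of these products decide the case and absolute values may be taken. If both are nonnegative,
ordering |s| and |s'| orders |c| and |c'| oppositely, and the factors follow since `enhance` is
monotone. -/
theorem gapPoly_enhance_pos {α : ℝ} (hα : 1 < α) {c s c' s' : ℝ} (h : c ^ 2 + s ^ 2 = 1)
    (h' : c' ^ 2 + s' ^ 2 = 1) (hne : ¬ (c = c' ∧ s = s')) :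
    0 < gapPoly (enhance α c) (enhance α s) (enhance α c') (enhance α s') c s c' s' := by
  have b1 := one_le_enhance α c
  have b2 := one_le_enhance α s
  have b3 := one_le_enhance α c'
  have b4 := one_le_enhance α s'
  have d1 := enhance_le_two hα h
  have d2 := enhance_le_two hα ((add_comm _ _).trans h)
  have d3 := enhance_le_two hα h'
  have d4 := enhance_le_two hα ((add_comm _ _).trans h')
  have ha : |c| ^ 2 + |s| ^ 2 = 1 := by simpa using h
  have ha' : |c'| ^ 2 + |s'| ^ 2 = 1 := by simpa using h'
  rcases le_or_gt 0 (c * c') with hc | hc <;> rcases le_or_gt 0 (s * s') with hs | hs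
  · have hne' : ¬ (|c| = |c'| ∧ |s| = |s'|) := by
      rintro ⟨e1, e2⟩
      refine hne ⟨?_, ?_⟩
      · rcases abs_eq_abs.mp e1 with e | e
        · exact e
        · subst e; have : c' = 0 := by nlinarith
          simp [this]
      · rcases abs_eq_abs.mp e2 with e | e
        · exact e
        · subst e; have : s' = 0 := by nlinarith
          simp [this]
    have e : gapPoly (enhance α c) (enhance α s) (enhance α c') (enhance α s') c s c' s' =
        gapPoly (enhance α c) (enhance α s) (enhance α c') (enhance α s') |c| |s| |c'| |s'| := by
      simp only [gapPoly, ← abs_mul, abs_of_nonneg hc, abs_of_nonneg hs, sq_abs]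
    rw [e]
    rcases le_total |s| |s'| with hle | hle
    · have hsq : s ^ 2 ≤ s' ^ 2 := sq_le_sq.mpr hle
      exact gapPoly_pos_of_le b1 d1 b2 d2 (enhance_mono hα (by linarith)) (enhance_mono hα hsq)
        (abs_nonneg _) (abs_nonneg _) (abs_nonneg _) (abs_nonneg _) ha ha' hle hne'
    · have hsq : s' ^ 2 ≤ s ^ 2 := sq_le_sq.mpr hle
      rw [gapPoly_symm]
      exact gapPoly_pos_of_le b3 d3 b4 d4 (enhance_mono hα (by linarith)) (enhance_mono hα hsq)
        (abs_nonneg _) (abs_nonneg _) (abs_nonneg _) (abs_nonneg _) ha' ha hle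
        fun hcon => hne' ⟨hcon.1.symm, hcon.2.symm⟩
  · rcases hc.eq_or_lt with hc0 | hc0
    · exact gapPoly_pos_of_nonpos b1 d1 b2 d2 b3 d3 b4 d4 hc0.symm.le hs.le h h'
    · have e : gapPoly (enhance α c) (enhance α s) (enhance α c') (enhance α s') c s c' s' =
          gapPoly (enhance α c) (enhance α s) (enhance α c') (enhance α s') |c| |s| |c'| (-|s'|) := by
        simp only [gapPoly, mul_neg, neg_sq, ← abs_mul, abs_of_pos hc0, abs_of_neg hs, sq_abs, neg_neg]
      rw [e]
      exact gapPoly_pos_of_neg b1 d1 b2 b3 d3 b4 (abs_pos.mpr (left_ne_zero_of_mul hc0.ne'))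
        (abs_pos.mpr (left_ne_zero_of_mul hs.ne)) (abs_pos.mpr (right_ne_zero_of_mul hc0.ne'))
        (abs_pos.mpr (right_ne_zero_of_mul hs.ne)) ha ha'
  · rcases hs.eq_or_lt with hs0 | hs0
    · exact gapPoly_pos_of_nonpos b1 d1 b2 d2 b3 d3 b4 d4 hc.le hs0.symm.le h h'
    · rw [gapPoly_swap]
      have e : gapPoly (enhance α s) (enhance α c) (enhance α s') (enhance α c') s c s' c' =
          gapPoly (enhance α s) (enhance α c) (enhance α s') (enhance α c') |s| |c| |s'| (-|c'|) := by
        simp only [gapPoly, mul_neg, neg_sq, ← abs_mul, abs_of_pos hs0, abs_of_neg hc, sq_abs, neg_neg]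
      rw [e]
      exact gapPoly_pos_of_neg b2 d2 b1 b4 d4 b3 (abs_pos.mpr (left_ne_zero_of_mul hs0.ne'))
        (abs_pos.mpr (left_ne_zero_of_mul hc.ne)) (abs_pos.mpr (right_ne_zero_of_mul hs0.ne'))
        (abs_pos.mpr (right_ne_zero_of_mul hc.ne)) ((add_comm _ _).trans ha)
        ((add_comm _ _).trans ha')
  · exact gapPoly_pos_of_nonpos b1 d1 b2 d2 b3 d3 b4 d4 hc.le hs.le h h'

/-- The weights of a two-block channel are positive, unless the points of the circle agree up to
the signs of the channel. -/
theorem chanWeight_pos {α : ℝ} (hα : 1 < α) {ν μ ν' μ' : ℝ} (h : ν ^ 2 + μ ^ 2 = 1)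
    (h' : ν' ^ 2 + μ' ^ 2 = 1) {σ τ : ℝ} (hσ : σ ^ 2 = 1) (hτ : τ ^ 2 = 1)
    (hne : ¬ (ν = σ * ν' ∧ μ = τ * μ')) :
    0 < chanWeight (hatDot α ν μ) (hatDot α ν' μ') ν μ ν' μ' (hatVal α ν) (hatVal α μ)
      (hatVal α ν') (hatVal α μ') σ τ := by
  have h1 : (σ * ν') ^ 2 = ν' ^ 2 := by rw [mul_pow, hσ, one_mul]
  have h2 : (τ * μ') ^ 2 = μ' ^ 2 := by rw [mul_pow, hτ, one_mul]
  have h3 := gapPoly_enhance_pos hα h (c' := σ * ν') (s' := τ * μ') (by rw [h1, h2, h']) hne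
  have e1 : enhance α (σ * ν') = enhance α ν' := by simp only [enhance, h1]
  have e2 : enhance α (τ * μ') = enhance α μ' := by simp only [enhance, h2]
  rw [e1, e2] at h3
  -- Modulo σ² = τ² = 1 the weight is the gap polynomial at (ν, μ) and the sign-changed point (σν',
  -- τμ').
  convert h3 using 1
  simp only [chanWeight, hatDot, hatVal_eq_mul_enhance α, gapPoly]
  linear_combination
    (-enhance α μ * enhance α ν' * ν' ^ 2 * μ ^ 2 - ν ^ 2 * enhance α ν * ν' ^ 2 * enhance α ν') * hσ
    - (enhance α ν * enhance α μ' * μ' ^ 2 * ν ^ 2 + μ ^ 2 * enhance α μ * μ' ^ 2 * enhance α μ') * hτ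

/-- At matching points the weight is (νν̂ + μμ̂)² + (νμ̂ - μν̂)² - ν̂² - μ̂², which vanishes by
Lagrange's identity. -/
theorem chanWeight_eq_zero {α : ℝ} {ν μ ν' μ' : ℝ} (h : ν ^ 2 + μ ^ 2 = 1)
    {σ τ : ℝ} (hσ : σ ^ 2 = 1) (hτ : τ ^ 2 = 1)
    (hν : ν' = σ * ν) (hμ : μ' = τ * μ) :
    chanWeight (hatDot α ν μ) (hatDot α ν' μ') ν μ ν' μ' (hatVal α ν) (hatVal α μ)
      (hatVal α ν') (hatVal α μ') σ τ = 0 := by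
  subst hν hμ
  rcases mul_self_eq_one_iff.mp ((sq σ).symm.trans hσ) with rfl | rfl <;>
  rcases mul_self_eq_one_iff.mp ((sq τ).symm.trans hτ) with rfl | rfl <;>
  · simp only [chanWeight, hatDot, neg_mul, one_mul, hatVal_neg]
    linear_combination (hatVal α ν ^ 2 + hatVal α μ ^ 2) * h

end Gap

/-! ### Negative semidefiniteness and the null directions -/

section Kernel

/-- Every entry of the commutator is a combination of products of a channel coordinate with ν' - σν
or μ' - τμ for the same signs; by hypothesis one of the factors vanishes each time. -/
theorem blockSum_commutator_eq_zero {a b : Fin 2 → Fin 2 → ℝ} {ν μ ν' μ' : ℝ}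
    (hst : ∀ σ τ : ℝ, σ ^ 2 = 1 → τ ^ 2 = 1 →
      chanSq σ τ a b = 0 ∨ (ν = σ * ν' ∧ μ = τ * μ')) :
    blockSum a b * covBlock ν' μ' - covBlock ν μ * blockSum a b = 0 := by
  have key : ∀ σ τ : ℝ, σ ^ 2 = 1 → τ ^ 2 = 1 →
      (a 0 0 + σ * a 1 1 + τ * (b 0 0 + σ * b 1 1)) * (ν' - σ * ν) = 0 ∧
      (a 0 0 + σ * a 1 1 + τ * (b 0 0 + σ * b 1 1)) * (μ' - τ * μ) = 0 ∧
      (a 0 1 - σ * a 1 0 + τ * (b 0 1 - σ * b 1 0)) * (ν' - σ * ν) = 0 ∧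
      (a 0 1 - σ * a 1 0 + τ * (b 0 1 - σ * b 1 0)) * (μ' - τ * μ) = 0 := by
    intro σ τ hσ hτ
    rcases hst σ τ hσ hτ with h | ⟨h1, h2⟩
    · unfold chanSq at h
      have hx : (a 0 0 + σ * a 1 1 + τ * (b 0 0 + σ * b 1 1)) = 0 := by
        refine pow_eq_zero_iff two_ne_zero |>.mp (le_antisymm ?_ (sq_nonneg _))
        linarith [sq_nonneg (a 0 1 - σ * a 1 0 + τ * (b 0 1 - σ * b 1 0))]
      have hy : (a 0 1 - σ * a 1 0 + τ * (b 0 1 - σ * b 1 0)) = 0 := by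
        refine pow_eq_zero_iff two_ne_zero |>.mp (le_antisymm ?_ (sq_nonneg _))
        linarith [sq_nonneg (a 0 0 + σ * a 1 1 + τ * (b 0 0 + σ * b 1 1))]
      rw [hx, hy]
      simp
    · have e1 : ν' - σ * ν = 0 := by rw [h1, ← mul_assoc, ← sq, hσ]; ring
      have e2 : μ' - τ * μ = 0 := by rw [h2, ← mul_assoc, ← sq, hτ]; ring
      rw [e1, e2]
      simp
  obtain ⟨p1, p2, p3, p4⟩ := key 1 1 (by norm_num) (by norm_num)
  obtain ⟨q1, q2, q3, q4⟩ := key 1 (-1) (by norm_num) (by norm_num)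
  obtain ⟨r1, r2, r3, r4⟩ := key (-1) 1 (by norm_num) (by norm_num)
  obtain ⟨s1, s2, s3, s4⟩ := key (-1) (-1) (by norm_num) (by norm_num)
  rw [blockSum_commutator]
  ext i j
  fin_cases i <;> fin_cases j <;>
    simp only [Fin.zero_eta, Fin.mk_one, Fin.reduceFinMk, Matrix.of_apply, Matrix.cons_val,
      Matrix.zero_apply] <;> linarith

end Kernel

section Semidefinite
variable {m n : ℕ}

/-- The middle matrix joins slot 0 to 3 and 1 to 2, so it maps the slots of a contributing pair out
of that pair. Only the full set survives. -/
theorem trace_covInv_sq_rotBlock {ν μ : ℝ} (δ : ℝ) (hνμ : ν ^ 2 + μ ^ 2 = 1) (t : Fin 4 → Bool) :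
    (covInv ν μ t * !![0, 0, 0, δ; 0, 0, -δ, 0; 0, δ, 0, 0; -δ, 0, 0, 0] * covInv ν μ t *
      !![0, 0, 0, δ; 0, 0, -δ, 0; 0, δ, 0, 0; -δ, 0, 0, 0]).trace =
      if t = ![true, true, true, true] then -4 * δ ^ 2 else 0 := by
  revert t
  refine boolVec_cases fun x y z w => ?_
  cases x <;> cases y <;> cases z <;> cases w <;>
    simp [covInv, covBlock, Matrix.trace, Fin.sum_univ_four, Matrix.vecHead, Matrix.vecTail]
  linear_combination (-4 * δ ^ 2) * hνμ

theorem commBlock_rotBlock (ν μ : Fin m → ℝ) (c : Fin n) (a b : ℝ) {δ : ℝ}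
    (hδ : δ = muExt μ c * (a - b)) : commBlock ν μ c c (rotBlock a b) =
      !![0, 0, 0, δ; 0, 0, -δ, 0; 0, δ, 0, 0; -δ, 0, 0, 0] := by
  rw [commBlock, rotBlock_commutator, hδ]

/-- The mean inverse gives -2μμ̂(a - b)²/S and the full set gives +2μ²(a - b)²/S; since μμ̂ = μ² +
|μ|^(2α), the μ² parts cancel. -/
theorem pairForm_self {α : ℝ} (hα : 1 < α) {ν μ : Fin m → ℝ} (hμ : ∀ k, μ k ^ 2 = 1 - ν k ^ 2)
    (c : Fin n) (a b : ℝ) : pairForm α ν μ c c (rotBlock a b) =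
      -(2 * (muExt μ c ^ 2) ^ α * (a - b) ^ 2 / hatDot α (nuExt ν c) (muExt μ c)) := by
  have ht : -(rotBlock a b)ᵀ = rotBlock a b := by
    ext i j
    fin_cases i <;> fin_cases j <;> simp [rotBlock]
  have hS := one_le_hatDot hα (nuExt_sq_add_muExt_sq hμ c)
  rw [pairForm, if_pos rfl, ht, commBlock_rotBlock ν μ c a b rfl]
  simp only [trace_covInv_sq_rotBlock _ (nuExt_sq_add_muExt_sq hμ c), mul_ite, mul_zero,
    Finset.sum_ite_eq', Finset.mem_univ, if_true]
  by_cases hc : (c : ℕ) < m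
  · have hT := blockTotal_eq hα hμ c
    rw [if_pos hc] at hT
    have hm := mul_hatVal hα (muExt μ c)
    rw [blockMeanInv_eq hα hμ, slotMask_of_lt hc, one_mul, mul_one, blockProb, hT, blockWeight,
      if_pos fun p _ => isSlot_of_lt hc p, covMinor]
    have htr : ∀ r x y δ : ℝ, ((r • covBlock x y) *
        (rotBlock a b * !![0, 0, 0, δ; 0, 0, -δ, 0; 0, δ, 0, 0; -δ, 0, 0, 0] -
        !![0, 0, 0, δ; 0, 0, -δ, 0; 0, δ, 0, 0; -δ, 0, 0, 0] * rotBlock a b)).trace =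
        r * (4 * y * δ * (a - b)) := by
      intro r x y δ
      rw [Matrix.smul_mul, Matrix.trace_smul, smul_eq_mul]
      congr 1
      simp only [Matrix.trace, Fin.sum_univ_four, Matrix.diag_apply, Matrix.mul_apply,
        Matrix.sub_apply, covBlock, rotBlock, Matrix.of_apply, Matrix.cons_val]
      ring
    rw [htr]
    simp only [Matrix.cons_val, Real.one_rpow]
    have : hatDot α (nuExt ν c) (muExt μ c) ≠ 0 := by linarith
    field_simp
    linear_combination (-4 * (a - b) ^ 2) * hm
  · rw [muExt_of_not_lt μ hc]
    simp only [zero_mul, neg_zero]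
    have h0 : !![0, 0, 0, (0 : ℝ); 0, 0, 0, 0; 0, 0, 0, 0; 0, 0, 0, 0] =
        (0 : Matrix (Fin 4) (Fin 4) ℝ) := by
      ext i j
      fin_cases i <;> fin_cases j <;> simp
    rw [h0]
    simp [Real.zero_rpow (by linarith : α ≠ 0)]

/-- Every pair of blocks contributes nonpositively to the Hessian, and the contribution vanishes
only on generators that commute with the canonical covariance matrix. -/
theorem pairForm_nonpos (h : m ≤ n) {α : ℝ} (hα : 1 < α) {ν μ : Fin m → ℝ}
    (hμ : ∀ k, μ k ^ 2 = 1 - ν k ^ 2) (K : LocalGen m n) (c d : Fin n) :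
    pairForm α ν μ c d (genBlock h K c d) + pairForm α ν μ d c (genBlock h K d c) ≤ 0 ∧
    (pairForm α ν μ c d (genBlock h K c d) + pairForm α ν μ d c (genBlock h K d c) = 0 →
      commBlock ν μ c d (genBlock h K c d) = 0) := by
  have hc := nuExt_sq_add_muExt_sq hμ c
  have hd := nuExt_sq_add_muExt_sq hμ d
  have hS := one_le_hatDot hα hc
  have hS' := one_le_hatDot hα hd
  by_cases hcd : c = d
  · subst hcd
    rw [genBlock_self_eq_rotBlock]
    generalize genBlock h K c c 0 1 = a
    generalize genBlock h K c c 2 3 = b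
    rw [pairForm_self hα hμ]
    have hr := Real.rpow_nonneg (sq_nonneg (muExt μ c)) α
    have h0 : 0 ≤ 2 * (muExt μ c ^ 2) ^ α * (a - b) ^ 2 / hatDot α (nuExt ν c) (muExt μ c) := by
      positivity
    refine ⟨by linarith, fun hz => ?_⟩
    have hz' : 2 * (muExt μ c ^ 2) ^ α * (a - b) ^ 2 / hatDot α (nuExt ν c) (muExt μ c) = 0 := by
      linarith
    have hz2 : muExt μ c * (a - b) = 0 := by
      rcases div_eq_zero_iff.mp hz' with h1 | h1
      · rcases mul_eq_zero.mp h1 with h2 | h2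
        · have h3 := (Real.rpow_eq_zero (sq_nonneg (muExt μ c)) (by linarith : α ≠ 0)).mp
            (by linarith)
          rw [pow_eq_zero_iff two_ne_zero |>.mp h3, zero_mul]
        · rw [pow_eq_zero_iff two_ne_zero |>.mp h2, mul_zero]
      · linarith
    rw [commBlock_rotBlock ν μ c a b hz2.symm]
    ext i j
    fin_cases i <;> fin_cases j <;> simp
  · obtain ⟨a, b, hab⟩ : ∃ a b, genBlock h K c d = blockSum a b := ⟨_, _, genBlock_eq_blockSum h K c d⟩
    rw [pairForm_add_pairForm h hα hμ K hcd hab rfl, hab, commBlock]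
    set w := chanWeight (hatDot α (nuExt ν c) (muExt μ c)) (hatDot α (nuExt ν d) (muExt μ d))
      (nuExt ν c) (muExt μ c) (nuExt ν d) (muExt μ d) (hatVal α (nuExt ν c))
      (hatVal α (muExt μ c)) (hatVal α (nuExt ν d)) (hatVal α (muExt μ d)) with hw
    have hw0 : ∀ σ τ : ℝ, σ ^ 2 = 1 → τ ^ 2 = 1 → 0 ≤ w σ τ ∧
        (w σ τ = 0 → nuExt ν c = σ * nuExt ν d ∧ muExt μ c = τ * muExt μ d) := by
      intro σ τ hσ hτ
      by_cases hne : nuExt ν c = σ * nuExt ν d ∧ muExt μ c = τ * muExt μ d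
      · refine ⟨(chanWeight_eq_zero hc hσ hτ ?_ ?_).ge, fun _ => hne⟩
        · rw [hne.1, ← mul_assoc, ← sq, hσ, one_mul]
        · rw [hne.2, ← mul_assoc, ← sq, hτ, one_mul]
      · have := chanWeight_pos hα hc hd hσ hτ hne
        exact ⟨this.le, fun h0 => absurd h0 this.ne'⟩
    have hq : ∀ σ τ : ℝ, 0 ≤ chanSq σ τ a b := fun σ τ => by unfold chanSq; positivity
    have n1 := mul_nonneg (hw0 1 1 (by norm_num) (by norm_num)).1 (hq 1 1)
    have n2 := mul_nonneg (hw0 1 (-1) (by norm_num) (by norm_num)).1 (hq 1 (-1))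
    have n3 := mul_nonneg (hw0 (-1) 1 (by norm_num) (by norm_num)).1 (hq (-1) 1)
    have n4 := mul_nonneg (hw0 (-1) (-1) (by norm_num) (by norm_num)).1 (hq (-1) (-1))
    have hpos : 0 < 1 / (4 * (hatDot α (nuExt ν c) (muExt μ c) * hatDot α (nuExt ν d) (muExt μ d))) := by
      positivity
    refine ⟨?_, fun hz => blockSum_commutator_eq_zero fun σ τ hσ hτ => ?_⟩
    · rw [neg_mul]
      exact neg_nonpos.mpr (mul_nonneg hpos.le (by linarith))
    · have hsum : w 1 1 * chanSq 1 1 a b + w 1 (-1) * chanSq 1 (-1) a b +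
          w (-1) 1 * chanSq (-1) 1 a b + w (-1) (-1) * chanSq (-1) (-1) a b = 0 := by
        rcases mul_eq_zero.mp hz with h1 | h1
        · linarith
        · exact h1
      have hz0 : w σ τ * chanSq σ τ a b = 0 := by
        rcases mul_self_eq_one_iff.mp ((sq σ).symm.trans hσ) with rfl | rfl <;>
        rcases mul_self_eq_one_iff.mp ((sq τ).symm.trans hτ) with rfl | rfl <;> linarith
      rcases mul_eq_zero.mp hz0 with h1 | h1
      · exact Or.inr ((hw0 σ τ hσ hτ).2 h1)
      · exact Or.inl h1

/-- The Hessian is negative semidefinite. -/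
theorem orbitHessian_nonpos (h : m ≤ n) {α : ℝ} (hα : 1 < α) {ν μ : Fin m → ℝ}
    (hμ : ∀ k, μ k ^ 2 = 1 - ν k ^ 2) (K : LocalGen m n) :
    orbitHessian α (canonicalCov ν μ) K K ≤ 0 ∧
    (orbitHessian α (canonicalCov ν μ) K K = 0 →
      genMatrix K * canonicalCov ν μ - canonicalCov ν μ * genMatrix K = 0) := by
  rw [(orbitF_derivs_eq h hα hμ K).2]
  have hZ : 0 < α * ∏ c : Fin n, blockTotal α ν μ c :=
    mul_pos (by linarith) (Finset.prod_pos fun c _ => blockTotal_pos α ν μ c)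
  -- Symmetrization, because the sign is established for the sum of both orders of a pair.
  have h2 : ∑ c, ∑ d, pairForm α ν μ c d (genBlock h K c d) = (1 / 2) * ∑ c, ∑ d,
      (pairForm α ν μ c d (genBlock h K c d) + pairForm α ν μ d c (genBlock h K d c)) := by
    simp only [Finset.sum_add_distrib]
    rw [Finset.sum_comm (f := fun c d => pairForm α ν μ d c (genBlock h K d c))]
    ring
  rw [h2]
  have hle : ∀ c, ∑ d, (pairForm α ν μ c d (genBlock h K c d) +
      pairForm α ν μ d c (genBlock h K d c)) ≤ 0 := fun c =>
    Finset.sum_nonpos fun d _ => (pairForm_nonpos h hα hμ K c d).1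
  refine ⟨mul_nonpos_of_nonneg_of_nonpos hZ.le (mul_nonpos_of_nonneg_of_nonpos (by norm_num)
    (Finset.sum_nonpos fun c _ => hle c)), fun hz => pad_injective h ?_⟩
  have hz1 : ∑ c, ∑ d, (pairForm α ν μ c d (genBlock h K c d) +
      pairForm α ν μ d c (genBlock h K d c)) = 0 := by
    rcases mul_eq_zero.mp hz with h1 | h1
    · exact absurd h1 hZ.ne'
    · linarith
  have hz2 := (Finset.sum_eq_zero_iff_of_nonpos fun c _ => hle c).mp hz1
  ext ⟨p, c⟩ ⟨q, d⟩
  have hz3 := (Finset.sum_eq_zero_iff_of_nonpos fun d _ =>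
    (pairForm_nonpos h hα hμ K c d).1).mp (hz2 c (Finset.mem_univ _)) d (Finset.mem_univ _)
  have hz4 := (pairForm_nonpos h hα hμ K c d).2 hz3
  have := slotBlock_commutator h ν μ K c d
  rw [← commBlock, hz4] at this
  exact congrFun (congrFun this p) q

end Semidefinite

/-! ### Sign flips and decoupling of the channels -/

section Symmetry
variable {m n : ℕ}

theorem genBlock_slot (h : m ≤ n) (K : LocalGen m n) (i j : Majorana m n) :
    genBlock h K (i.block h) (j.block h) (slot h i).1 (slot h j).1 = K.1 i j := by
  rw [genBlock, slotBlock, Matrix.of_apply, ← slot_snd h i, ← slot_snd h j]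
  exact pad_slot h (genMatrix K) i j

theorem genBlock_eq_smul (h : m ≤ n) {K K' : LocalGen m n} {c d : Fin n} {r : ℝ}
    (hK : ∀ i j : Majorana m n, i.block h = c → j.block h = d → K.1 i j = r * K'.1 i j) :
    genBlock h K c d = r • genBlock h K' c d := by
  ext p q
  rw [Matrix.smul_apply, smul_eq_mul]
  by_cases hp : IsSlot m c p
  · by_cases hq : IsSlot m d q
    · obtain ⟨i, hi⟩ := (exists_slot_eq h p c).mpr hp
      obtain ⟨j, hj⟩ := (exists_slot_eq h q d).mpr hq
      have hi2 : i.block h = c := by rw [← slot_snd h i, hi]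
      have hj2 : j.block h = d := by rw [← slot_snd h j, hj]
      have h1 := genBlock_slot h K i j
      have h2 := genBlock_slot h K' i j
      rw [hi2, hj2, hi, hj] at h1 h2
      rw [h1, h2, hK i j hi2 hj2]
    · rw [genBlock_eq_zero_right h K c p hq, genBlock_eq_zero_right h K' c p hq, mul_zero]
  · rw [genBlock_eq_zero_left h K d q hp, genBlock_eq_zero_left h K' d q hp, mul_zero]

theorem genBlock_congr (h : m ≤ n) {K K' : LocalGen m n} {c d : Fin n}
    (hK : ∀ i j : Majorana m n, i.block h = c → j.block h = d → K.1 i j = K'.1 i j) :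
    genBlock h K c d = genBlock h K' c d := by
  have := genBlock_eq_smul h (K := K) (K' := K') (r := 1) (c := c) (d := d)
    fun i j hi hj => by rw [one_mul]; exact hK i j hi hj
  rwa [one_smul] at this

theorem genBlock_of_channel (h : m ≤ n) {K : LocalGen m n} {c d x y : Fin n}
    (hK : K ∈ channel h c d) (hxy : s(x, y) ≠ s(c, d)) : genBlock h K x y = 0 := by
  have := genBlock_eq_smul h (K := K) (K' := K) (r := 0) (c := x) (d := y)
    fun i j hi hj => by rw [zero_mul]; exact hK i j (by rw [hi, hj]; exact hxy)
  rwa [zero_smul] at this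

theorem channelPart_mem (h : m ≤ n) (c d : Fin n) (K : LocalGen m n) :
    channelPart h c d K ∈ channel h c d := fun _ _ hij => if_neg hij

theorem orbitHessian_polarization {α : ℝ} (hα : 1 < α)
    (Γ : Matrix (Majorana m n) (Majorana m n) ℝ) (K K' : LocalGen m n) :
    2 * orbitHessian α Γ K K' = orbitHessian α Γ (K + K') (K + K') - orbitHessian α Γ K K -
      orbitHessian α Γ K' K' := by
  have hs : IsSymmSndFDerivAt ℝ (orbitF α Γ) 0 :=
    (contDiff_orbitF hα Γ).contDiffAt.isSymmSndFDerivAt (by simp)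
  have := hs K' K
  simp only [orbitHessian, map_add, add_apply, this]
  ring

/-- The quadratic form is a sum over pairs of blocks, and K and K' are supported on disjoint sets of
pairs; so the form is additive on K + K', and polarization concludes. -/
theorem orbitHessian_eq_zero_of_channel (h : m ≤ n) {α : ℝ} (hα : 1 < α) {ν μ : Fin m → ℝ}
    (hμ : ∀ k, μ k ^ 2 = 1 - ν k ^ 2) {c d e f : Fin n} {K K' : LocalGen m n}
    (hne : s(c, d) ≠ s(e, f)) (hK : K ∈ channel h c d) (hK' : K' ∈ channel h e f) :
    orbitHessian α (canonicalCov ν μ) K K' = 0 := by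
  have hp := orbitHessian_polarization hα (canonicalCov ν μ) K K'
  rw [(orbitF_derivs_eq h hα hμ _).2, (orbitF_derivs_eq h hα hμ K).2,
    (orbitF_derivs_eq h hα hμ K').2] at hp
  have hsum : ∑ x, ∑ y, pairForm α ν μ x y (genBlock h (K + K') x y) =
      ∑ x, ∑ y, pairForm α ν μ x y (genBlock h K x y) +
        ∑ x, ∑ y, pairForm α ν μ x y (genBlock h K' x y) := by
    simp only [← Finset.sum_add_distrib]
    refine Finset.sum_congr rfl fun x _ => Finset.sum_congr rfl fun y _ => ?_
    by_cases hxy : s(x, y) = s(c, d)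
    · have h1 : genBlock h K' x y = 0 := genBlock_of_channel h hK' (by rwa [hxy])
      have h2 : genBlock h (K + K') x y = genBlock h K x y := genBlock_congr h fun i j hi hj => by
        have := hK' i j (by rw [hi, hj, hxy]; exact hne)
        simp [this]
      rw [h1, h2, pairForm_zero, add_zero]
    · have h1 : genBlock h K x y = 0 := genBlock_of_channel h hK hxy
      have h2 : genBlock h (K + K') x y = genBlock h K' x y := genBlock_congr h fun i j hi hj => by
        have := hK i j (by rw [hi, hj]; exact hxy)
        simp [this]
      rw [h1, h2, pairForm_zero, zero_add]
  rw [hsum] at hp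
  linarith

theorem sum_pairs_eq_sum_channels (F : Fin n → Fin n → ℝ) :
    ∑ x, ∑ y, F x y = (∑ c, ∑ x, ∑ y, if s(x, y) = s(c, c) then F x y else 0) +
      ∑ p : Fin n × Fin n with p.1 < p.2, ∑ x, ∑ y, if s(x, y) = s(p.1, p.2) then F x y else 0 := by
  rw [Finset.sum_comm, Finset.sum_comm (s := Finset.univ.filter _), ← Finset.sum_add_distrib]
  rw [Finset.sum_comm]
  refine Finset.sum_congr rfl fun x _ => ?_
  rw [Finset.sum_comm, Finset.sum_comm (s := Finset.univ.filter _), ← Finset.sum_add_distrib]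
  refine Finset.sum_congr rfl fun y _ => ?_
  rcases lt_trichotomy x y with hxy | rfl | hxy
  · rw [Finset.sum_eq_zero fun c _ => if_neg (by simp only [Sym2.eq_iff]; omega), zero_add,
      Finset.sum_eq_single_of_mem (x, y) (by simpa using hxy), if_pos rfl]
    rintro ⟨p, q⟩ hp hne
    refine if_neg fun hs => ?_
    simp only [Finset.mem_filter, Finset.mem_univ, true_and] at hp
    rcases Sym2.eq_iff.mp hs with ⟨rfl, rfl⟩ | ⟨rfl, rfl⟩
    · exact hne rfl
    · exact absurd hp hxy.asymm
  · rw [Finset.sum_eq_single_of_mem x (Finset.mem_univ _), if_pos rfl, left_eq_add]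
    · refine Finset.sum_eq_zero fun p hp => if_neg fun hs => ?_
      simp only [Finset.mem_filter, Finset.mem_univ, true_and] at hp
      rcases Sym2.eq_iff.mp hs with ⟨h1, h2⟩ | ⟨h1, h2⟩ <;> omega
    · intro c _ hc
      refine if_neg fun hs => hc ?_
      rcases Sym2.eq_iff.mp hs with ⟨h1, h2⟩ | ⟨h1, h2⟩ <;> exact h1
  · rw [Finset.sum_eq_zero fun c _ => if_neg (by simp only [Sym2.eq_iff]; omega), zero_add,
      Finset.sum_eq_single_of_mem (y, x) (by simpa using hxy), if_pos Sym2.eq_swap]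
    rintro ⟨p, q⟩ hp hne
    refine if_neg fun hs => ?_
    simp only [Finset.mem_filter, Finset.mem_univ, true_and] at hp
    rcases Sym2.eq_iff.mp hs with ⟨rfl, rfl⟩ | ⟨rfl, rfl⟩
    · exact absurd hp hxy.asymm
    · exact hne rfl

theorem orbitHessian_channelPart (h : m ≤ n) {α : ℝ} (hα : 1 < α) {ν μ : Fin m → ℝ}
    (hμ : ∀ k, μ k ^ 2 = 1 - ν k ^ 2) (c d : Fin n) (K : LocalGen m n) :
    orbitHessian α (canonicalCov ν μ) (channelPart h c d K) (channelPart h c d K) =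
      α * (∏ c : Fin n, blockTotal α ν μ c) *
        ∑ x, ∑ y, if s(x, y) = s(c, d) then pairForm α ν μ x y (genBlock h K x y) else 0 := by
  rw [(orbitF_derivs_eq h hα hμ _).2]
  congr 1
  refine Finset.sum_congr rfl fun x _ => Finset.sum_congr rfl fun y _ => ?_
  split_ifs with hxy
  · congr 1
    refine genBlock_congr h fun i j hi hj => if_pos (by rw [hi, hj, hxy])
  · rw [genBlock_of_channel h (channelPart_mem h c d K) hxy, pairForm_zero]

theorem orbitHessian_eq_sum_channels (h : m ≤ n) {α : ℝ} (hα : 1 < α) {ν μ : Fin m → ℝ}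
    (hμ : ∀ k, μ k ^ 2 = 1 - ν k ^ 2) (K : LocalGen m n) :
    orbitHessian α (canonicalCov ν μ) K K =
      (∑ c : Fin n, orbitHessian α (canonicalCov ν μ) (channelPart h c c K) (channelPart h c c K)) +
      ∑ p : Fin n × Fin n with p.1 < p.2, orbitHessian α (canonicalCov ν μ)
        (channelPart h p.1 p.2 K) (channelPart h p.1 p.2 K) := by
  simp only [orbitHessian_channelPart h hα hμ, ← Finset.mul_sum]
  rw [← mul_add, (orbitF_derivs_eq h hα hμ _).2]
  congr 1
  exact sum_pairs_eq_sum_channels fun x y => pairForm α ν μ x y (genBlock h K x y)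

/-- A sign flip multiplies each block of the generator by ±1, and every `pairForm` is even. -/
theorem orbitHessian_flipGen_self (h : m ≤ n) {α : ℝ} (hα : 1 < α) {ν μ : Fin m → ℝ}
    (hμ : ∀ k, μ k ^ 2 = 1 - ν k ^ 2) (c : Fin n) (K : LocalGen m n) :
    orbitHessian α (canonicalCov ν μ) (flipGen h c K) (flipGen h c K) =
      orbitHessian α (canonicalCov ν μ) K K := by
  rw [(orbitF_derivs_eq h hα hμ (flipGen h c K)).2, (orbitF_derivs_eq h hα hμ K).2]
  refine congrArg (fun x => α * (∏ c : Fin n, blockTotal α ν μ c) * x) ?_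
  refine Finset.sum_congr rfl fun x _ => Finset.sum_congr rfl fun y _ => ?_
  have h1 : genBlock h (flipGen h c K) x y =
      ((if x = c then -1 else 1) * (if y = c then -1 else 1) : ℝ) • genBlock h K x y := by
    refine genBlock_eq_smul h fun i j hi hj => ?_
    simp only [flipGen, flipSign, hi, hj]
    ring
  rw [h1]
  split_ifs <;> simp [pairForm_neg]

theorem orbitHessian_flipGen (h : m ≤ n) {α : ℝ} (hα : 1 < α) {ν μ : Fin m → ℝ}
    (hμ : ∀ k, μ k ^ 2 = 1 - ν k ^ 2) (c : Fin n) (K K' : LocalGen m n) :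
    orbitHessian α (canonicalCov ν μ) (flipGen h c K) (flipGen h c K') =
      orbitHessian α (canonicalCov ν μ) K K' := by
  have h1 := orbitHessian_polarization hα (canonicalCov ν μ) K K'
  have h2 := orbitHessian_polarization hα (canonicalCov ν μ) (flipGen h c K) (flipGen h c K')
  have h3 : flipGen h c K + flipGen h c K' = flipGen h c (K + K') := by
    ext i j
    simp only [flipGen, Submodule.coe_add, Pi.add_apply]
    ring
  rw [h3] at h2
  simp only [orbitHessian_flipGen_self h hα hμ] at h2
  linarith

theorem flipGen_of_channel (h : m ≤ n) (c : Fin n) {d e : Fin n} {K : LocalGen m n}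
    (hK : K ∈ channel h d e) : flipGen h c K = if (d = c ↔ e = c) then K else -K := by
  have key : ∀ i j : Majorana m n, flipSign h c i * K.1 i j * flipSign h c j =
      if (d = c ↔ e = c) then K.1 i j else -K.1 i j := by
    intro i j
    by_cases hij : s(i.block h, j.block h) = s(d, e)
    · unfold flipSign
      rcases Sym2.eq_iff.mp hij with ⟨h1, h2⟩ | ⟨h1, h2⟩ <;> rw [h1, h2] <;>
        by_cases hd : d = c <;> by_cases he : e = c <;> simp [hd, he]
    · rw [hK i j hij]
      simp
  ext i j
  refine (key i j).trans ?_
  split_ifs <;> rfl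

theorem canonicalCov_eq_zero (h : m ≤ n) (ν μ : Fin m → ℝ) {i j : Majorana m n}
    (hij : i.block h ≠ j.block h) : canonicalCov ν μ i j = 0 := by
  rcases i with ⟨k, i⟩ | ⟨k, i⟩ <;> rcases j with ⟨l, j⟩ | ⟨l, j⟩ <;>
    simp only [Majorana.block, ne_eq, Fin.ext_iff, Fin.val_castLE] at hij <;>
    simp [canonicalCov, Fin.ext_iff, hij]

theorem signFlip_conj_apply (h : m ≤ n) (c : Fin n) (M : Matrix (Majorana m n) (Majorana m n) ℝ)
    (i j : Majorana m n) : (signFlip h c * M * (signFlip h c)ᵀ) i j =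
      flipSign h c i * M i j * flipSign h c j := by
  simp [signFlip, Matrix.diagonal_mul, Matrix.mul_diagonal]

theorem flipSign_mul_self (h : m ≤ n) (c : Fin n) (i : Majorana m n) :
    flipSign h c i * flipSign h c i = 1 := by
  unfold flipSign; split_ifs <;> norm_num

theorem signFlip_canonicalCov (h : m ≤ n) (c : Fin n) (ν μ : Fin m → ℝ) :
    signFlip h c * canonicalCov ν μ * (signFlip h c)ᵀ = canonicalCov ν μ := by
  ext i j
  rw [signFlip_conj_apply]
  by_cases hij : i.block h = j.block h
  · have : flipSign h c i = flipSign h c j := by unfold flipSign; rw [hij]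
    rw [this, mul_right_comm, flipSign_mul_self, one_mul]
  · rw [canonicalCov_eq_zero h ν μ hij]; ring

theorem pfaffianSum_eq_sum_det {ι : Type*} [LinearOrder ι] [Fintype ι] {Γ : Matrix ι ι ℝ}
    (hΓ : ∀ i j, Γ j i = -Γ i j) (α : ℝ) :
    pfaffianSum α Γ =
      ∑ X : Finset ι, (Γ.submatrix (Subtype.val : X → ι) Subtype.val).det ^ α :=
  Finset.sum_congr rfl fun X _ => abs_pfMinor_rpow Γ hΓ X α

theorem pfaffianSum_signFlip (h : m ≤ n) (c : Fin n) (α : ℝ)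
    {Γ : Matrix (Majorana m n) (Majorana m n) ℝ} (hΓ : Γᵀ = -Γ) :
    pfaffianSum α (signFlip h c * Γ * (signFlip h c)ᵀ) = pfaffianSum α Γ := by
  have hs : ∀ i j, Γ j i = -Γ i j := fun i j => congrFun (congrFun hΓ i) j
  rw [pfaffianSum_eq_sum_det hs, pfaffianSum_eq_sum_det (conj_skew hs _)]
  refine Finset.sum_congr rfl fun X _ => ?_
  have hd : (signFlip h c * Γ * (signFlip h c)ᵀ).submatrix (Subtype.val : X → _) Subtype.val =
      Matrix.diagonal (fun i : X => flipSign h c i) * Γ.submatrix Subtype.val Subtype.val *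
        Matrix.diagonal (fun i : X => flipSign h c i) := by
    ext i j
    rw [Matrix.submatrix_apply, signFlip_conj_apply, Matrix.mul_diagonal, Matrix.diagonal_mul,
      Matrix.submatrix_apply]
  rw [hd, Matrix.det_mul, Matrix.det_mul, Matrix.det_diagonal, mul_right_comm,
    ← Finset.prod_mul_distrib, Finset.prod_congr rfl fun (i : X) _ => flipSign_mul_self h c i,
    Finset.prod_const_one, one_mul]

end Symmetry

/-! ### Dimension and stabilizer of a two-block channel -/

section TwoBlock
variable {m n : ℕ}

/-- The 2×2 blocks from c to d inside A and inside B are free, and skew-symmetry determines those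
from d to c: 4 + 4 parameters. -/
theorem finrank_channel (h : m ≤ n) {c d : Fin m} (hcd : c ≠ d) :
    Module.finrank ℝ (channel h (Fin.castLE h c) (Fin.castLE h d)) = 8 := by
  let L : channel h (Fin.castLE h c) (Fin.castLE h d) →ₗ[ℝ]
      (Fin 2 → Fin 2 → ℝ) × (Fin 2 → Fin 2 → ℝ) :=
    { toFun := fun K => (fun i j => K.1.1 (.a c i) (.a d j),
        fun i j => K.1.1 (.b (Fin.castLE h c) i) (.b (Fin.castLE h d) j))
      map_add' := fun _ _ => rfl
      map_smul' := fun _ _ => rfl }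
  have hL : Function.Bijective L := by
    constructor
    · rw [injective_iff_map_eq_zero]
      rintro ⟨⟨K, hK⟩, hKc⟩ h0
      have ha : ∀ i j, K (.a c i) (.a d j) = 0 := fun i j =>
        congrFun (congrFun (congrArg Prod.fst h0) i) j
      have hb : ∀ i j, K (.b (Fin.castLE h c) i) (.b (Fin.castLE h d) j) = 0 := fun i j =>
        congrFun (congrFun (congrArg Prod.snd h0) i) j
      have hz : K = 0 := by
        funext i j
        by_cases hij : s(i.block h, j.block h) = s(Fin.castLE h c, Fin.castLE h d)
        · rcases i with ⟨k, i⟩ | ⟨k, i⟩ <;> rcases j with ⟨l, j⟩ | ⟨l, j⟩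
          · simp only [Majorana.block, Sym2.eq_iff, Fin.castLE_inj] at hij
            rcases hij with ⟨rfl, rfl⟩ | ⟨rfl, rfl⟩
            · exact ha i j
            · exact (hK.1 _ _).trans (by rw [ha]; simp)
          · exact hK.2 _ _ (by simp [Majorana.inA])
          · exact hK.2 _ _ (by simp [Majorana.inA])
          · simp only [Majorana.block, Sym2.eq_iff] at hij
            rcases hij with ⟨rfl, rfl⟩ | ⟨rfl, rfl⟩
            · exact hb i j
            · exact (hK.1 _ _).trans (by rw [hb]; simp)
        · exact hKc i j hij
      exact Subtype.ext (Subtype.ext hz)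
    · rintro ⟨u, v⟩
      have hcd' : Fin.castLE h c ≠ Fin.castLE h d := by simpa using hcd
      let K : Majorana m n → Majorana m n → ℝ
        | .a k i, .a l j => if k = c ∧ l = d then u i j else if k = d ∧ l = c then -u j i else 0
        | .b k i, .b l j => if k = Fin.castLE h c ∧ l = Fin.castLE h d then v i j else
            if k = Fin.castLE h d ∧ l = Fin.castLE h c then -v j i else 0
        | _, _ => 0
      refine ⟨⟨⟨K, ?_, ?_⟩, ?_⟩, ?_⟩
      · rintro (⟨k, i⟩ | ⟨k, i⟩) (⟨l, j⟩ | ⟨l, j⟩) <;> simp only [K, neg_zero]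
        · split_ifs <;> simp_all
        · split_ifs <;> simp_all
      · rintro (⟨k, i⟩ | ⟨k, i⟩) (⟨l, j⟩ | ⟨l, j⟩) hij <;> simp_all [K, Majorana.inA]
      · rintro (⟨k, i⟩ | ⟨k, i⟩) (⟨l, j⟩ | ⟨l, j⟩) hij <;>
          simp only [Majorana.block, ne_eq, Sym2.eq_iff, Fin.castLE_inj, not_or] at hij <;>
          simp [K, hij]
      · ext i j <;> simp [L, K]
  rw [(LinearEquiv.ofBijective L hL).finrank_eq]
  simp [Module.finrank_prod, Module.finrank_pi_fintype]

/-- In a two-block channel with different parameters, no generator commutes with the canonical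
covariance matrix. -/
theorem eq_zero_of_commutator_eq_zero (h : m ≤ n) {ν μ : Fin m → ℝ} {c d : Fin m}
    (hsq : ν c ^ 2 ≠ ν d ^ 2) {K : LocalGen m n}
    (hK : K ∈ channel h (Fin.castLE h c) (Fin.castLE h d))
    (h0 : genMatrix K * canonicalCov ν μ - canonicalCov ν μ * genMatrix K = 0) : K = 0 := by
  set c' := Fin.castLE h c with hc'
  set d' := Fin.castLE h d with hd'
  have hνc : nuExt ν c' = ν c := by simp [nuExt, hc']
  have hνd : nuExt ν d' = ν d := by simp [nuExt, hd']
  have h1 := slotBlock_commutator h ν μ K c' d'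
  obtain ⟨a, b, hab⟩ : ∃ a b, genBlock h K c' d' = blockSum a b :=
    ⟨_, _, genBlock_eq_blockSum h K c' d'⟩
  rw [h0, hab, blockSum_commutator, hνc, hνd] at h1
  have hz : slotBlock (pad h (0 : Matrix (Majorana m n) (Majorana m n) ℝ)) c' d' = 0 := by
    ext p q
    simp [slotBlock, pad]
  rw [hz] at h1
  have e := fun p q => congrFun (congrFun h1 p) q
  have e00 : 0 = -a 0 1 * ν d - ν c * a 1 0 := e 0 0
  have e01 : 0 = a 0 0 * ν d - ν c * a 1 1 := e 0 1
  have e10 : 0 = -a 1 1 * ν d + ν c * a 0 0 := e 1 0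
  have e11 : 0 = a 1 0 * ν d + ν c * a 0 1 := e 1 1
  have e22 : 0 = b 0 1 * ν d + ν c * b 1 0 := e 2 2
  have e23 : 0 = -b 0 0 * ν d + ν c * b 1 1 := e 2 3
  have e32 : 0 = b 1 1 * ν d - ν c * b 0 0 := e 3 2
  have e33 : 0 = -b 1 0 * ν d - ν c * b 0 1 := e 3 3
  -- The entries of the commutator inside A and inside B split into four 2×2 linear systems of this
  -- shape, with determinant ν_d² - ν_c².
  have z : ∀ x y : ℝ, x * ν d + ν c * y = 0 → y * ν d + ν c * x = 0 → x = 0 ∧ y = 0 := by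
    intro x y hx hy
    have hne : ν c ^ 2 - ν d ^ 2 ≠ 0 := sub_ne_zero.mpr hsq
    refine ⟨(mul_eq_zero.mp (?_ : (ν c ^ 2 - ν d ^ 2) * x = 0)).resolve_left hne,
      (mul_eq_zero.mp (?_ : (ν c ^ 2 - ν d ^ 2) * y = 0)).resolve_left hne⟩
    · linear_combination ν c * hy - ν d * hx
    · linear_combination ν c * hx - ν d * hy
  have a1 := z (a 0 1) (a 1 0) (by linarith [e00]) (by linarith [e11])
  have a2 := z (a 0 0) (-a 1 1) (by linarith [e01]) (by linarith [e10])
  have b1 := z (b 0 1) (b 1 0) (by linarith [e22]) (by linarith [e33])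
  have b2 := z (b 0 0) (-b 1 1) (by linarith [e23]) (by linarith [e32])
  have hB : genBlock h K c' d' = 0 := by
    rw [hab]
    ext p q
    have := a2.2
    have := b2.2
    fin_cases p <;> fin_cases q <;> simp [blockSum] <;> linarith
  ext i j
  by_cases hij : s(i.block h, j.block h) = s(c', d')
  · have hK1 := genBlock_slot h K i j
    rcases Sym2.eq_iff.mp hij with ⟨h3, h4⟩ | ⟨h3, h4⟩
    · rw [h3, h4, hB] at hK1
      exact hK1.symm
    · rw [h3, h4, genBlock_swap h K c' d', hB] at hK1
      simpa using hK1.symm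
  · exact hK i j hij

end TwoBlock

/-! ### The magic of the canonical matrix -/

section Magic
variable {m n : ℕ}

theorem canonicalCov_mul_self (h : m ≤ n) {ν μ : Fin m → ℝ} (hμ : ∀ k, μ k ^ 2 = 1 - ν k ^ 2) :
    (canonicalCov ν μ : Matrix (Majorana m n) (Majorana m n) ℝ) * canonicalCov ν μ = -1 := by
  have hC : ∀ c : Fin n, covBlock (nuExt ν c) (muExt μ c) * covBlock (nuExt ν c) (muExt μ c) =
      -1 := by
    intro c
    have := nuExt_sq_add_muExt_sq hμ c
    ext i j
    rw [Matrix.mul_apply, Fin.sum_univ_four]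
    fin_cases i <;> fin_cases j <;> simp [covBlock] <;> linarith
  have h1 := pad_mul_pad_canonicalCov h ν μ 1
  rw [← pad_mul, one_mul] at h1
  have h2 := pad_mul_pad_canonicalCov h ν μ (canonicalCov ν μ)
  have h4 : pad h (canonicalCov ν μ) * (Matrix.blockDiagonal fun c : Fin n =>
      covBlock (nuExt ν c) (muExt μ c)) =
      pad h 1 * Matrix.blockDiagonal fun _ : Fin n => (-1 : Matrix (Fin 4) (Fin 4) ℝ) := by
    rw [h1, Matrix.mul_assoc, ← Matrix.blockDiagonal_mul]
    simp only [hC]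
  have h3 : (Matrix.blockDiagonal fun _ : Fin n => (-1 : Matrix (Fin 4) (Fin 4) ℝ)) = -1 := by
    rw [← Matrix.blockDiagonal_one]
    exact Matrix.blockDiagonal_neg _
  rw [h4, h3, ← pad_mul, mul_neg, mul_one, ← pad_neg] at h2
  rw [← sub_eq_zero]
  refine pad_injective h ?_
  rw [pad_sub, h2, sub_self]

/-- The product (1 + G)(1 + G)ᵀ = 2 fixes the determinant up to sign, and the sign is positive
because 1 + G is the square of a real matrix. -/
theorem det_one_add_of_mul_self {κ : Type*} [Fintype κ] [DecidableEq κ] {G : Matrix κ κ ℝ}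
    (hG : Gᵀ = -G) (hGG : G * G = -1) {r : ℕ} (hr : Fintype.card κ = 2 * r) :
    (1 + G).det = 2 ^ r := by
  have h1 : (1 + G) * (1 + G)ᵀ = (2 : ℝ) • (1 : Matrix κ κ ℝ) := by
    rw [Matrix.transpose_add, Matrix.transpose_one, hG, add_mul, mul_add, mul_add, mul_neg, mul_neg,
      hGG, two_smul]
    simp
  have h2 : (1 + G).det ^ 2 = (2 ^ r) ^ 2 := by
    have := congrArg Matrix.det h1
    rw [Matrix.det_mul, Matrix.det_transpose, Matrix.det_smul, Matrix.det_one, mul_one, hr] at this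
    rw [sq, this]
    ring
  have h3 : 0 ≤ (1 + G).det := by
    -- G behaves like the imaginary unit; a and 1/(2a) are the real and imaginary parts of the
    -- square root of 1 + i.
    set a := √((1 + √2) / 2) with ha
    have ha0 : 0 < (1 + √2) / 2 := by positivity
    have ha2 : a ^ 2 = (1 + √2) / 2 := Real.sq_sqrt ha0.le
    have hane : a ≠ 0 := (Real.sqrt_pos.mpr ha0).ne'
    have h22 : √2 ^ 2 = 2 := Real.sq_sqrt (by norm_num)
    have e1 : a ^ 2 - (1 / (2 * a)) ^ 2 = 1 := by
      have h4 : (1 / (2 * a)) ^ 2 = (√2 - 1) / 2 := by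
        rw [div_pow, mul_pow, ha2]
        field_simp
        linarith
      rw [ha2, h4]
      ring
    have e2 : a * (1 / (2 * a)) = 1 / 2 := by field_simp
    have hsq : (1 + G) = (a • (1 : Matrix κ κ ℝ) + (1 / (2 * a)) • G) *
        (a • (1 : Matrix κ κ ℝ) + (1 / (2 * a)) • G) := by
      simp only [add_mul, mul_add, Matrix.smul_mul, Matrix.mul_smul, one_mul, mul_one, hGG,
        smul_smul, smul_neg]
      rw [mul_comm (1 / (2 * a)) a, e2]
      have : (1 + G) = (a ^ 2 - (1 / (2 * a)) ^ 2) • (1 : Matrix κ κ ℝ) + G := by rw [e1, one_smul]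
      rw [this, sub_smul, sq, sq]
      have hG2 : G = (1 / 2 : ℝ) • G + (1 / 2 : ℝ) • G := by rw [← add_smul]; norm_num
      nth_rewrite 1 [hG2]
      abel
    rw [hsq, Matrix.det_mul]
    exact mul_self_nonneg _
  exact (pow_left_inj₀ h3 (by positivity) two_ne_zero).mp h2

theorem card_majorana : Fintype.card (Majorana m n) = 2 * (m + n) := by
  rw [Fintype.card_congr Majorana.equivSum]
  simp
  ring

theorem pfaffianSum_pos {ι : Type*} [LinearOrder ι] [Fintype ι] {Γ : Matrix ι ι ℝ}
    (hΓ : ∀ i j, Γ j i = -Γ i j) (α : ℝ) : 0 < pfaffianSum α Γ := by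
  refine Finset.sum_pos' (fun X _ => by positivity) ⟨∅, Finset.mem_univ _, ?_⟩
  rw [abs_pfMinor_rpow Γ hΓ ∅ α, Matrix.det_isEmpty, Real.one_rpow]
  exact one_pos

/-- The two normalizations combine through -α/(1 - α) - 1 = -1/(1 - α). -/
theorem gaussianMagic_eq {α : ℝ} (hα : 1 < α) {Γ : Matrix (Majorana m n) (Majorana m n) ℝ}
    (hΓ : ∀ i j, Γ j i = -Γ i j) (hdet : (1 + Γ).det = 2 ^ (m + n)) :
    gaussianMagic α Γ =
      1 / (1 - α) * (Real.log (pfaffianSum α Γ) - (m + n : ℕ) * Real.log 2) := by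
  have h1 : ∑ X : Finset (Majorana m n),
      ((Γ.submatrix (Subtype.val : X → Majorana m n) Subtype.val).det / (1 + Γ).det) ^ α =
      pfaffianSum α Γ / ((2 : ℝ) ^ (m + n)) ^ α := by
    rw [pfaffianSum_eq_sum_det hΓ, Finset.sum_div, hdet]
    exact Finset.sum_congr rfl fun X _ =>
      Real.div_rpow (det_minor_nonneg Γ hΓ X) (by positivity) α
  rw [gaussianMagic, h1, Real.log_div (pfaffianSum_pos hΓ α).ne' (by positivity),
    Real.log_rpow (by positivity), Real.log_pow]
  have : 1 - α ≠ 0 := by linarith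
  field_simp
  ring

theorem pfaffianSum_canonicalCov (h : m ≤ n) {α : ℝ} (hα : 1 < α) {ν μ : Fin m → ℝ}
    (hμ : ∀ k, μ k ^ 2 = 1 - ν k ^ 2) :
    pfaffianSum α (canonicalCov ν μ : Matrix (Majorana m n) (Majorana m n) ℝ) =
      ∏ c : Fin n, if (c : ℕ) < m then 2 * hatDot α (nuExt ν c) (muExt μ c) else 2 := by
  rw [pfaffianSum_eq_sum_det (canonicalCov_skew ν μ)]
  simp only [det_minor_canonicalCov h hμ, sum_minor_rpow h, blockTotal_eq hα hμ]

theorem gaussianMagic_canonicalCov (h : m ≤ n) {α : ℝ} (hα : 1 < α) {ν μ : Fin m → ℝ}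
    (hμ : ∀ k, μ k ^ 2 = 1 - ν k ^ 2) :
    gaussianMagic α (canonicalCov ν μ : Matrix (Majorana m n) (Majorana m n) ℝ) =
      nonlocalMagicBound α ν μ := by
  have hs : (canonicalCov ν μ : Matrix (Majorana m n) (Majorana m n) ℝ)ᵀ = -canonicalCov ν μ := by
    ext i j; exact canonicalCov_skew ν μ i j
  rw [gaussianMagic_eq hα (canonicalCov_skew ν μ)
    (det_one_add_of_mul_self hs (canonicalCov_mul_self h hμ) card_majorana), nonlocalMagicBound,
    pfaffianSum_canonicalCov h hα hμ]
  congr 1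
  -- Each of the first m blocks yields 4 times the argument of the logarithm in the bound, and each
  -- of the remaining l blocks yields 2; the powers of 2 add up to 2m + l = m + n and cancel the
  -- normalization.
  obtain ⟨l, rfl⟩ := Nat.exists_eq_add_of_le h
  rw [Fin.prod_univ_add]
  have e1 : ∀ k : Fin m, (if ((Fin.castAdd l k : Fin (m + l)) : ℕ) < m then
      2 * hatDot α (nuExt ν (Fin.castAdd l k)) (muExt μ (Fin.castAdd l k)) else 2) =
      4 * ((1 + |ν k| ^ (2 * α) + |μ k| ^ (2 * α)) / 2) := by
    intro k
    have a1 : nuExt ν (Fin.castAdd l k) = ν k := by simp [nuExt]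
    have a2 : muExt μ (Fin.castAdd l k) = μ k := by simp [muExt]
    have a3 : ν k ^ 2 + μ k ^ 2 = 1 := by rw [hμ]; ring
    have a4 : ∀ x : ℝ, |x| ^ (2 * α) = (x ^ 2) ^ α := by
      intro x
      rw [Real.rpow_mul (abs_nonneg x), Real.rpow_two, sq_abs]
    rw [if_pos (by simp), a1, a2, hatDot_eq hα a3, a4, a4]
    ring
  have e2 : ∀ k : Fin l, (if ((Fin.natAdd m k : Fin (m + l)) : ℕ) < m then
      2 * hatDot α (nuExt ν (Fin.natAdd m k)) (muExt μ (Fin.natAdd m k)) else 2) = (2 : ℝ) :=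
    fun k => if_neg (by simp)
  simp only [e1, e2, Finset.prod_const, Finset.card_univ, Fintype.card_fin]
  have hpos : ∀ k : Fin m, 4 * ((1 + |ν k| ^ (2 * α) + |μ k| ^ (2 * α)) / 2) ≠ 0 := fun k => by
    positivity
  have hlog : ∀ k : Fin m, Real.log (4 * ((1 + |ν k| ^ (2 * α) + |μ k| ^ (2 * α)) / 2)) =
      2 * Real.log 2 + Real.log ((1 + |ν k| ^ (2 * α) + |μ k| ^ (2 * α)) / 2) := by
    intro k
    rw [Real.log_mul (by norm_num) (by positivity), show (4 : ℝ) = 2 ^ 2 by norm_num, Real.log_pow]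
    norm_num
  rw [Real.log_mul (Finset.prod_ne_zero_iff.mpr fun k _ => hpos k) (by positivity),
    Real.log_prod fun k _ => hpos k, Real.log_pow]
  simp only [hlog, Finset.sum_add_distrib, Finset.sum_const, Finset.card_univ, Fintype.card_fin,
    nsmul_eq_mul]
  push_cast
  ring

end Magic

/-! ### The compact group of local orthogonal transformations -/

section LocalGroup
variable {m n : ℕ}

/-- The orthogonal transformations that preserve the two subsystems. -/
def localGroup (m n : ℕ) : Set (Matrix (Majorana m n) (Majorana m n) ℝ) :=
  {g | g * gᵀ = 1 ∧ ∀ i j, i.inA ≠ j.inA → g i j = 0}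

theorem localSum_mem_localGroup {OA : Matrix (Fin m × Fin 2) (Fin m × Fin 2) ℝ}
    {OB : Matrix (Fin n × Fin 2) (Fin n × Fin 2) ℝ}
    (hA : OA ∈ Matrix.orthogonalGroup (Fin m × Fin 2) ℝ)
    (hB : OB ∈ Matrix.orthogonalGroup (Fin n × Fin 2) ℝ) :
    localSum OA OB ∈ localGroup m n := by
  have hA' : OA * OAᵀ = 1 := Matrix.mem_unitaryGroup_iff.mp hA
  have hB' : OB * OBᵀ = 1 := Matrix.mem_unitaryGroup_iff.mp hB
  have e : localSum OA OB = (Matrix.fromBlocks OA 0 0 OB).submatrix Majorana.equivSum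
      Majorana.equivSum := by
    ext i j
    rcases i with ⟨k, i⟩ | ⟨k, i⟩ <;> rcases j with ⟨l, j⟩ | ⟨l, j⟩ <;> rfl
  refine ⟨?_, ?_⟩
  · rw [e, Matrix.transpose_submatrix, Matrix.submatrix_mul_equiv, Matrix.fromBlocks_transpose,
      Matrix.fromBlocks_multiply]
    simp [hA', hB']
  · rintro (⟨k, i⟩ | ⟨k, i⟩) (⟨l, j⟩ | ⟨l, j⟩) hij <;> simp_all [Majorana.inA, localSum]

theorem exists_localGroup_of_mem_localOrbit {Γ Γ' : Matrix (Majorana m n) (Majorana m n) ℝ}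
    (h : Γ' ∈ localOrbit Γ) : ∃ g ∈ localGroup m n, Γ' = g * Γ * gᵀ := by
  obtain ⟨OA, hA, OB, hB, e⟩ := h
  exact ⟨_, localSum_mem_localGroup hA hB, e⟩

theorem localGroup_transpose_mul {g : Matrix (Majorana m n) (Majorana m n) ℝ}
    (hg : g ∈ localGroup m n) : gᵀ * g = 1 := mul_eq_one_comm.mp hg.1

theorem localGroup_mul {g g' : Matrix (Majorana m n) (Majorana m n) ℝ}
    (hg : g ∈ localGroup m n) (hg' : g' ∈ localGroup m n) : g * g' ∈ localGroup m n := by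
  refine ⟨?_, fun i j hij => ?_⟩
  · rw [Matrix.transpose_mul, Matrix.mul_assoc, ← Matrix.mul_assoc g', hg'.1, one_mul, hg.1]
  · rw [Matrix.mul_apply]
    refine Finset.sum_eq_zero fun l _ => ?_
    by_cases hl : i.inA = l.inA
    · rw [hg'.2 l j (hl ▸ hij), mul_zero]
    · rw [hg.2 i l hl, zero_mul]

theorem localGroup_transpose {g : Matrix (Majorana m n) (Majorana m n) ℝ}
    (hg : g ∈ localGroup m n) : gᵀ ∈ localGroup m n :=
  ⟨by rw [Matrix.transpose_transpose]; exact localGroup_transpose_mul hg,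
    fun i j hij => hg.2 j i hij.symm⟩

theorem isCompact_localGroup : IsCompact (localGroup m n) := by
  have hcl : IsClosed (localGroup m n) := by
    have e : localGroup m n = {g | g * gᵀ = 1} ∩ ⋂ i, ⋂ j, ⋂ _ : i.inA ≠ j.inA,
        {g | g i j = 0} := by
      ext g
      simp [localGroup]
    rw [e]
    refine IsClosed.inter ?_ ?_
    · exact isClosed_eq (by fun_prop) continuous_const
    · refine isClosed_iInter fun i => isClosed_iInter fun j => isClosed_iInter fun _ => ?_
      exact isClosed_eq (continuous_id.matrix_elem i j) continuous_const
  have hc : IsCompact (Set.pi Set.univ fun _ : Majorana m n => Set.pi Set.univ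
      fun _ : Majorana m n => Set.Icc (-1 : ℝ) 1) :=
    isCompact_univ_pi fun _ => isCompact_univ_pi fun _ => isCompact_Icc
  refine hc.of_isClosed_subset hcl fun g hg i _ j _ => ?_
  have h1 : ∑ l, g i l * g i l = 1 :=
    (congrFun (congrFun hg.1 i) i).trans (Matrix.one_apply_eq i)
  have h2 : g i j * g i j ≤ 1 := h1 ▸ Finset.single_le_sum
    (f := fun l => g i l * g i l) (fun l _ => mul_self_nonneg _) (Finset.mem_univ j)
  exact ⟨by nlinarith, by nlinarith⟩

theorem det_one_add_conj {g Γ : Matrix (Majorana m n) (Majorana m n) ℝ}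
    (hg : g ∈ localGroup m n) : (1 + g * Γ * gᵀ).det = (1 + Γ).det := by
  have : 1 + g * Γ * gᵀ = g * (1 + Γ) * gᵀ := by
    rw [mul_add, add_mul, mul_one, hg.1]
  rw [this, Matrix.det_mul_right_comm, hg.1, one_mul]

end LocalGroup

/-! ### Second-order expansion and the matrix logarithm -/

section
open Filter Topology

section SecondOrder
variable {E : Type*} [NormedAddCommGroup E] [NormedSpace ℝ E]

/-- At a critical point, a step that increases a function is not a direction of strict decrease
of the Hessian. -/
theorem ContDiff.eventually_hessian_ge {f : E → ℝ} (hf : ContDiff ℝ 2 f)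
    (h0 : fderiv ℝ f 0 = 0) {ε : ℝ} (hε : 0 < ε) :
    ∀ᶠ v in 𝓝 (0 : E), f 0 < f v → -(ε * ‖v‖ ^ 2) ≤ fderiv ℝ (fderiv ℝ f) 0 v v := by
  have hd : HasFDerivAt (fderiv ℝ f) (fderiv ℝ (fderiv ℝ f) 0) 0 :=
    (((hf.fderiv_right (m := 1) (by norm_num)).differentiable (by norm_num)) 0).hasFDerivAt
  have ho := hd.isLittleO.def hε
  obtain ⟨δ, hδ, hball⟩ := Metric.eventually_nhds_iff_ball.mp ho
  filter_upwards [Metric.ball_mem_nhds (0 : E) hδ] with v hv hlt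
  have hline : ∀ t : ℝ, HasDerivAt (fun t : ℝ => f (t • v)) (fderiv ℝ f (t • v) v) t := fun t =>
    ((hf.differentiable (by norm_num) (t • v)).hasFDerivAt).comp_hasDerivAt t
      (by simpa using (hasDerivAt_id t).smul_const v)
  -- By the mean value theorem f(v) - f(0) is the derivative at sv in direction v, which is s times
  -- the Hessian up to sε‖v‖²; the common factor s > 0 drops out.
  obtain ⟨s, hs, hmv⟩ := exists_hasDerivAt_eq_slope (fun t : ℝ => f (t • v))
    (fun t => fderiv ℝ f (t • v) v) one_pos
    (fun t _ => (hline t).continuousAt.continuousWithinAt) fun t _ => hline t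
  simp only [one_smul, zero_smul, sub_zero, div_one] at hmv
  have hsv : s • v ∈ Metric.ball (0 : E) δ := by
    rw [mem_ball_zero_iff, norm_smul, Real.norm_of_nonneg hs.1.le]
    rw [mem_ball_zero_iff] at hv
    nlinarith [norm_nonneg v, hs.2]
  have hb := hball _ hsv
  rw [h0, sub_zero, sub_zero, map_smul] at hb
  have hb2 := (ContinuousLinearMap.le_opNorm (fderiv ℝ f (s • v) -
    s • fderiv ℝ (fderiv ℝ f) 0 v) v).trans (mul_le_mul_of_nonneg_right hb (norm_nonneg v))
  rw [norm_smul, Real.norm_of_nonneg hs.1.le] at hb2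
  have hb3 := (abs_le.mp hb2).2
  simp only [sub_apply, smul_apply, smul_eq_mul] at hb3
  have hpos : 0 < s * (fderiv ℝ (fderiv ℝ f) 0 v v + ε * ‖v‖ ^ 2) := by nlinarith
  have := pos_of_mul_pos_right hpos hs.1.le
  linarith

end SecondOrder

section Log
variable {κ : Type*} [Fintype κ] [DecidableEq κ]

attribute [local instance] Matrix.linftyOpNormedRing Matrix.linftyOpNormedAlgebra

theorem hasStrictFDerivAt_exp_zero_matrix :
    HasStrictFDerivAt (NormedSpace.exp : Matrix κ κ ℝ → Matrix κ κ ℝ)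
      ((ContinuousLinearEquiv.refl ℝ (Matrix κ κ ℝ) : Matrix κ κ ℝ ≃L[ℝ] Matrix κ κ ℝ) :
        Matrix κ κ ℝ →L[ℝ] Matrix κ κ ℝ) 0 :=
  hasStrictFDerivAt_exp_zero (𝕂 := ℝ)

/-- A local logarithm. -/
theorem exists_matrix_log : ∃ L : Matrix κ κ ℝ → Matrix κ κ ℝ, Tendsto L (𝓝 1) (𝓝 0) ∧
    (∀ᶠ g in 𝓝 (1 : Matrix κ κ ℝ), NormedSpace.exp (L g) = g) ∧
    ∀ᶠ M in 𝓝 (0 : Matrix κ κ ℝ), L (NormedSpace.exp M) = M := by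
  have h := hasStrictFDerivAt_exp_zero_matrix (κ := κ)
  have h1 := h.localInverse_tendsto
  have h2 := h.eventually_right_inverse
  have h3 := h.eventually_left_inverse
  rw [NormedSpace.exp_zero] at h1 h2
  exact ⟨_, h1, h2, h3⟩

/-- The linear approximation of the exponential at the origin. -/
theorem tendsto_exp_sub_one_div {K : ℕ → Matrix κ κ ℝ} {u : Matrix κ κ ℝ} {r : ℕ → ℝ}
    (hK : Tendsto K atTop (𝓝 0))
    (hu : Tendsto (fun k => (r k)⁻¹ • K k) atTop (𝓝 u)) :
    Tendsto (fun k => (r k)⁻¹ • (NormedSpace.exp (K k) - 1)) atTop (𝓝 u) := by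
  have h := (hasStrictFDerivAt_exp_zero_matrix (κ := κ)).hasFDerivAt
  have ho := h.isLittleO.comp_tendsto hK
  simp only [Function.comp_def, NormedSpace.exp_zero, sub_zero] at ho
  have ho2 : (fun k => (r k)⁻¹ • (NormedSpace.exp (K k) - 1 - K k)) =o[atTop]
      fun k => (r k)⁻¹ • K k := (Asymptotics.isBigO_refl (fun k => (r k)⁻¹) atTop).smul_isLittleO ho
  have ho3 := ho2.trans_isBigO (hu.isBigO_one ℝ)
  have h4 := ((Asymptotics.isLittleO_one_iff ℝ).mp ho3).add hu
  rw [zero_add] at h4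
  refine h4.congr fun k => ?_
  rw [← smul_add, sub_add_cancel]

end Log

end

/-! ### Logarithms inside the local group -/

section
open Filter Topology

section LocalLog
variable {m n : ℕ}

/-- The involution that distinguishes the two subsystems. -/
def subsystemSign (m n : ℕ) : Matrix (Majorana m n) (Majorana m n) ℝ :=
  Matrix.diagonal fun i => if i.inA then 1 else -1

theorem subsystemSign_mul_self : subsystemSign m n * subsystemSign m n = 1 := by
  rw [subsystemSign, Matrix.diagonal_mul_diagonal, ← Matrix.diagonal_one]
  congr 1
  funext i
  split_ifs <;> norm_num

theorem subsystemSign_conj_eq_iff {M : Matrix (Majorana m n) (Majorana m n) ℝ} :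
    subsystemSign m n * M * subsystemSign m n = M ↔ ∀ i j, i.inA ≠ j.inA → M i j = 0 := by
  rw [← Matrix.ext_iff]
  simp only [subsystemSign, Matrix.mul_diagonal, Matrix.diagonal_mul]
  refine forall₂_congr fun i j => ?_
  cases i.inA <;> cases j.inA <;> simp <;> constructor <;> intro h <;> linarith

theorem exp_subsystemSign_conj (M : Matrix (Majorana m n) (Majorana m n) ℝ) :
    NormedSpace.exp (subsystemSign m n * M * subsystemSign m n) =
      subsystemSign m n * NormedSpace.exp M * subsystemSign m n := by
  have hinv : (subsystemSign m n)⁻¹ = subsystemSign m n :=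
    Matrix.inv_eq_left_inv subsystemSign_mul_self
  have := Matrix.exp_conj (subsystemSign m n) M (IsUnit.of_mul_eq_one _ subsystemSign_mul_self)
  rwa [hinv] at this

theorem exp_mul_exp_transpose {κ : Type*} [Fintype κ] [DecidableEq κ] {M : Matrix κ κ ℝ}
    (hM : Mᵀ = -M) : NormedSpace.exp M * (NormedSpace.exp M)ᵀ = 1 := by
  rw [← Matrix.exp_transpose, hM, ← Matrix.exp_add_of_commute _ _ (Commute.refl M).neg_right,
    add_neg_cancel, NormedSpace.exp_zero]

theorem exp_genMatrix_mem (K : LocalGen m n) : NormedSpace.exp (genMatrix K) ∈ localGroup m n := by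
  refine ⟨exp_mul_exp_transpose (genMatrix_transpose K), subsystemSign_conj_eq_iff.mp ?_⟩
  have hb : subsystemSign m n * genMatrix K * subsystemSign m n = genMatrix K :=
    subsystemSign_conj_eq_iff.mpr K.2.2
  rw [← exp_subsystemSign_conj, hb]

/-- Elements of the local group close to the identity are exponentials of small generators. -/
theorem exists_localGen_log : ∃ L : Matrix (Majorana m n) (Majorana m n) ℝ →
    Matrix (Majorana m n) (Majorana m n) ℝ, Tendsto L (𝓝 1) (𝓝 0) ∧
    ∀ᶠ g in 𝓝 (1 : Matrix (Majorana m n) (Majorana m n) ℝ), g ∈ localGroup m n →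
      ∃ K : LocalGen m n, genMatrix K = L g ∧ NormedSpace.exp (genMatrix K) = g := by
  obtain ⟨L, h1, h2, h3⟩ := exists_matrix_log (κ := Majorana m n)
  refine ⟨L, h1, ?_⟩
  have t1 : Tendsto (fun g => (L g)ᵀ) (𝓝 1) (𝓝 0) := by
    have := (continuous_id.matrix_transpose (X := Matrix (Majorana m n) (Majorana m n) ℝ)).tendsto 0
    simp only [id, Matrix.transpose_zero] at this
    exact this.comp h1
  have t2 : Tendsto (fun g => -L g) (𝓝 1) (𝓝 0) := by simpa using h1.neg
  have t3 : Tendsto (fun g => subsystemSign m n * L g * subsystemSign m n) (𝓝 1) (𝓝 0) := by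
    have hc : Continuous fun M : Matrix (Majorana m n) (Majorana m n) ℝ =>
      subsystemSign m n * M * subsystemSign m n := by fun_prop
    have := hc.tendsto 0
    simp only [mul_zero, zero_mul] at this
    exact this.comp h1
  filter_upwards [h2, h1.eventually h3, t1.eventually h3, t2.eventually h3, t3.eventually h3]
    with g e0 e1 e2 e3 e4 hg
  -- Both sides are small and exponentiate to gᵀ = g⁻¹, so the local logarithm identifies them.
  have hskew : (L g)ᵀ = -L g := by
    rw [← e2, ← e3, Matrix.exp_transpose, Matrix.exp_neg, e0, Matrix.inv_eq_right_inv hg.1]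
  -- The same uniqueness applies, since g is fixed by conjugation with the involution.
  have hblk : subsystemSign m n * L g * subsystemSign m n = L g := by
    rw [← e4, exp_subsystemSign_conj, e0, subsystemSign_conj_eq_iff.mpr hg.2]
  exact ⟨⟨L g, fun i j => congrFun (congrFun hskew i) j, subsystemSign_conj_eq_iff.mp hblk⟩,
    rfl, e0⟩

end LocalLog

/-! ### Representatives closest to the identity -/

section LocalMax
variable {m n : ℕ}

theorem continuous_genMatrix : Continuous (genMatrix : LocalGen m n → _) := continuous_subtype_val

theorem eq_one_of_trace_ge {κ : Type*} [Fintype κ] [DecidableEq κ] {g : Matrix κ κ ℝ}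
    (hg : g * gᵀ = 1) (ht : (1 : Matrix κ κ ℝ).trace ≤ g.trace) : g = 1 := by
  have h1 : ((g - 1) * (g - 1)ᵀ).trace = 2 * ((1 : Matrix κ κ ℝ).trace - g.trace) := by
    rw [Matrix.transpose_sub, Matrix.transpose_one, sub_mul, mul_sub, hg, mul_one, one_mul]
    simp only [Matrix.trace_sub, Matrix.trace_transpose]
    ring
  have h2 : ((g - 1) * (g - 1)ᵀ).trace = ∑ i, ∑ j, (g - 1) i j ^ 2 := by
    simp only [Matrix.trace, Matrix.diag_apply, Matrix.mul_apply, Matrix.transpose_apply, sq]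
  have h3 : ∑ i, ∑ j, (g - 1) i j ^ 2 ≤ 0 := by linarith
  have h4 : ∑ i, ∑ j, (g - 1) i j ^ 2 = 0 := le_antisymm h3 (by positivity)
  rw [← sub_eq_zero]
  ext i j
  have h5 := (Finset.sum_eq_zero_iff_of_nonneg fun i _ =>
    Finset.sum_nonneg fun j _ => sq_nonneg ((g - 1) i j)).mp h4 i (Finset.mem_univ _)
  exact pow_eq_zero_iff two_ne_zero |>.mp ((Finset.sum_eq_zero_iff_of_nonneg fun j _ =>
    sq_nonneg ((g - 1) i j)).mp h5 j (Finset.mem_univ _))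

theorem eq_zero_of_trace_mul_self {κ : Type*} [Fintype κ] {M : Matrix κ κ ℝ}
    (hM : Mᵀ = -M) (ht : (M * M).trace = 0) : M = 0 := by
  have h2 : (M * M).trace = -∑ i, ∑ j, M i j ^ 2 := by
    have h3 : ∀ i j, M j i = -M i j := fun i j => congrFun (congrFun hM i) j
    simp only [Matrix.trace, Matrix.diag_apply, Matrix.mul_apply, ← Finset.sum_neg_distrib]
    refine Finset.sum_congr rfl fun i _ => Finset.sum_congr rfl fun j _ => ?_
    rw [h3 i j]; ring
  have h4 : ∑ i, ∑ j, M i j ^ 2 = 0 := by linarith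
  ext i j
  have h5 := (Finset.sum_eq_zero_iff_of_nonneg fun i _ =>
    Finset.sum_nonneg fun j _ => sq_nonneg (M i j)).mp h4 i (Finset.mem_univ _)
  exact pow_eq_zero_iff two_ne_zero |>.mp ((Finset.sum_eq_zero_iff_of_nonneg fun j _ =>
    sq_nonneg (M i j)).mp h5 j (Finset.mem_univ _))

/-- The elements carrying Γ to Γ' form a compact coset of the stabilizer, on which the trace attains
a maximum. For orthogonal g, ‖g - 1‖² = 2(tr 1 - tr g) in the Frobenius norm, so this picks a
closest element to the identity. -/
theorem exists_representative {Γ Γ' : Matrix (Majorana m n) (Majorana m n) ℝ}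
    (h : Γ' ∈ localOrbit Γ) : ∃ g ∈ localGroup m n, Γ' = g * Γ * gᵀ ∧
      ∀ x ∈ localGroup m n, x * Γ * xᵀ = Γ → (g * x).trace ≤ g.trace := by
  obtain ⟨g₀, hg₀, e₀⟩ := exists_localGroup_of_mem_localOrbit h
  have hc : IsCompact (localGroup m n ∩ {g | g * Γ * gᵀ = Γ'}) :=
    isCompact_localGroup.inter_right (isClosed_eq (by fun_prop) continuous_const)
  obtain ⟨g, hg, hmax⟩ := hc.exists_isMaxOn ⟨g₀, hg₀, e₀.symm⟩
    (f := Matrix.trace) (by fun_prop : Continuous fun g : Matrix (Majorana m n) (Majorana m n) ℝ =>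
      g.trace).continuousOn
  refine ⟨g, hg.1, hg.2.symm, fun x hx hxΓ => hmax ⟨localGroup_mul hg.1 hx, ?_⟩⟩
  have hg2 : g * Γ * gᵀ = Γ' := hg.2
  calc g * x * Γ * (g * x)ᵀ = g * (x * Γ * xᵀ) * gᵀ := by
        simp only [Matrix.transpose_mul, Matrix.mul_assoc]
    _ = Γ' := by rw [hxΓ, hg2]

/-- The curve exp(tu) stays in the stabilizer, so tr(g exp(tu)) is maximal at t = 0 and its
derivative there vanishes. This is the slice condition transverse to the stabilizer. -/
theorem trace_mul_genMatrix_eq_zero {Γ g : Matrix (Majorana m n) (Majorana m n) ℝ}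
    (hmax : ∀ x ∈ localGroup m n, x * Γ * xᵀ = Γ → (g * x).trace ≤ g.trace) {u : LocalGen m n}
    (hu : genMatrix u * Γ - Γ * genMatrix u = 0) : (g * genMatrix u).trace = 0 := by
  have hd : HasDerivAt (fun t : ℝ => (g * NormedSpace.exp (t • genMatrix u)).trace)
      ((g * genMatrix u).trace) 0 := by
    simp only [Matrix.trace, Matrix.diag_apply, Matrix.mul_apply]
    refine HasDerivAt.fun_sum fun i _ => HasDerivAt.fun_sum fun j _ => ?_
    have := (hasDerivAt_exp_smul_apply (genMatrix u) 0 j i).const_mul (g i j)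
    rwa [zero_smul, NormedSpace.exp_zero, one_mul] at this
  refine IsLocalMax.hasDerivAt_eq_zero (Filter.Eventually.of_forall fun t => ?_) hd
  simp only [zero_smul, NormedSpace.exp_zero, mul_one]
  have hmem := exp_genMatrix_mem (t • u)
  rw [genMatrix_smul] at hmem
  refine hmax _ hmem ?_
  have hc : Commute (t • genMatrix u) Γ := (show Commute (genMatrix u) Γ from sub_eq_zero.mp hu).smul_left t
  rw [hc.exp_left.eq, Matrix.mul_assoc, hmem.1, mul_one]

end LocalMax

end

/-! ### The local maximum -/

section
open Filter Topology

section LocalMax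
variable {m n : ℕ}

/-- A slice argument by contradiction: the Hessian degenerates only along the stabilizer, and the
choice of representatives excludes approach along these directions. -/
theorem isLocalMaxOn_localOrbit (h : m ≤ n) {α : ℝ} (hα : 1 < α) {ν μ : Fin m → ℝ}
    (hμ : ∀ k, μ k ^ 2 = 1 - ν k ^ 2) :
    IsLocalMaxOn (pfaffianSum α) (localOrbit (canonicalCov ν μ))
      (canonicalCov ν μ : Matrix (Majorana m n) (Majorana m n) ℝ) := by
  set Γ : Matrix (Majorana m n) (Majorana m n) ℝ := canonicalCov ν μ with hΓ
  by_contra hcon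
  have hfreq : ∃ᶠ x in 𝓝[localOrbit Γ] Γ, pfaffianSum α Γ < pfaffianSum α x ∧ x ∈ localOrbit Γ := by
    refine Frequently.and_eventually ?_ self_mem_nhdsWithin
    refine (not_eventually.mp hcon).mono fun x hx => not_le.mp hx
  have : FirstCountableTopology (Matrix (Majorana m n) (Majorana m n) ℝ) :=
    inferInstanceAs (FirstCountableTopology (Majorana m n → Majorana m n → ℝ))
  obtain ⟨Γs, hΓs, hlt⟩ := exists_seq_forall_of_frequently hfreq
  have hΓs' : Tendsto Γs atTop (𝓝 Γ) := hΓs.mono_right nhdsWithin_le_nhds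
  choose g hg he hmax using fun k => exists_representative (hlt k).2
  obtain ⟨g₀, hg₀, ns, hns, hlim⟩ := isCompact_localGroup.tendsto_subseq hg
  have hstab : g₀ * Γ * g₀ᵀ = Γ := by
    have hc : Continuous fun x : Matrix (Majorana m n) (Majorana m n) ℝ => x * Γ * xᵀ := by fun_prop
    refine tendsto_nhds_unique ((hc.tendsto g₀).comp hlim) ?_
    refine (hΓs'.comp hns.tendsto_atTop).congr fun k => ?_
    exact he (ns k)
  -- Since g₀ stabilizes Γ, so does g₀ᵀ. Maximality gives tr(g g₀ᵀ) ≤ tr g along the sequence, hence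
  -- tr 1 ≤ tr g₀ in the limit.
  have hone : g₀ = 1 := by
    refine eq_one_of_trace_ge hg₀.1 ?_
    have hc1 : Continuous fun x : Matrix (Majorana m n) (Majorana m n) ℝ => (x * g₀ᵀ).trace := by
      fun_prop
    have hc2 : Continuous fun x : Matrix (Majorana m n) (Majorana m n) ℝ => x.trace := by fun_prop
    have hle := le_of_tendsto_of_tendsto' ((hc1.tendsto g₀).comp hlim) ((hc2.tendsto g₀).comp hlim)
      fun k => hmax (ns k) g₀ᵀ (localGroup_transpose hg₀) (by
        rw [Matrix.transpose_transpose]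
        conv_lhs => rw [← hstab]
        rw [← Matrix.mul_assoc, ← Matrix.mul_assoc, localGroup_transpose_mul hg₀, one_mul,
          Matrix.mul_assoc, localGroup_transpose_mul hg₀, mul_one])
    simpa only [hg₀.1] using hle
  rw [hone] at hlim
  obtain ⟨L, hL, hlog⟩ := exists_localGen_log (m := m) (n := n)
  obtain ⟨N, hN⟩ := eventually_atTop.mp (hlim.eventually hlog)
  choose K hKL hKexp using fun k => hN (k + N) (Nat.le_add_left N k) (hg (ns (k + N)))
  have hKmat : Tendsto (fun k => genMatrix (K k)) atTop (𝓝 0) := by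
    refine (((hL.comp hlim).comp (tendsto_add_atTop_nat N))).congr fun k => ?_
    exact (hKL k).symm
  have hK0 : Tendsto K atTop (𝓝 0) := tendsto_subtype_rng.mpr hKmat
  have hf : ∀ k, orbitF α Γ 0 < orbitF α Γ (K k) := by
    intro k
    have h0 : orbitF α Γ 0 = pfaffianSum α Γ := by
      have : genMatrix (0 : LocalGen m n) = 0 := rfl
      rw [orbitF, this, NormedSpace.exp_zero, one_mul, Matrix.transpose_one, mul_one]
    have h1 : orbitF α Γ (K k) = pfaffianSum α (Γs (ns (k + N))) := by
      rw [orbitF, hKexp, he (ns (k + N))]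
      rfl
    rw [h0, h1]
    exact (hlt _).1
  have hKne : ∀ k, K k ≠ 0 := fun k h0 => by
    have := hf k
    rw [h0] at this
    exact lt_irrefl _ this
  have hsph : ∀ k, ‖K k‖⁻¹ • K k ∈ Metric.sphere (0 : LocalGen m n) 1 := fun k => by
    rw [mem_sphere_zero_iff_norm, norm_smul, norm_inv, norm_norm,
      inv_mul_cancel₀ (norm_ne_zero_iff.mpr (hKne k))]
  obtain ⟨u, hu, ks, hks, hulim⟩ := (isCompact_sphere (0 : LocalGen m n) 1).tendsto_subseq hsph
  have hfd : fderiv ℝ (orbitF α Γ) 0 = 0 := by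
    ext v
    exact (orbitF_derivs_eq h hα hμ v).1
  have hHu : 0 ≤ orbitHessian α Γ u u := by
    have hc : Continuous fun v : LocalGen m n => fderiv ℝ (fderiv ℝ (orbitF α Γ)) 0 v v :=
      (fderiv ℝ (fderiv ℝ (orbitF α Γ)) 0).continuous.clm_apply continuous_id
    -- The second-order lower bound along K is divided by ‖K‖² and passes to the limit for each ε.
    refine le_of_forall_pos_sub_le fun ε hε => ?_
    rw [zero_sub]
    refine ge_of_tendsto ((hc.tendsto u).comp hulim) ?_
    filter_upwards [(hK0.comp hks.tendsto_atTop).eventually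
      ((contDiff_orbitF hα Γ).eventually_hessian_ge hfd hε)] with k hk
    have h2 := hk (hf (ks k))
    have hpos : 0 < ‖K (ks k)‖ := norm_pos_iff.mpr (hKne _)
    simp only [Function.comp_apply, map_smul, smul_apply, smul_eq_mul] at h2 ⊢
    rw [← sub_nonneg] at h2 ⊢
    have : ‖K (ks k)‖⁻¹ * (‖K (ks k)‖⁻¹ * fderiv ℝ (fderiv ℝ (orbitF α Γ)) 0 (K (ks k)) (K (ks k))) - -ε =
        (‖K (ks k)‖⁻¹) ^ 2 * (fderiv ℝ (fderiv ℝ (orbitF α Γ)) 0 (K (ks k)) (K (ks k)) -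
          -(ε * ‖K (ks k)‖ ^ 2)) := by
      field_simp
    rw [this]
    positivity
  have hcomm := (orbitHessian_nonpos h hα hμ u).2
    (le_antisymm (orbitHessian_nonpos h hα hμ u).1 hHu)
  have htr : ∀ k, (NormedSpace.exp (genMatrix (K k)) * genMatrix u).trace = 0 := fun k => by
    rw [hKexp]
    exact trace_mul_genMatrix_eq_zero (hmax (ns (k + N))) hcomm
  have htu : (genMatrix u).trace = 0 := by
    have := congrArg Matrix.trace (genMatrix_transpose u)
    rw [Matrix.trace_transpose, Matrix.trace_neg] at this
    linarith
  have hlim2 := tendsto_exp_sub_one_div (r := fun k => ‖K (ks k)‖) (hKmat.comp hks.tendsto_atTop)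
    ((continuous_genMatrix.tendsto u).comp hulim)
  have hc : Continuous fun x : Matrix (Majorana m n) (Majorana m n) ℝ => (x * genMatrix u).trace := by
    fun_prop
  -- The trace of (exp K - 1)u is 0 for every term; divided by ‖K‖, it converges to tr(u²).
  have hzero : (genMatrix u * genMatrix u).trace = 0 := by
    refine tendsto_nhds_unique ((hc.tendsto _).comp hlim2) (tendsto_const_nhds.congr fun k => ?_)
    simp only [Function.comp_apply, Matrix.smul_mul, Matrix.trace_smul, sub_mul, one_mul,
      Matrix.trace_sub, htr, htu, sub_zero, smul_zero]
  have hu0 : u = 0 := Subtype.ext (eq_zero_of_trace_mul_self (genMatrix_transpose u) hzero)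
  rw [hu0, mem_sphere_zero_iff_norm, norm_zero] at hu
  exact zero_ne_one hu

end LocalMax

end

/-! ### The local minimum of the magic, and the theorem -/

section LocalMin
variable {m n : ℕ}

/-- The determinant of 1 + Γ is constant on the orbit, so the magic is an affine function of log
F_α; its slope 1/(1 - α) is negative and turns the maximum into a minimum. -/
theorem isLocalMinOn_gaussianMagic (h : m ≤ n) {α : ℝ} (hα : 1 < α) {ν μ : Fin m → ℝ}
    (hμ : ∀ k, μ k ^ 2 = 1 - ν k ^ 2) :
    IsLocalMinOn (gaussianMagic α) (localOrbit (canonicalCov ν μ))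
      (canonicalCov ν μ : Matrix (Majorana m n) (Majorana m n) ℝ) := by
  have hskew := canonicalCov_skew (m := m) (n := n) ν μ
  have hs : (canonicalCov ν μ : Matrix (Majorana m n) (Majorana m n) ℝ)ᵀ = -canonicalCov ν μ := by
    ext i j; exact hskew i j
  have hdet := det_one_add_of_mul_self hs (canonicalCov_mul_self h hμ) card_majorana
  filter_upwards [isLocalMaxOn_localOrbit h hα hμ, self_mem_nhdsWithin] with Γ' hle hmem
  obtain ⟨g, hg, rfl⟩ := exists_localGroup_of_mem_localOrbit hmem
  have hskew' := conj_skew hskew g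
  rw [gaussianMagic_eq hα hskew hdet,
    gaussianMagic_eq hα hskew' (by rw [det_one_add_conj hg, hdet])]
  have hlog := Real.log_le_log (pfaffianSum_pos hskew' α) hle
  exact mul_le_mul_of_nonpos_left (by linarith) (one_div_nonpos.mpr (by linarith))

end LocalMin

theorem mainTheorem2 (m n : ℕ) (hmn : m ≤ n) (α : ℝ) (hα : 1 < α) (ν μ : Fin m → ℝ)
    (hν : ∀ k, 0 ≤ ν k ∧ ν k ≤ 1) (hμ : ∀ k, μ k ^ 2 = 1 - ν k ^ 2)
    (Γ : Matrix (Majorana m n) (Majorana m n) ℝ) (hΓ : Γ = canonicalCov ν μ) :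
    -- critical point, and local maximum of `F_α` on the local Gaussian orbit
    (ContDiffAt ℝ 2 (orbitF α Γ) (0 : LocalGen m n) ∧ HasFDerivAt (orbitF α Γ) (0 : LocalGen m n →L[ℝ] ℝ) 0 ∧
      IsLocalMaxOn (pfaffianSum α) (localOrbit Γ) Γ) ∧
    -- the nonlocal magic bound is a local minimum of the magic along the orbit
    (gaussianMagic α Γ = nonlocalMagicBound α ν μ ∧
      IsLocalMinOn (gaussianMagic α) (localOrbit Γ) Γ) ∧
    -- sign-flip symmetries
    (∀ c : Fin n,
      signFlip hmn c * Γ * (signFlip hmn c)ᵀ = Γ ∧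
      (∀ Γ' : Matrix (Majorana m n) (Majorana m n) ℝ, Γ'ᵀ = -Γ' →
        pfaffianSum α (signFlip hmn c * Γ' * (signFlip hmn c)ᵀ) = pfaffianSum α Γ') ∧
      (∀ K K' : LocalGen m n,
        orbitHessian α Γ (flipGen hmn c K) (flipGen hmn c K') = orbitHessian α Γ K K') ∧
      (∀ (d e : Fin n) (K : LocalGen m n), K ∈ channel hmn d e →
        flipGen hmn c K = if (d = c ↔ e = c) then K else -K)) ∧
    -- decoupling of the Hessian into intra-block and two-block channels
    (∀ (c d e f : Fin n) (K K' : LocalGen m n), s(c, d) ≠ s(e, f) →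
      K ∈ channel hmn c d → K' ∈ channel hmn e f → orbitHessian α Γ K K' = 0) ∧
    (∀ K : LocalGen m n, orbitHessian α Γ K K =
      (∑ c : Fin n, orbitHessian α Γ (channelPart hmn c c K) (channelPart hmn c c K)) +
      ∑ p : Fin n × Fin n with p.1 < p.2,
        orbitHessian α Γ (channelPart hmn p.1 p.2 K) (channelPart hmn p.1 p.2 K)) ∧
    -- the Hessian is negative semidefinite
    (∀ K : LocalGen m n, orbitHessian α Γ K K ≤ 0) ∧
    -- for `α = 2` the two-block Hessians in `8` parameters are negative definite
    (∀ c d : Fin m, c ≠ d →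
      Module.finrank ℝ (channel hmn (Fin.castLE hmn c) (Fin.castLE hmn d)) = 8 ∧
      (α = 2 → ∀ K ∈ channel hmn (Fin.castLE hmn c) (Fin.castLE hmn d),
        (ν c ≠ ν d → K ≠ 0 → orbitHessian α Γ K K < 0) ∧
        (genMatrix K * Γ - Γ * genMatrix K ≠ 0 → orbitHessian α Γ K K < 0))) := by
  subst hΓ
  refine ⟨⟨(contDiff_orbitF hα _).contDiffAt, ?_, isLocalMaxOn_localOrbit hmn hα hμ⟩,
    ⟨gaussianMagic_canonicalCov hmn hα hμ, isLocalMinOn_gaussianMagic hmn hα hμ⟩,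
    fun c => ⟨signFlip_canonicalCov hmn c ν μ, fun Γ' hΓ' => pfaffianSum_signFlip hmn c α hΓ',
      orbitHessian_flipGen hmn hα hμ c, fun d e K hK => flipGen_of_channel hmn c hK⟩,
    fun c d e f K K' hne hK hK' => orbitHessian_eq_zero_of_channel hmn hα hμ hne hK hK',
    orbitHessian_eq_sum_channels hmn hα hμ, fun K => (orbitHessian_nonpos hmn hα hμ K).1,
    fun c d hcd => ⟨finrank_channel hmn hcd, fun _ K hK => ?_⟩⟩
  · have hd := ((contDiff_orbitF hα (canonicalCov ν μ : Matrix (Majorana m n) (Majorana m n) ℝ)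
      ).differentiable (by norm_num) 0).hasFDerivAt
    have h0 : fderiv ℝ (orbitF α (canonicalCov ν μ)) (0 : LocalGen m n) = 0 := by
      ext v
      exact (orbitF_derivs_eq hmn hα hμ v).1
    rwa [h0] at hd
  -- Strict negativity follows from semidefiniteness, because null vectors of the form commute with
  -- Γ.
  · have hneg : genMatrix K * canonicalCov ν μ - canonicalCov ν μ * genMatrix K ≠ 0 →
        orbitHessian α (canonicalCov ν μ) K K < 0 := fun hne =>
      lt_of_le_of_ne (orbitHessian_nonpos hmn hα hμ K).1 fun h0 =>
        hne ((orbitHessian_nonpos hmn hα hμ K).2 h0)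
    refine ⟨fun hν' hK0 => hneg fun h0 => hK0 (eq_zero_of_commutator_eq_zero hmn ?_ hK h0), hneg⟩
    -- The vanishing criterion needs distinct squares; for nonnegative parameters this is the same
    -- as being distinct.
    exact fun hsq => hν' ((pow_left_inj₀ (hν c).1 (hν d).1 two_ne_zero).mp hsq)
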